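/- Write $\{x\}=x-x^{-1}$, $D=\{A\}/\{q\}$, $\phi=A\{q\}$, $\bar\phi=-A^{-1}\{q\}$, and for $n\in\mathbb Z$, $k\in\mathbb Z_{\ge 0}$ $$\bar\Theta_{n,k}=\frac{(D+\bar\phi)^k(1+\phi D)^{n-k}-\bar\phi^{\,k}}{D}.$$ Let $H(q,A)$ be the HOMFLY polynomial of oriented links with $A\,H(L_+)-A^{-1}H(L_-)=\{q\}H(L_0)$ and $H(\text{unknot})=D$; equivalently, $H$ is the Laurent polynomial in $A$ over $\mathbb Q(q)$ whose value at $A=q^N$ is the Reshetikhin–Turaev invariant of the fundamental representation of $\mathfrak{sl}_q(N)$, for all $N\ge1$. **Diagrams.** A *lock* is a clasp (two crossings) of two antiparallel arcs. On two vertical antiparallel strands, a *horizontal lock* consists of two consecutive positive half twists, and an *opposite horizontal lock* is its inverse. A *vertical lock* is the horizontal lock rotated by $90^\circ$, so that its two arcs join the two upper ends and the two lower ends; its two crossings are positive in the antiparallel orientation. An *opposite vertical lock* is the same with negative crossings. A chain of $j$ horizontal locks is the braid of $2j$ half twists ($j\in\mathbb Z$). Take eight vertical strands $0,\dots,7$.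 At the bottom, join the pairs $(0,7),(1,6),(2,3),(4,5)$. On top of this put a lower row with a $q$-box on strands $1,2$, the opposite chain of $j$ horizontal locks on $3,4$, and the chain of $j$ horizontal locks on $5,6$. Above it put an upper row with the opposite chain of $i$ horizontal locks on $0,1$, the chain of $i$ horizontal locks on $2,3$, and a $p$-box on $4,5$. At the top, join the pairs $(0,5),(1,2),(3,4),(6,7)$. Orient the link so that at the bottom strands $0,2,6$ go up and $1,3,7$ go down, and strand $4$ goes up and $5$ down if the number of half twists in the $p$-box is even, conversely if it is odd. Then the strands in both boxes are antiparallel. With $p$ and $q$ half twists in the boxes this is the Kanenobu link $\mathrm{Kan}(p,q,2j,2i)$, and $\mathrm{Kan}(p,q)=\mathrm{Kan}(p,q,2,2)$ is the usual Kanenobu knot. If instead the $p$-box is an arbitrary vertical stack of half twists of either sign and exactly $l$ opposite vertical locks, and the $q$-box is such a stack with exactly $k$ opposite vertical locks, the result is $\mathrm{KanGen}(p,q,2k,2l,2j,2i)$. Here $p$ is the signed number of half twists in the $p$-box plus $2l$, and $q$ is the signed number of half twists in the $q$-box plus $2k$. Write $\mathrm{KanGen}(p,q,2k,2l)$ for $j=i=1$.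 **Theorem.** Let $p=2m+\varepsilon_1$, $q=2n+\varepsilon_2$ with $m,n\in\mathbb Z$, $\varepsilon_1,\varepsilon_2\in\{0,1\}$, let $i,j\in\mathbb Z$ and $k,l\ge0$. 1. For every choice of the stacks, $$\begin{aligned}H^{\mathrm{KanGen}(2m+\varepsilon_1,2n+\varepsilon_2,2k,2l,2j,2i)}&=A^{-2m-2n+4k+4l}\Big(\bar\phi^{\,k+l}H^{\mathrm{Kan}(\varepsilon_1,\varepsilon_2,2j,2i)}+D^2\big(\bar\phi^{\,l}\bar\Theta_{n,k}+\bar\phi^{\,k}\bar\Theta_{m,l}+\bar\Theta_{n,k}\bar\Theta_{m,l}D\big)\Big)\\&=A^{-2m-2n+4k+4l}\Big(\bar\phi^{\,k+l}H^{\mathrm{Kan}(\varepsilon_1,\varepsilon_2,2j,2i)}+D^2\,\bar\Theta_{n+m,k+l}\Big).\end{aligned}$$ 2. Consequently, for fixed $i$, $j$, fixed $k+l$ and fixed parities of $p$ and $q$, the polynomial $H$ depends only on $p+q$. For $i=j=1$ and fixed $k+l$, the two families with $p+q$ odd moreover coincide: $H^{\mathrm{KanGen}(2m+1,2n,2k,2l)}=H^{\mathrm{KanGen}(2m,2n+1,2k,2l)}$.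 3. Let $i=j=1$, $p=2m$, $q=2n$, and replace the opposite horizontal lock on strands $0,1$ by a vertical lock. Denote the resulting link by $\mathrm{Def}(2m,2n,2k,2l)$, and let $\mathrm{Def}(0,0)$ be the one with empty boxes. Put $$P^{DB}=D(1+\phi^2+2\phi D),\qquad P^{\mathrm{def}}=D(D+\phi)\big\{(D+\bar\phi)(1+\phi(D+\phi))+\phi\big\}+D\phi\bar\phi(1+\phi D).$$ Then $$H^{\mathrm{Def}(2m,2n,2k,2l)}=A^{-2m-2n+4k+4l}\Big(\bar\phi^{\,k+l}H^{\mathrm{Def}(0,0)}+A^{-4}\big(\bar\phi^{\,k}\bar\Theta_{m,l}P^{\mathrm{def}}+\bar\phi^{\,l}\bar\Theta_{n,k}P^{DB}+\bar\Theta_{n,k}\bar\Theta_{m,l}P^{DB}D\big)\Big),$$ and the dependence on $p+q$ only is lost: for fixed $k$ and $l$ and $m+n=m'+n'$, one has $H^{\mathrm{Def}(2m,2n,2k,2l)}=H^{\mathrm{Def}(2m',2n',2k,2l)}$ if and only if $m=m'$ and $n=n'$. -/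

import Mathlib

namespace KanenobuHomfly

/-! ## Oriented link diagrams

A diagram is drawn in the plane so that its height function is generic, and is read from bottom to
top as a list of elementary layers.  Strands at a given height are numbered from left to right,
starting with `0`. An orientation is a Boolean: `true` is upward, `false` is downward. -/

/-- Elementary layers of a diagram. -/
inductive Layer : Type
  /-- A local minimum: two new strands, at positions `i` and `i + 1`; the left one is oriented by
  `o`, the right one oppositely. -/
  | cup (i : ℕ) (o : Bool)
  /-- A local maximum: the strands `i` and `i + 1` are joined. -/
  | cap (i : ℕ)
  /-- The strands `i` and `i + 1` cross. If `slash` is `true`, the strand that runs from bottom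
  left to top right passes over, otherwise the one from bottom right to top left does. -/
  | cross (i : ℕ) (slash : Bool)

/-- Whether a crossing is positive. A crossing with `slash = true` is positive if its two strands
are both oriented upward or both downward, and is negative if they are antiparallel. -/
def isPositive (slash o₁ o₂ : Bool) : Bool := slash == (o₁ == o₂)

/-- The sign `±1` of a crossing. -/
def crossingSign (slash o₁ o₂ : Bool) : ℤ := if isPositive slash o₁ o₂ then 1 else -1

/-- The orientations above a layer, given those below it; `none` if the layer does not fit. -/
def Layer.next : Layer → List Bool → Option (List Bool)
  | .cup i o, s => if i ≤ s.length then some (s.take i ++ o :: (!o) :: s.drop i) else none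
  | .cap i, s =>
    match s.drop i with
    | o₁ :: o₂ :: t => if o₂ = !o₁ then some (s.take i ++ t) else none
    | _ => none
  | .cross i _, s =>
    match s.drop i with
    | o₁ :: o₂ :: t => some (s.take i ++ o₂ :: o₁ :: t)
    | _ => none

/-- The contribution of a layer to the writhe. -/
def Layer.sign : Layer → List Bool → ℤ
  | .cross i slash, s =>
    match s.drop i with
    | o₁ :: o₂ :: _ => crossingSign slash o₁ o₂
    | _ => 0
  | _, _ => 0

/-- The orientations above a list of layers, given those below it. -/
def endOrientation : List Layer → List Bool → Option (List Bool)
  | [], s => some s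
  | L :: w, s => (L.next s).bind (endOrientation w)

/-- The list of layers is a (closed) oriented link diagram. -/
def IsLinkDiagram (w : List Layer) : Prop := endOrientation w [] = some []

/-- The sum of the signs of the crossings of the layers, which start at orientations `s`. -/
def writheFrom : List Layer → List Bool → ℤ
  | [], _ => 0
  | L :: w, s => L.sign s + ((L.next s).map (writheFrom w)).getD 0

/-- The writhe of a diagram. -/
def writhe (w : List Layer) : ℤ := writheFrom w []

/-! ## The Reshetikhin–Turaev state sum for the fundamental representation of `sl_q(N)` -/

section StateSum

variable {K : Type*} [Field K] (q : K) (N : ℕ)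

/-- The diagonal entries `q ^ (1 - N), q ^ (3 - N), …, q ^ (N - 1)` of the pivotal element;
their sum is `[N]`. -/
def pivot (a : Fin N) : K := q ^ (2 * ((a : ℕ) : ℤ) + 1 - (N : ℤ))

/-- The weight of a local minimum of colour `a` whose left strand is oriented by `o`. -/
def cupWeight (o : Bool) (a : Fin N) : K := if o then 1 else (pivot q N a)⁻¹

/-- The weight of a local maximum of colour `a` whose left strand is oriented by `o`. -/
def capWeight (o : Bool) (a : Fin N) : K := if o then pivot q N a else 1

/-- The order of colours that occurs in the `R`-matrix (`pos = true`) and in its inverse. -/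
def below {N : ℕ} (pos : Bool) (a b : Fin N) : Bool := if pos then decide (a < b) else decide (b < a)

/-- The matrix entries of a crossing whose bottom left, bottom right, top left and top right ends
carry the colours `a`, `b`, `c`, `d`; the bottom left and bottom right ends are oriented by
`o₁` and `o₂`. For two upward strands this is the `R`-matrix of the fundamental
representation, with eigenvalues `q` and `-q⁻¹`, or its inverse; for the other orientations it is
obtained from it by rotating the crossing with the help of cups and caps. -/
def crossWeight (slash o₁ o₂ : Bool) (a b c d : Fin N) : K :=
  let pos := isPositive slash o₁ o₂
  let z : K := if pos then q - q⁻¹ else -(q - q⁻¹)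
  if c = b ∧ d = a then
    if a = b then (if pos then q else q⁻¹) else 1
  else
    match o₁, o₂ with
    | true, true => if c = a ∧ d = b ∧ below pos a b then z else 0
    | false, false => if c = a ∧ d = b ∧ below pos b a then z else 0
    | true, false =>
      if b = a ∧ d = c ∧ below pos c a then z * pivot q N a * (pivot q N c)⁻¹ else 0
    | false, true => if b = a ∧ d = c ∧ below pos a c then z else 0

/-- The sum over all colourings of the layers by `N` colours, with the orientations and colours
`s` prescribed at the bottom and no strands at the top, of the products of local weights. -/
def stateSum : List Layer → List (Bool × Fin N) → K
  | [], [] => 1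
  | [], _ :: _ => 0
  | .cup i o :: w, s =>
    if i ≤ s.length then
      ∑ a : Fin N, cupWeight q N o a * stateSum w (s.take i ++ (o, a) :: (!o, a) :: s.drop i)
    else 0
  | .cap i :: w, s =>
    match s.drop i with
    | (o₁, a) :: (o₂, b) :: t =>
      if o₂ = !o₁ ∧ b = a then capWeight q N o₁ a * stateSum w (s.take i ++ t) else 0
    | _ => 0
  | .cross i slash :: w, s =>
    match s.drop i with
    | (o₁, a) :: (o₂, b) :: t =>
      ∑ c : Fin N, ∑ d : Fin N,
        crossWeight q N slash o₁ o₂ a b c d * stateSum w (s.take i ++ (o₂, c) :: (o₁, d) :: t)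
    | _ => 0

/-- The `sl_q(N)` polynomial of a diagram in the vertical framing, unnormalised: an unknotted
circle gives `[N]`. -/
def verticalPolynomial (w : List Layer) : K := stateSum q N w []

/-- The `sl_q(N)` polynomial of a diagram in the topological framing. -/
def topologicalPolynomial (w : List Layer) : K :=
  (q ^ N) ^ (-writhe w) * verticalPolynomial q N w

end StateSum

/-! ## The HOMFLY polynomial -/

/-- The field `ℚ(q)`. -/
abbrev Kq : Type := RatFunc ℚ

/-- The field `ℚ(q)(A)`. -/
abbrev KqA : Type := RatFunc Kq

/-- The variable `q` of `ℚ(q)`. -/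
noncomputable def q₀ : Kq := RatFunc.X

/-- The variable `q` as an element of `ℚ(q)(A)`. -/
noncomputable def q : KqA := RatFunc.C q₀

/-- The variable `A`. -/
noncomputable def A : KqA := RatFunc.X

theorem q₀_ne_zero : q₀ ≠ 0 := RatFunc.X_ne_zero

theorem A_ne_zero : A ≠ 0 := RatFunc.X_ne_zero

/-- The inclusion of the Laurent polynomials in `A` over `ℚ(q)` into `ℚ(q)(A)`. -/
noncomputable def laurentToField : LaurentPolynomial Kq →+* KqA :=
  LaurentPolynomial.eval₂ RatFunc.C (Units.mk0 A A_ne_zero)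

/-- The substitution `A = q ^ N` in Laurent polynomials in `A` over `ℚ(q)`. -/
noncomputable def specialize (N : ℕ) : LaurentPolynomial Kq →+* Kq :=
  LaurentPolynomial.eval₂ (RingHom.id Kq) (Units.mk0 (q₀ ^ N) (pow_ne_zero N q₀_ne_zero))

/-- `H` is the (unnormalised) HOMFLY polynomial of the oriented link diagram `w`: the Laurent
polynomial in `A` over `ℚ(q)` whose value at `A = q ^ N` is the `sl_q(N)` polynomial of `w` for
every `N ≥ 1`. -/
def IsHomfly (w : List Layer) (H : KqA) : Prop :=
  IsLinkDiagram w ∧ ∃ F : LaurentPolynomial Kq, laurentToField F = H ∧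
    ∀ N : ℕ, 1 ≤ N → specialize N F = topologicalPolynomial q₀ N w

open Classical in
/-- The (unnormalised) HOMFLY polynomial of a diagram. -/
noncomputable def homfly (w : List Layer) : KqA :=
  if h : ∃ H, IsHomfly w H then h.choose else 0

theorem q₀_pow_injective : Function.Injective fun N : ℕ => q₀ ^ N := by
  intro M N h
  have h' : algebraMap (Polynomial ℚ) Kq (Polynomial.X ^ M) =
      algebraMap (Polynomial ℚ) Kq (Polynomial.X ^ N) := by
    simpa [q₀, RatFunc.algebraMap_X] using h
  have h'' := RatFunc.algebraMap_injective ℚ h'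
  simpa using congrArg Polynomial.natDegree h''

/-- A diagram has at most one HOMFLY polynomial. -/
theorem IsHomfly.unique {w : List Layer} {H H' : KqA} (h : IsHomfly w H) (h' : IsHomfly w H') :
    H = H' := by
  obtain ⟨-, F, rfl, hF⟩ := h
  obtain ⟨-, F', rfl, hF'⟩ := h'
  suffices hz : F - F' = 0 by rw [sub_eq_zero.mp hz]
  obtain ⟨n, f, hf⟩ := LaurentPolynomial.exists_T_pow (F - F')
  have hroot : ∀ N : ℕ, 1 ≤ N → f.eval (q₀ ^ N) = 0 := by
    intro N hN
    have h1 := congrArg (specialize N) hf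
    rw [map_mul, map_sub, hF N hN, hF' N hN, sub_self, zero_mul] at h1
    simpa [specialize, LaurentPolynomial.eval₂_toLaurent, Polynomial.eval₂_id] using h1
  have hf0 : f = 0 := by
    refine Polynomial.eq_zero_of_infinite_isRoot f ?_
    refine Set.infinite_of_injective_forall_mem
      (f := fun N : ℕ => q₀ ^ (N + 1)) (fun a b hab => ?_) (fun N => hroot (N + 1) (by omega))
    have := q₀_pow_injective hab
    omega
  rw [hf0, map_zero] at hf
  have h2 := congrArg (fun x => x * LaurentPolynomial.T (-(n : ℤ))) hf
  simp only [zero_mul, mul_assoc, ← LaurentPolynomial.T_add] at h2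
  simpa using h2.symm

theorem IsHomfly.eq_homfly {w : List Layer} {H : KqA} (h : IsHomfly w H) : homfly w = H := by
  have h' : ∃ H, IsHomfly w H := ⟨H, h⟩
  rw [homfly, dif_pos h']
  exact h'.choose_spec.unique h

/-- `D = {A} / {q}`, where `{x} = x - x⁻¹`. -/
noncomputable def dimD : KqA := (A - A⁻¹) / (q - q⁻¹)

/-- `φ = A {q}`. -/
noncomputable def phi : KqA := A * (q - q⁻¹)

/-- `φ̄ = -A⁻¹ {q}`. -/
noncomputable def phiBar : KqA := -(A⁻¹ * (q - q⁻¹))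

/-- `Θ̄_{n,k} = ((D + φ̄) ^ k (1 + φ D) ^ (n - k) - φ̄ ^ k) / D`. -/
noncomputable def thetaBar (n : ℤ) (k : ℕ) : KqA :=
  ((dimD + phiBar) ^ k * (1 + phi * dimD) ^ (n - (k : ℤ)) - phiBar ^ k) / dimD

/-! ## Kanenobu diagrams -/

/-- The pieces, on two vertical strands, of which the tangles in the two boxes are stacked. -/
inductive Piece : Type
  /-- A half twist. Between antiparallel strands this crossing is positive, and two consecutive
  ones form a horizontal lock. -/
  | twist
  /-- The inverse half twist; two consecutive ones form an opposite horizontal lock. -/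
  | untwist
  /-- An opposite vertical lock. -/
  | lock

/-- The number of half twists in a box, counted with sign. -/
def twistNumber : List Piece → ℤ
  | [] => 0
  | .twist :: u => twistNumber u + 1
  | .untwist :: u => twistNumber u - 1
  | .lock :: u => twistNumber u

/-- The number of opposite vertical locks in a box. -/
def lockNumber : List Piece → ℕ
  | [] => 0
  | .lock :: u => lockNumber u + 1
  | _ :: u => lockNumber u

/-- The number of crossings in a box: a half twist counts with its sign, and each opposite vertical
lock counts for the two half twists that it replaces. -/
def crossingNumber (u : List Piece) : ℤ := twistNumber u + 2 * lockNumber u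

/-- A clasp of two arcs at positions `i`, `i + 1`: one joins the two lower ends and the other the
two upper ends; `o` orients the left ends. With `slash = true` it is a vertical lock, with
`slash = false` it is an opposite vertical lock. -/
def verticalLock (i : ℕ) (slash o : Bool) : List Layer :=
  [.cup (i + 1) o, .cross i slash, .cross (i + 2) slash, .cap (i + 1)]

/-- The layers, from bottom to top, of a box at positions `i`, `i + 1`, where `o` orients the
bottom left end. -/
def boxLayers (i : ℕ) : Bool → List Piece → List Layer
  | _, [] => []
  | o, .twist :: u => .cross i false :: boxLayers i (!o) u
  | o, .untwist :: u => .cross i true :: boxLayers i (!o) u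
  | o, .lock :: u => verticalLock i false o ++ boxLayers i o u

/-- The two-strand braid of `t` half twists at positions `i`, `i + 1`; for `t = 2 * j` this is a
chain of `j` horizontal locks (of `-j` opposite ones if `j` is negative). -/
def twistLayers (i : ℕ) (t : ℤ) : List Layer :=
  List.replicate t.natAbs (.cross i (decide (t < 0)))

/-- The lower half of all diagrams below. There are eight strands. The lower row of boxes
consists of the `q`-box at positions 1, 2, the opposite chain of `j` locks at positions 3, 4, and
the chain of `j` locks at positions 5, 6. The orientation of the cup at positions 4, 5 is the only
one that depends on `u`, through the parity of the number of half twists. -/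
def lowerPart (u v : List Piece) (j : ℤ) : List Layer :=
  [.cup 0 true, .cup 1 false, .cup 2 true, .cup 4 (decide (Even (twistNumber u)))] ++
    boxLayers 1 false v ++ twistLayers 3 (-2 * j) ++ twistLayers 5 (2 * j)

/-- The caps at the top of all diagrams below. They join, in the numbering of the eight strands,
3 to 4, 1 to 2, 0 to 5 and 6 to 7. -/
def topCaps : List Layer := [.cap 3, .cap 1, .cap 0, .cap 0]

/-- The generalised Kanenobu diagram with the tangle `u` in the `p`-box and the tangle `v` in the
`q`-box. The upper row of boxes consists of the opposite chain of `i` locks at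
positions 0, 1, the chain of `i` locks at positions 2, 3, and the `p`-box at positions 4, 5. -/
def kanGen (u v : List Piece) (j i : ℤ) : List Layer :=
  lowerPart u v j ++ twistLayers 0 (-2 * i) ++ twistLayers 2 (2 * i) ++
    boxLayers 4 (decide (Even (twistNumber u))) u ++ topCaps

/-- A box that contains `p` half twists. -/
def halfTwists (p : ℤ) : List Piece :=
  List.replicate p.natAbs (if p < 0 then .untwist else .twist)

/-- The Kanenobu diagram `Kan(p, q, 2 j, 2 i)`; for `j = i = 1` it is the diagram `Kan(p, q)` of
the usual Kanenobu knot. -/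
def kan (p q : ℤ) (j i : ℤ) : List Layer := kanGen (halfTwists p) (halfTwists q) j i

/-- The deformed Kanenobu diagram: of the four locks of `kanGen u v 1 1` outside the two boxes,
the opposite horizontal one at positions 0, 1 is replaced by a vertical lock. -/
def kanDef (u v : List Piece) : List Layer :=
  lowerPart u v 1 ++ verticalLock 0 true true ++ twistLayers 2 2 ++
    boxLayers 4 (decide (Even (twistNumber u))) u ++ topCaps

/-- The polynomial `P^{DB(2,2)} = D (1 + φ² + 2 φ D)`. -/
noncomputable def doubleBraidP : KqA := dimD * (1 + phi ^ 2 + 2 * phi * dimD)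

/-- The polynomial
`P^{def} = D (D + φ) ((D + φ̄) (1 + φ (D + φ)) + φ) + D φ φ̄ (1 + φ D)`. -/
noncomputable def deformedP : KqA :=
  dimD * (dimD + phi) * ((dimD + phiBar) * (1 + phi * (dimD + phi)) + phi) +
    dimD * phi * phiBar * (1 + phi * dimD)

end KanenobuHomfly

open KanenobuHomfly

/-! A word of layers acts on functionals of coloured boundaries, and the state sum is one value of
this action. The skein relation, Reidemeister II and III, curls worth `A`, circles worth `D` and the
straightening of zigzags are checked in coordinates for each number `N` of colours; the sums over
colours telescope to powers of `q`. They are then read in the module `Sem o`, where a Laurent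
polynomial acts on the component with `N` colours through `A = q ^ N`. A relation there holds for
all `N` at once, and `exists_whisker` carries it into any surrounding word. When a closed word
equals `c` times the empty word, `c` times a power of `A` for the writhe is its HOMFLY polynomial,
so each computation also proves existence.

Let T be the turnback, a cap followed by a cup. Between antiparallel strands two half twists are `1
+ φ T`, an opposite vertical lock is `T + φ̄`, and T absorbs a half twist at the cost `A` and
another T at the cost `D`. Hence a box with `l` locks is `φ̄ ^ l` times the empty box or a single
half twist, according to parity, plus a multiple of T (`ev_boxLayers`). Capping the box off
determines that multiple, because each piece acts on the cap by a scalar (`A`, `A⁻¹` or `D + φ̄`);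
it is `A ^ ε` times a polynomial `Θ̄`.

With T in a box of a Kanenobu diagram, the two chains of each row lie on the two sides of nested
cups or caps with opposite twists, and they untangle. Only circles and at most one curl remain: the
values are `D ^ 2`, up to a factor `A`, and `D ^ 3` for T in both boxes, whatever `i` and `j` are.
The one remaining term is the diagram with at most one half twist in each box, that is, the Kanenobu
diagram of the parities. It has a value because each chain is a combination of two tangles and the
resulting closed diagrams can be tabulated. This proves the first formula. The second follows
because `D Θ̄ + φ̄ ^ k = (D + φ̄) ^ k A ^ (2 (n - k))` is multiplicative in `(n, k)`
(`thetaBar_add`). For `i = j = 1` the two diagrams with a single half twist are evaluated and agree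
(`homfly_kan_one_zero`).

In the deformed diagram the upper row no longer untangles. T in the `p`-box gives `P^def`, T in the
`q`-box gives `P^DB`, and T in both gives `P^DB D`. If the first two were equal, `thetaBar_add`
would again leave only the sum. For fixed `m + n`, `k` and `l` the dependence on `m` is therefore
through `(P^def - P^DB) Θ̄_{m,l}`. The difference factors as `A² D (1 + z²)² (D² - 1)` with `z = q -
q⁻¹`, which is nonzero, and `Θ̄_{m,l}` determines `m`. -/

namespace KanenobuHomfly

/-! ## Layers as operators -/

section Operators

variable {K : Type*} [Field K] (q : K) {N : ℕ}

/-- The operator of a layer on functions of coloured orientations. -/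
def layerAct : Layer → (List (Bool × Fin N) → K) → List (Bool × Fin N) → K
  | .cup i o, F, s =>
    if i ≤ s.length then
      ∑ a : Fin N, cupWeight q N o a * F (s.take i ++ (o, a) :: (!o, a) :: s.drop i)
    else 0
  | .cap i, F, s =>
    match s.drop i with
    | (o₁, a) :: (o₂, b) :: t =>
      if o₂ = !o₁ ∧ b = a then capWeight q N o₁ a * F (s.take i ++ t) else 0
    | _ => 0
  | .cross i slash, F, s =>
    match s.drop i with
    | (o₁, a) :: (o₂, b) :: t =>
      ∑ c : Fin N, ∑ d : Fin N,
        crossWeight q N slash o₁ o₂ a b c d * F (s.take i ++ (o₂, c) :: (o₁, d) :: t)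
    | _ => 0

/-- The operator of a list of layers. -/
def act : List Layer → (List (Bool × Fin N) → K) → List (Bool × Fin N) → K
  | [], F => F
  | L :: w, F => layerAct q L (act w F)

/-- Layers act on functionals of the boundary above them, so the upper word is applied first. -/
theorem act_append (w w' : List Layer) (F : List (Bool × Fin N) → K) :
    act q (w ++ w') F = act q w (act q w' F) := by
  induction w with
  | nil => rfl
  | cons L w ih => simp only [List.cons_append, act, ih]

/-- The function that is `1` on the empty list. -/
def isNil (s : List (Bool × Fin N)) : K := match s with | [] => 1 | _ => 0

/-- The state sum only allows an empty top. Replacing `isNil` by an arbitrary functional is what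
makes it possible to cut a diagram at any height. -/
theorem stateSum_eq_act (w : List Layer) (s : List (Bool × Fin N)) :
    stateSum q N w s = act q w isNil s := by
  induction w generalizing s with
  | nil => cases s <;> rfl
  | cons L w ih =>
    cases L with
    | cup i o => simp only [stateSum, act, layerAct, ih]
    | cap i => simp only [stateSum, act, layerAct, ih]
    | cross i sl => simp only [stateSum, act, layerAct, ih]

theorem layerAct_add (L : Layer) (F G : List (Bool × Fin N) → K) (s : List (Bool × Fin N)) :
    layerAct q L (fun y => F y + G y) s = layerAct q L F s + layerAct q L G s := by
  cases L with
  | cup i o =>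
    simp only [layerAct]; split <;> simp [mul_add, Finset.sum_add_distrib]
  | cap i =>
    simp only [layerAct]; split
    · split <;> simp [mul_add]
    · simp
  | cross i sl =>
    simp only [layerAct]; split <;> simp [mul_add, Finset.sum_add_distrib]

theorem layerAct_smul (L : Layer) (c : K) (F : List (Bool × Fin N) → K)
    (s : List (Bool × Fin N)) :
    layerAct q L (fun y => c * F y) s = c * layerAct q L F s := by
  cases L with
  | cup i o =>
    simp only [layerAct]; split <;> simp [mul_left_comm _ c, Finset.mul_sum]
  | cap i =>
    simp only [layerAct]; split
    · split <;> simp [mul_left_comm _ c]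
    · simp
  | cross i sl =>
    simp only [layerAct]; split <;> simp [mul_left_comm _ c, Finset.mul_sum]

theorem act_add (w : List Layer) (F G : List (Bool × Fin N) → K) (s : List (Bool × Fin N)) :
    act q w (fun y => F y + G y) s = act q w F s + act q w G s := by
  induction w generalizing s with
  | nil => rfl
  | cons L w ih =>
    simp only [act]
    rw [show act q w (fun y => F y + G y) = fun y => act q w F y + act q w G y from funext ih,
      layerAct_add]

theorem act_smul (w : List Layer) (c : K) (F : List (Bool × Fin N) → K)
    (s : List (Bool × Fin N)) :
    act q w (fun y => c * F y) s = c * act q w F s := by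
  induction w generalizing s with
  | nil => rfl
  | cons L w ih =>
    simp only [act]
    rw [show act q w (fun y => c * F y) = fun y => c * act q w F y from funext ih,
      layerAct_smul]

theorem act_zero (w : List Layer) (s : List (Bool × Fin N)) :
    act q w (fun _ => 0) s = 0 := by
  simpa using act_smul q w 0 (fun _ => 0) s

theorem act_sum {ι : Type*} (w : List Layer) (t : Finset ι)
    (F : ι → List (Bool × Fin N) → K) (s : List (Bool × Fin N)) :
    act q w (fun y => ∑ i ∈ t, F i y) s = ∑ i ∈ t, act q w (F i) s := by
  classical
  induction t using Finset.induction_on with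
  | empty => simp [act_zero]
  | insert i t hi ih => simp [Finset.sum_insert hi, act_add, ih]

/-! ### Dependence on orientations only through the boundary -/

/-- A layer sees only the values of a function on lists with the right orientations. -/
theorem layerAct_congr {L : Layer} {o o' : List Bool} (h : L.next o = some o')
    {F G : List (Bool × Fin N) → K} (hFG : ∀ s, s.map Prod.fst = o' → F s = G s)
    {s : List (Bool × Fin N)} (hs : s.map Prod.fst = o) :
    layerAct q L F s = layerAct q L G s := by
  subst hs
  cases L with
  | cup i b =>
    simp only [Layer.next, List.length_map] at h
    split at h
    · rename_i hi
      simp only [Option.some.injEq] at h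
      simp only [layerAct, if_pos hi]
      refine Finset.sum_congr rfl fun a _ => ?_
      rw [hFG]
      simp [← h, List.map_take, List.map_drop]
    · simp at h
  | cap i =>
    simp only [Layer.next, ← List.map_drop, ← List.map_take] at h
    simp only [layerAct]
    rcases hd : s.drop i with _ | ⟨⟨o₁, a⟩, _ | ⟨⟨o₂, b⟩, t⟩⟩
    · rfl
    · rfl
    · simp only [hd, List.map_cons] at h
      split at h
      · simp only [Option.some.injEq] at h
        dsimp only
        rw [hFG]
        simp [← h]
      · simp at h
  | cross i b =>
    simp only [Layer.next, ← List.map_drop, ← List.map_take] at h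
    simp only [layerAct]
    rcases hd : s.drop i with _ | ⟨⟨o₁, a⟩, _ | ⟨⟨o₂, b⟩, t⟩⟩
    · rfl
    · rfl
    · simp only [hd, List.map_cons, Option.some.injEq] at h
      refine Finset.sum_congr rfl fun c _ => Finset.sum_congr rfl fun d _ => ?_
      rw [hFG]
      simp [← h]

theorem act_congr {w : List Layer} {o o' : List Bool} (h : endOrientation w o = some o')
    {F G : List (Bool × Fin N) → K} (hFG : ∀ s, s.map Prod.fst = o' → F s = G s)
    {s : List (Bool × Fin N)} (hs : s.map Prod.fst = o) :
    act q w F s = act q w G s := by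
  induction w generalizing o s with
  | nil =>
    simp only [endOrientation, Option.some.injEq] at h
    exact hFG s (hs.trans h)
  | cons L w ih =>
    simp only [endOrientation, Option.bind_eq_some_iff] at h
    obtain ⟨o₁, h₁, h₂⟩ := h
    exact layerAct_congr q h₁ (fun s hs => ih h₂ hs) hs

/-! ### Locality -/

/-- Moving a layer to the right. -/
def Layer.shift (i : ℕ) : Layer → Layer
  | .cup j o => .cup (i + j) o
  | .cap j => .cap (i + j)
  | .cross j b => .cross (i + j) b

/-- Moving a list of layers to the right. -/
def shift (i : ℕ) (w : List Layer) : List Layer := w.map (Layer.shift i)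

theorem shift_append (i : ℕ) (w w' : List Layer) : shift i (w ++ w') = shift i w ++ shift i w' :=
  List.map_append

theorem shift_zero (w : List Layer) : shift 0 w = w := by
  refine (List.map_congr_left fun L _ => ?_).trans (List.map_id w)
  cases L <;> simp [Layer.shift]

theorem shift_shift (i j : ℕ) (w : List Layer) : shift i (shift j w) = shift (i + j) w := by
  simp only [shift, List.map_map]
  refine List.map_congr_left fun L _ => ?_
  cases L <;> simp [Layer.shift, add_assoc]

theorem Layer.next_shift {L : Layer} {o o' : List Bool} (h : L.next o = some o')
    (p r : List Bool) : (L.shift p.length).next (p ++ o ++ r) = some (p ++ o' ++ r) := by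
  cases L with
  | cup i b =>
    simp only [Layer.next] at h
    split at h
    · rename_i hi
      simp only [Option.some.injEq] at h
      subst h
      simp only [Layer.shift, Layer.next, List.append_assoc]
      rw [if_pos (by simp; omega)]
      simp [List.take_length_add_append, List.drop_length_add_append, List.take_append_of_le_length hi,
        List.drop_append_of_le_length hi]
    · simp at h
  | cap i =>
    simp only [Layer.next] at h
    rcases hd : o.drop i with _ | ⟨o₁, _ | ⟨o₂, t⟩⟩
    · simp [hd] at h
    · simp [hd] at h
    · have hi : i ≤ o.length := by
        by_contra hc
        rw [List.drop_eq_nil_of_le (by omega)] at hd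
        simp at hd
      simp only [hd] at h
      simp only [Layer.shift, Layer.next, List.append_assoc, List.drop_length_add_append,
        List.drop_append_of_le_length hi, hd, List.take_length_add_append,
        List.take_append_of_le_length hi, List.cons_append]
      split at h
      · rename_i h1
        simp only [Option.some.injEq] at h
        subst h
        simp [h1]
      · simp at h
  | cross i b =>
    simp only [Layer.next] at h
    rcases hd : o.drop i with _ | ⟨o₁, _ | ⟨o₂, t⟩⟩
    · simp [hd] at h
    · simp [hd] at h
    · have hi : i ≤ o.length := by
        by_contra hc
        rw [List.drop_eq_nil_of_le (by omega)] at hd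
        simp at hd
      simp only [hd, Option.some.injEq] at h
      subst h
      simp [Layer.shift, Layer.next, List.append_assoc, List.drop_length_add_append,
        List.drop_append_of_le_length hi, hd, List.take_length_add_append,
        List.take_append_of_le_length hi]

theorem endOrientation_append (w w' : List Layer) (o : List Bool) :
    endOrientation (w ++ w') o = (endOrientation w o).bind (endOrientation w') := by
  induction w generalizing o with
  | nil => rfl
  | cons L w ih =>
    simp only [List.cons_append, endOrientation, Option.bind_assoc]
    congr 1
    exact funext ih

theorem endOrientation_append_of {w w' : List Layer} {o o' : List Bool}
    (h : endOrientation w o = some o') :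
    endOrientation (w ++ w') o = endOrientation w' o' := by
  rw [endOrientation_append, h]; rfl

theorem endOrientation_shift {w : List Layer} {o o' : List Bool} (h : endOrientation w o = some o')
    (p r : List Bool) :
    endOrientation (shift p.length w) (p ++ o ++ r) = some (p ++ o' ++ r) := by
  induction w generalizing o with
  | nil =>
    simp only [endOrientation, Option.some.injEq] at h
    simp [shift, endOrientation, h]
  | cons L w ih =>
    simp only [endOrientation, Option.bind_eq_some_iff] at h
    obtain ⟨o₁, h₁, h₂⟩ := h
    simp only [shift, List.map_cons, endOrientation, Layer.next_shift h₁]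
    exact ih h₂

/-- The hypothesis says that the layer fits into the strands `x`, so that after the shift it cannot
reach into the strands `r` on the right. -/
theorem layerAct_shift {L : Layer} {x : List (Bool × Fin N)} {o' : List Bool}
    (h : L.next (x.map Prod.fst) = some o') (p r : List (Bool × Fin N))
    (F : List (Bool × Fin N) → K) :
    layerAct q (L.shift p.length) F (p ++ x ++ r) =
      layerAct q L (fun y => F (p ++ y ++ r)) x := by
  cases L with
  | cup i b =>
    simp only [Layer.next, List.length_map] at h
    split at h
    · rename_i hi
      simp only [Layer.shift, layerAct, List.append_assoc]
      rw [if_pos (by simp; omega), if_pos hi]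
      simp [List.take_length_add_append, List.drop_length_add_append, List.take_append_of_le_length hi,
        List.drop_append_of_le_length hi]
    · simp at h
  | cap i =>
    simp only [Layer.next, ← List.map_drop, ← List.map_take] at h
    rcases hd : x.drop i with _ | ⟨⟨o₁, a⟩, _ | ⟨⟨o₂, b⟩, t⟩⟩
    · simp [hd] at h
    · simp [hd] at h
    · have hi : i ≤ x.length := by
        by_contra hc
        rw [List.drop_eq_nil_of_le (by omega)] at hd
        simp at hd
      simp [Layer.shift, layerAct, List.append_assoc, List.drop_length_add_append,
        List.drop_append_of_le_length hi, hd, List.take_length_add_append,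
        List.take_append_of_le_length hi]
  | cross i b =>
    simp only [Layer.next, ← List.map_drop, ← List.map_take] at h
    rcases hd : x.drop i with _ | ⟨⟨o₁, a⟩, _ | ⟨⟨o₂, b⟩, t⟩⟩
    · simp [hd] at h
    · simp [hd] at h
    · have hi : i ≤ x.length := by
        by_contra hc
        rw [List.drop_eq_nil_of_le (by omega)] at hd
        simp at hd
      simp [Layer.shift, layerAct, List.append_assoc, List.drop_length_add_append,
        List.drop_append_of_le_length hi, hd, List.take_length_add_append,
        List.take_append_of_le_length hi]

theorem act_shift {w : List Layer} {o o' : List Bool} (h : endOrientation w o = some o')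
    {x : List (Bool × Fin N)} (hx : x.map Prod.fst = o) (p r : List (Bool × Fin N))
    (F : List (Bool × Fin N) → K) :
    act q (shift p.length w) F (p ++ x ++ r) = act q w (fun y => F (p ++ y ++ r)) x := by
  induction w generalizing o x with
  | nil => rfl
  | cons L w ih =>
    simp only [endOrientation, Option.bind_eq_some_iff] at h
    obtain ⟨o₁, h₁, h₂⟩ := h
    subst hx
    simp only [shift, List.map_cons, act]
    rw [layerAct_shift q h₁]
    exact layerAct_congr q h₁ (fun s hs => ih h₂ hs) rfl

/-- Operators on disjoint groups of strands commute. -/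
theorem act_comm (w w' : List Layer) (G : List (Bool × Fin N) → List (Bool × Fin N) → K)
    (x y : List (Bool × Fin N)) :
    act q w (fun x' => act q w' (fun y' => G x' y') y) x =
      act q w' (fun y' => act q w (fun x' => G x' y') x) y := by
  induction w generalizing x with
  | nil => rfl
  | cons L w ih =>
    simp only [act]
    rw [funext ih]
    cases L with
    | cup i b =>
      simp only [layerAct]
      split
      · rw [act_sum]; simp only [act_smul]
      · rw [act_zero]
    | cap i =>
      simp only [layerAct]
      split
      · split
        · rw [act_smul]
        · rw [act_zero]
      · rw [act_zero]
    | cross i b =>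
      simp only [layerAct]
      split
      · rw [act_sum]; simp only [act_sum, act_smul]
      · rw [act_zero]

/-- The two shifts differ because the right word has on its left the strands above `w` or those
below `w`, depending on the order. -/
theorem act_interchange {w w' : List Layer} {o₁ o₁' o₂ o₂' : List Bool}
    (h : endOrientation w o₁ = some o₁') (h' : endOrientation w' o₂ = some o₂')
    {x y : List (Bool × Fin N)} (hx : x.map Prod.fst = o₁) (hy : y.map Prod.fst = o₂)
    (F : List (Bool × Fin N) → K) :
    act q (w ++ shift o₁'.length w') F (x ++ y) =
      act q (shift o₁.length w' ++ w) F (x ++ y) := by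
  have key (G : List (Bool × Fin N) → K) (z : List (Bool × Fin N)) :
      act q w G (x ++ z) = act q w (fun x' => G (x' ++ z)) x := by
    simpa [shift_zero] using act_shift q h hx [] z G
  have key' (G : List (Bool × Fin N) → K) (z : List (Bool × Fin N)) :
      act q (shift z.length w') G (z ++ y) = act q w' (fun y' => G (z ++ y')) y := by
    simpa using act_shift q h' hy z [] G
  have hl : o₁.length = x.length := by simp [← hx]
  rw [act_append, act_append, key, hl, key']
  simp only [key]
  rw [← act_comm]
  refine act_congr q h (fun s hs => ?_) hx
  have hl' : o₁'.length = s.length := by simp [← hs]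
  rw [hl', key']

end Operators

/-! ## The coefficient ring -/

/-- Laurent polynomials in `A` over `ℚ(q)`. -/
abbrev Coeff : Type := LaurentPolynomial Kq

/-- `A` as a Laurent polynomial. -/
noncomputable def cA : Coeff := LaurentPolynomial.T 1

/-- `A⁻¹` as a Laurent polynomial. -/
noncomputable def cAinv : Coeff := LaurentPolynomial.T (-1)

/-- `q - q⁻¹` as a Laurent polynomial. -/
noncomputable def cz : Coeff := LaurentPolynomial.C (q₀ - q₀⁻¹)

/-- `D` as a Laurent polynomial. -/
noncomputable def cD : Coeff := LaurentPolynomial.C (q₀ - q₀⁻¹)⁻¹ * (cA - cAinv)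

theorem cA_mul_cAinv : cA * cAinv = 1 := by
  rw [cA, cAinv, ← LaurentPolynomial.T_add, add_neg_cancel, LaurentPolynomial.T_zero]

theorem q₀_sub_inv_ne_zero : q₀ - q₀⁻¹ ≠ 0 := by
  intro h
  have h1 : q₀ ^ 2 = 1 := by
    have := mul_inv_cancel₀ q₀_ne_zero
    have h2 := sub_eq_zero.mp h
    rw [← h2] at this
    rw [pow_two, this]
  have := q₀_pow_injective (a₁ := 2) (a₂ := 0) (by simpa using h1)
  omega

@[simp] theorem specialize_cA (N : ℕ) : specialize N cA = q₀ ^ N := by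
  simp [specialize, cA, LaurentPolynomial.eval₂_T]

@[simp] theorem specialize_cAinv (N : ℕ) : specialize N cAinv = (q₀ ^ N)⁻¹ := by
  simp only [specialize, cAinv, LaurentPolynomial.eval₂_T, zpow_neg, zpow_one, Units.val_inv_eq_inv_val,
    Units.val_mk0]

@[simp] theorem specialize_C (N : ℕ) (c : Kq) : specialize N (LaurentPolynomial.C c) = c := by
  simp [specialize]

@[simp] theorem specialize_cz (N : ℕ) : specialize N cz = q₀ - q₀⁻¹ := specialize_C N _

theorem specialize_T (N : ℕ) (n : ℤ) : specialize N (LaurentPolynomial.T n) = (q₀ ^ N) ^ n := by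
  simp [specialize, LaurentPolynomial.eval₂_T]

@[simp] theorem laurentToField_cA : laurentToField cA = A := by
  simp [laurentToField, cA, LaurentPolynomial.eval₂_T]

@[simp] theorem laurentToField_cAinv : laurentToField cAinv = A⁻¹ := by
  simp only [laurentToField, cAinv, LaurentPolynomial.eval₂_T, zpow_neg, zpow_one,
    Units.val_inv_eq_inv_val, Units.val_mk0]

theorem laurentToField_T (n : ℤ) : laurentToField (LaurentPolynomial.T n) = A ^ n := by
  simp [laurentToField, LaurentPolynomial.eval₂_T]

theorem laurentToField_C (c : Kq) : laurentToField (LaurentPolynomial.C c) = RatFunc.C c := by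
  simp [laurentToField]

@[simp] theorem laurentToField_cz : laurentToField cz = q - q⁻¹ := by
  simp [cz, laurentToField_C, q]

@[simp] theorem laurentToField_cD : laurentToField cD = dimD := by
  simp [cD, laurentToField_C, q, dimD, div_eq_inv_mul]

/-! ## Words of layers as elements of a module -/

/-- The colours, functionals and coloured boundaries on which a word with boundary `o` at the bottom
can be evaluated. -/
abbrev TestData (o : List Bool) : Type :=
  Σ N : ℕ, (List (Bool × Fin N) → Kq) × {s : List (Bool × Fin N) // s.map Prod.fst = o}

/-- Functions of the test data, with the action of Laurent polynomials by specialisation. -/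
def Sem (o : List Bool) : Type := TestData o → Kq

noncomputable instance (o : List Bool) : AddCommGroup (Sem o) :=
  inferInstanceAs (AddCommGroup (TestData o → Kq))

/-- The variable `A` acts as `q ^ N` on the component with `N` colours. An identity with Laurent
polynomial coefficients is thus proved uniformly in `N`. -/
noncomputable instance (o : List Bool) : Module Coeff (Sem o) where
  smul c f := fun x => specialize x.1 c * f x
  one_smul f := funext fun x => by
    change specialize x.1 1 * f x = f x
    simp
  mul_smul c d f := funext fun x => by
    change specialize x.1 (c * d) * f x = specialize x.1 c * (specialize x.1 d * f x)
    simp [mul_assoc]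
  smul_zero c := funext fun x => by
    change specialize x.1 c * 0 = 0
    simp
  smul_add c f g := funext fun x => by
    change specialize x.1 c * (f x + g x) = specialize x.1 c * f x + specialize x.1 c * g x
    ring
  add_smul c d f := funext fun x => by
    change specialize x.1 (c + d) * f x = specialize x.1 c * f x + specialize x.1 d * f x
    simp [add_mul]
  zero_smul f := funext fun x => by
    change specialize x.1 0 * f x = 0
    simp

theorem Sem.add_apply {o : List Bool} (f g : Sem o) (x : TestData o) : (f + g) x = f x + g x := rfl

theorem Sem.smul_apply {o : List Bool} (c : Coeff) (f : Sem o) (x : TestData o) :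
    (c • f) x = specialize x.1 c * f x := rfl

/-- The value of a word. -/
noncomputable def ev (o : List Bool) (w : List Layer) : Sem o :=
  fun x => act q₀ w x.2.1 x.2.2.1

theorem ev_ext {o : List Bool} {w w' : List Layer}
    (h : ∀ (N : ℕ) (F : List (Bool × Fin N) → Kq) (s : List (Bool × Fin N)), s.map Prod.fst = o →
      act q₀ w F s = act q₀ w' F s) : ev o w = ev o w' :=
  funext fun x => h x.1 x.2.1 x.2.2.1 x.2.2.2

/-- Insertion of a tangle in a surrounding word. -/
theorem exists_whisker (p r : List Layer) (pre post o O : List Bool)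
    (hp : endOrientation p O = some (pre ++ o ++ post)) :
    ∃ Φ : Sem o →ₗ[Coeff] Sem O, ∀ (w : List Layer) (o' : List Bool),
      endOrientation w o = some o' →
        Φ (ev o w) = ev O (p ++ (shift pre.length w ++ r)) := by
  classical
  -- The state above `p` is cut into left, middle and right strands. The given function is evaluated
  -- on the middle ones, with `r` and the frozen outer strands as functional. The default value `0`
  -- never matters, since `p` forces the orientations of the middle strands.
  refine ⟨{
    toFun := fun X x => act q₀ p (fun s =>
      if h : ((s.drop pre.length).take o.length).map Prod.fst = o then
        X ⟨x.1, fun y => act q₀ r x.2.1 (s.take pre.length ++ y ++ s.drop (pre.length + o.length)),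
          ⟨_, h⟩⟩ else 0) x.2.2.1
    map_add' := fun X Y => funext fun x => ?_
    map_smul' := fun c X => funext fun x => ?_ }, fun w o' hw => ?_⟩
  · refine Eq.trans ?_ (act_add q₀ p _ _ _)
    congr 1
    funext s
    split
    · rfl
    · exact (add_zero 0).symm
  · refine Eq.trans ?_ (act_smul q₀ p (specialize x.1 c) _ _)
    congr 1
    funext s
    split
    · rfl
    · exact (mul_zero _).symm
  · funext ⟨N, F, s, hs⟩
    change act q₀ p _ s = act q₀ (p ++ (shift pre.length w ++ r)) F s
    rw [act_append]
    refine act_congr q₀ hp (fun s' hs' => ?_) hs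
    obtain ⟨t, z, rfl, ht, hz⟩ := List.map_eq_append_iff.mp hs'
    obtain ⟨x, y, rfl, hx, hy⟩ := List.map_eq_append_iff.mp ht
    have hxl : pre.length = x.length := by simp [← hx]
    have hyl : o.length = y.length := by simp [← hy]
    have h1 : (List.take o.length (List.drop pre.length (x ++ y ++ z))) = y := by
      rw [hxl, hyl, List.append_assoc, List.drop_left, List.take_left]
    have h2 : List.take pre.length (x ++ y ++ z) = x := by
      rw [hxl, List.append_assoc, List.take_left]
    have h3 : List.drop (pre.length + o.length) (x ++ y ++ z) = z := by
      rw [hxl, hyl, ← List.length_append, List.drop_left]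
    rw [dif_pos (by rw [h1, hy]), act_append]
    change act q₀ w (fun u => act q₀ r F (List.take pre.length (x ++ y ++ z) ++ u ++
      List.drop (pre.length + o.length) (x ++ y ++ z)))
      (List.take o.length (List.drop pre.length (x ++ y ++ z))) = _
    rw [h1, h2, h3, hxl, act_shift q₀ hw hy]

/-! ### Local relations inside a surrounding word -/

section Context

variable {pre o post O o₁ o₂ o₃ : List Bool} {w w₁ w₂ : List Layer} {c c₁ c₂ : Coeff}

theorem ctx (p r : List Layer) (h : ev o w = ev o w₁)
    (hp : endOrientation p O = some (pre ++ o ++ post)) (h₁ : endOrientation w o = some o₁)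
    (h₂ : endOrientation w₁ o = some o₂) :
    ev O (p ++ (shift pre.length w ++ r)) = ev O (p ++ (shift pre.length w₁ ++ r)) := by
  obtain ⟨Φ, hΦ⟩ := exists_whisker p r pre post o O hp
  rw [← hΦ w _ h₁, ← hΦ w₁ _ h₂, h]

theorem ctx1 (p r : List Layer) (h : ev o w = c • ev o w₁)
    (hp : endOrientation p O = some (pre ++ o ++ post)) (h₁ : endOrientation w o = some o₁)
    (h₂ : endOrientation w₁ o = some o₂) :
    ev O (p ++ (shift pre.length w ++ r)) = c • ev O (p ++ (shift pre.length w₁ ++ r)) := by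
  obtain ⟨Φ, hΦ⟩ := exists_whisker p r pre post o O hp
  rw [← hΦ w _ h₁, ← hΦ w₁ _ h₂, h, map_smul]

theorem ctx2 (p r : List Layer) (h : ev o w = c₁ • ev o w₁ + c₂ • ev o w₂)
    (hp : endOrientation p O = some (pre ++ o ++ post)) (h₁ : endOrientation w o = some o₁)
    (h₂ : endOrientation w₁ o = some o₂) (h₃ : endOrientation w₂ o = some o₃) :
    ev O (p ++ (shift pre.length w ++ r)) = c₁ • ev O (p ++ (shift pre.length w₁ ++ r)) +
      c₂ • ev O (p ++ (shift pre.length w₂ ++ r)) := by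
  obtain ⟨Φ, hΦ⟩ := exists_whisker p r pre post o O hp
  rw [← hΦ w _ h₁, ← hΦ w₁ _ h₂, ← hΦ w₂ _ h₃, h, map_add, map_smul, map_smul]

end Context

theorem ev_interchange {w w' : List Layer} {o₁ o₁' o₂ o₂' : List Bool}
    (h : endOrientation w o₁ = some o₁') (h' : endOrientation w' o₂ = some o₂') :
    ev (o₁ ++ o₂) (w ++ shift o₁'.length w') = ev (o₁ ++ o₂) (shift o₁.length w' ++ w) := by
  refine ev_ext fun N F s hs => ?_
  obtain ⟨x, y, rfl, hx, hy⟩ := List.map_eq_append_iff.mp hs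
  exact act_interchange q₀ h h' hx hy F

/-- Interchange of two groups of strands inside a word. -/
theorem ctx_interchange {pre post O : List Bool} {w w' : List Layer} {o₁ o₁' o₂ o₂' : List Bool}
    (p r : List Layer) (hp : endOrientation p O = some (pre ++ (o₁ ++ o₂) ++ post))
    (h : endOrientation w o₁ = some o₁') (h' : endOrientation w' o₂ = some o₂') :
    ev O (p ++ (shift pre.length w ++ (shift (pre.length + o₁'.length) w' ++ r))) =
      ev O (p ++ (shift (pre.length + o₁.length) w' ++ (shift pre.length w ++ r))) := by
  have e1 : endOrientation (w ++ shift o₁'.length w') (o₁ ++ o₂) = some (o₁' ++ o₂') := by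
    have a := endOrientation_shift h [] o₂
    have b := endOrientation_shift h' o₁' []
    simp only [List.length_nil, shift_zero, List.nil_append, List.append_nil] at a b
    rw [endOrientation_append_of a, b]
  have e2 : endOrientation (shift o₁.length w' ++ w) (o₁ ++ o₂) = some (o₁' ++ o₂') := by
    have a := endOrientation_shift h [] o₂'
    have b := endOrientation_shift h' o₁ []
    simp only [List.length_nil, shift_zero, List.nil_append, List.append_nil] at a b
    rw [endOrientation_append_of b, a]
  have := ctx p r (ev_interchange h h') hp e1 e2
  simpa only [shift_append, shift_shift, List.append_assoc] using this

/-- A closed word whose value is known computes the vertical polynomial. -/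
theorem verticalPolynomial_of_ev {w : List Layer} {c : Coeff} (h : ev [] w = c • ev [] [])
    (N : ℕ) : verticalPolynomial q₀ N w = specialize N c := by
  have := congrFun h ⟨N, isNil, [], rfl⟩
  rw [Sem.smul_apply] at this
  simpa [ev, act, isNil, verticalPolynomial, stateSum_eq_act] using this

/-! ## The local relations of the state sum, in coordinates -/

section Telescope

variable {M : Type*} [CommRing M]

theorem sum_fin_telescope (g : ℕ → M) (N : ℕ) :
    ∑ a : Fin N, (g ((a : ℕ) + 1) - g a) = g N - g 0 := by
  rw [Fin.sum_univ_eq_sum_range (fun a => g (a + 1) - g a), Finset.sum_range_sub]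

theorem sum_fin_telescope_lt (g : ℕ → M) {N : ℕ} (c : Fin N) :
    ∑ a : Fin N, (if a < c then g ((a : ℕ) + 1) - g a else 0) = g c - g 0 := by
  simp only [Fin.lt_def]
  rw [Fin.sum_univ_eq_sum_range (fun a => if a < (c : ℕ) then g (a + 1) - g a else 0),
    ← Finset.sum_filter, ← Finset.sum_range_sub]
  refine Finset.sum_congr ?_ fun _ _ => rfl
  ext a
  have := c.2
  simp only [Finset.mem_filter, Finset.mem_range]
  omega

theorem sum_fin_telescope_gt (g : ℕ → M) {N : ℕ} (c : Fin N) :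
    ∑ a : Fin N, (if c < a then g ((a : ℕ) + 1) - g a else 0) = g N - g (c + 1) := by
  have h1 := sum_fin_telescope g N
  have h2 := sum_fin_telescope_lt g c
  have h3 : ∑ a : Fin N, (if a = c then g ((a : ℕ) + 1) - g a else 0) = g (c + 1) - g c := by
    simp
  have h4 : ∑ a : Fin N, (g ((a : ℕ) + 1) - g a) =
      ∑ a : Fin N, (if a < c then g ((a : ℕ) + 1) - g a else 0) +
      ∑ a : Fin N, (if a = c then g ((a : ℕ) + 1) - g a else 0) +
      ∑ a : Fin N, (if c < a then g ((a : ℕ) + 1) - g a else 0) := by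
    rw [← Finset.sum_add_distrib, ← Finset.sum_add_distrib]
    refine Finset.sum_congr rfl fun a _ => ?_
    rcases lt_trichotomy a c with h | h | h
    · simp [h, h.ne, h.not_gt]
    · simp [h]
    · simp [h, h.ne', h.not_gt]
  rw [h1, h2, h3] at h4
  linear_combination -h4

theorem sum_fin_telescope_between (g : ℕ → M) {N : ℕ} {c d : Fin N} (hcd : c < d) :
    ∑ a : Fin N, (if c < a ∧ a < d then g ((a : ℕ) + 1) - g a else 0) = g d - g (c + 1) := by
  have h1 := sum_fin_telescope_lt g d
  have h2 := sum_fin_telescope_lt g c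
  have h3 : ∑ a : Fin N, (if a = c then g ((a : ℕ) + 1) - g a else 0) = g (c + 1) - g c := by
    simp
  have h4 : ∑ a : Fin N, (if a < d then g ((a : ℕ) + 1) - g a else 0) =
      ∑ a : Fin N, (if a < c then g ((a : ℕ) + 1) - g a else 0) +
      ∑ a : Fin N, (if a = c then g ((a : ℕ) + 1) - g a else 0) +
      ∑ a : Fin N, (if c < a ∧ a < d then g ((a : ℕ) + 1) - g a else 0) := by
    rw [← Finset.sum_add_distrib, ← Finset.sum_add_distrib]
    refine Finset.sum_congr rfl fun a _ => ?_
    rcases lt_trichotomy a c with h | h | h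
    · simp [h, h.ne, h.not_gt, h.trans hcd]
    · simp [h, hcd]
    · simp [h, h.ne', h.not_gt]
  rw [h1, h2, h3] at h4
  linear_combination -h4

end Telescope

section Coordinates

variable {K : Type*} [Field K] {q : K} {N : ℕ}

theorem pivot_ne_zero (hq : q ≠ 0) (a : Fin N) : pivot q N a ≠ 0 := zpow_ne_zero _ hq

/-- The source of all telescoping: the right side is `g (a + 1) - g a` with `g a = q ^ (2 a - N)`.
The weights are ordered by colour, so sums over intervals of colours collapse to their end points.
-/
theorem sub_inv_mul_pivot (hq : q ≠ 0) (a : Fin N) :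
    (q - q⁻¹) * pivot q N a =
      q ^ (2 * (((a : ℕ) + 1 : ℕ) : ℤ) - N) - q ^ (2 * ((a : ℕ) : ℤ) - N) := by
  rw [pivot, sub_mul, ← zpow_one_add₀ hq, ← zpow_neg_one, ← zpow_add₀ hq]
  congr 2 <;> push_cast <;> ring

theorem sub_inv_mul_pivot_inv (hq : q ≠ 0) (a : Fin N) :
    (q - q⁻¹) * (pivot q N a)⁻¹ =
      -q ^ ((N : ℤ) - 2 * (((a : ℕ) + 1 : ℕ) : ℤ)) - -q ^ ((N : ℤ) - 2 * ((a : ℕ) : ℤ)) := by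
  rw [pivot, ← zpow_neg, sub_mul, ← zpow_one_add₀ hq, ← zpow_neg_one, ← zpow_add₀ hq,
    neg_sub_neg]
  congr 2 <;> push_cast <;> ring

theorem sub_inv_mul_sum_pivot (hq : q ≠ 0) :
    (q - q⁻¹) * ∑ a : Fin N, pivot q N a = q ^ N - (q ^ N)⁻¹ := by
  rw [Finset.mul_sum]
  simp only [sub_inv_mul_pivot hq]
  rw [sum_fin_telescope (fun a => q ^ (2 * (a : ℤ) - N))]
  congr 1
  · rw [← zpow_natCast]; congr 1; ring
  · simp

theorem sub_inv_mul_sum_pivot_inv (hq : q ≠ 0) :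
    (q - q⁻¹) * ∑ a : Fin N, (pivot q N a)⁻¹ = q ^ N - (q ^ N)⁻¹ := by
  rw [Finset.mul_sum]
  simp only [sub_inv_mul_pivot_inv hq]
  rw [sum_fin_telescope (fun a => -q ^ ((N : ℤ) - 2 * (a : ℤ)))]
  have : (N : ℤ) - 2 * N = - N := by ring
  simp only [this]
  simp
  ring

/-- A crossing of parallel strands. -/
theorem layerAct_cross_parallel (s o : Bool) (F : List (Bool × Fin N) → K) (a b : Fin N)
    (t : List (Bool × Fin N)) :
    layerAct q (.cross 0 s) F ((o, a) :: (o, b) :: t) =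
      (if a = b then (if s then q else q⁻¹) else 1) * F ((o, b) :: (o, a) :: t) +
      (if below (s == o) a b then (if s then q - q⁻¹ else -(q - q⁻¹)) else 0) *
        F ((o, a) :: (o, b) :: t) := by
  have key : ∀ c d : Fin N, crossWeight q N s o o a b c d =
      (if c = b then if d = a then (if a = b then (if s then q else q⁻¹) else 1) else 0 else 0) +
      (if c = a then if d = b then
        (if below (s == o) a b then (if s then q - q⁻¹ else -(q - q⁻¹)) else 0) else 0 else 0) := by
    intro c d
    rcases eq_or_ne a b with h | h
    · subst h
      by_cases hc : c = a <;> by_cases hd : d = a <;> cases s <;> cases o <;>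
        simp [crossWeight, isPositive, below, hc, hd]
    · by_cases hc : c = b <;> by_cases hd : d = a <;> cases s <;> cases o <;>
        simp [crossWeight, isPositive, below, hc, hd, h, h.symm, ite_and]
  simp [layerAct, key, add_mul, Finset.sum_add_distrib, ite_mul]

/-- The weight of the transition of a cap of colour `a` to a cup of colour `c` in a crossing of
antiparallel strands. -/
def turnWeight (q : K) (N : ℕ) (s o : Bool) (a c : Fin N) : K :=
  if below (s == o) a c then
    (if s then -(q - q⁻¹) else q - q⁻¹) * (if o then pivot q N a * (pivot q N c)⁻¹ else 1)
  else 0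

/-- A crossing of antiparallel strands. -/
theorem layerAct_cross_antiparallel (s o : Bool) (F : List (Bool × Fin N) → K) (a b : Fin N)
    (t : List (Bool × Fin N)) :
    layerAct q (.cross 0 s) F ((o, a) :: (!o, b) :: t) =
      (if a = b then (if s then q⁻¹ else q) else 1) * F ((!o, b) :: (o, a) :: t) +
      if a = b then ∑ c, turnWeight q N s o a c * F ((!o, c) :: (o, c) :: t) else 0 := by
  have key : ∀ c d : Fin N, crossWeight q N s o (!o) a b c d =
      (if c = b then if d = a then (if a = b then (if s then q⁻¹ else q) else 1) else 0 else 0) +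
      (if d = c then if a = b then turnWeight q N s o a c else 0 else 0) := by
    intro c d
    rcases eq_or_ne a b with h | h
    · subst h
      by_cases hc : c = a
      · subst hc
        by_cases hd : d = c <;> cases s <;> cases o <;>
          simp [crossWeight, isPositive, below, turnWeight, hd]
      · by_cases hd : d = c <;> cases s <;> cases o <;>
          simp [crossWeight, isPositive, below, turnWeight, hc, hd, mul_assoc]
    · by_cases hc : c = b <;> by_cases hd : d = a <;> cases s <;> cases o <;>
        simp [crossWeight, isPositive, below, hc, hd, h, h.symm]
  simp only [layerAct, List.drop_zero, List.take_zero, List.nil_append, key, add_mul,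
    Finset.sum_add_distrib]
  congr 1
  · simp [ite_mul]
  · simp only [ite_mul, zero_mul, Finset.sum_ite_eq', Finset.mem_univ, if_true]
    split <;> simp

theorem layerAct_cup_zero (o : Bool) (F : List (Bool × Fin N) → K) (t : List (Bool × Fin N)) :
    layerAct q (.cup 0 o) F t = ∑ a, cupWeight q N o a * F ((o, a) :: (!o, a) :: t) := by
  simp [layerAct]

theorem layerAct_cup_succ (n : ℕ) (o : Bool) (F : List (Bool × Fin N) → K) (x : Bool × Fin N)
    (t : List (Bool × Fin N)) :
    layerAct q (.cup (n + 1) o) F (x :: t) = layerAct q (.cup n o) (fun r => F (x :: r)) t := by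
  simp [layerAct]

theorem layerAct_cap_zero (o : Bool) (a b : Fin N) (F : List (Bool × Fin N) → K)
    (t : List (Bool × Fin N)) :
    layerAct q (.cap 0) F ((o, a) :: (!o, b) :: t) =
      if a = b then capWeight q N o a * F t else 0 := by
  simp [layerAct, eq_comm]

theorem layerAct_cap_succ (n : ℕ) (F : List (Bool × Fin N) → K) (x : Bool × Fin N)
    (t : List (Bool × Fin N)) :
    layerAct q (.cap (n + 1)) F (x :: t) = layerAct q (.cap n) (fun r => F (x :: r)) t := by
  simp [layerAct]

theorem layerAct_cross_succ (n : ℕ) (s : Bool) (F : List (Bool × Fin N) → K) (x : Bool × Fin N)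
    (t : List (Bool × Fin N)) :
    layerAct q (.cross (n + 1) s) F (x :: t) =
      layerAct q (.cross n s) (fun r => F (x :: r)) t := by
  simp [layerAct]

/-- Reidemeister II for parallel strands. -/
theorem act_cross_cross_parallel (hq : q ≠ 0) (s o : Bool) (F : List (Bool × Fin N) → K)
    (a b : Fin N) :
    act q [.cross 0 s, .cross 0 (!s)] F [(o, a), (o, b)] = F [(o, a), (o, b)] := by
  simp only [act, layerAct_cross_parallel]
  rcases lt_trichotomy a b with h | h | h
  · cases s <;> cases o <;> simp [below, h, h.ne, h.ne', h.not_gt] <;> ring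
  · subst h
    cases s <;> cases o <;> simp [below, hq]
  · cases s <;> cases o <;> simp [below, h, h.ne, h.ne', h.not_gt] <;> ring

theorem sum_gt_pivot (hq : q ≠ 0) (c : Fin N) :
    ∑ a : Fin N, (if c < a then (q - q⁻¹) * pivot q N a else 0) = q ^ N - q * pivot q N c := by
  simp only [sub_inv_mul_pivot hq]
  rw [sum_fin_telescope_gt (fun a => q ^ (2 * (a : ℤ) - N)), pivot, ← zpow_one_add₀ hq,
    ← zpow_natCast]
  congr 2 <;> push_cast <;> ring

theorem sum_lt_pivot_inv (hq : q ≠ 0) (c : Fin N) :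
    ∑ a : Fin N, (if a < c then (q - q⁻¹) * (pivot q N a)⁻¹ else 0) =
      q ^ N - q * (pivot q N c)⁻¹ := by
  simp only [sub_inv_mul_pivot_inv hq]
  rw [sum_fin_telescope_lt (fun a => -q ^ ((N : ℤ) - 2 * (a : ℤ))), pivot, ← zpow_neg,
    ← zpow_one_add₀ hq, neg_sub_neg, ← zpow_natCast]
  congr 2
  ring

theorem sum_between_pivot (hq : q ≠ 0) {c d : Fin N} (hcd : c < d) :
    ∑ a : Fin N, (if c < a ∧ a < d then (q - q⁻¹) * pivot q N a else 0) =
      q⁻¹ * pivot q N d - q * pivot q N c := by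
  simp only [sub_inv_mul_pivot hq]
  rw [sum_fin_telescope_between (fun a => q ^ (2 * (a : ℤ) - N)) hcd, pivot, pivot,
    ← zpow_one_add₀ hq, ← zpow_neg_one, ← zpow_add₀ hq]
  congr 2 <;> push_cast <;> ring

theorem sum_between_pivot_inv (hq : q ≠ 0) {c d : Fin N} (hcd : c < d) :
    ∑ a : Fin N, (if c < a ∧ a < d then (q - q⁻¹) * (pivot q N a)⁻¹ else 0) =
      q⁻¹ * (pivot q N c)⁻¹ - q * (pivot q N d)⁻¹ := by
  simp only [sub_inv_mul_pivot_inv hq]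
  rw [sum_fin_telescope_between (fun a => -q ^ ((N : ℤ) - 2 * (a : ℤ))) hcd, pivot, pivot,
    ← zpow_neg, ← zpow_neg, ← zpow_one_add₀ hq, ← zpow_neg_one, ← zpow_add₀ hq, neg_sub_neg]
  congr 2 <;> push_cast <;> ring

theorem below_trans {p : Bool} {a b c : Fin N} (h : below p a b) (h' : below p b c) :
    below p a c := by
  cases p <;> simp only [below, if_true, Bool.false_eq_true, if_false, decide_eq_true_eq] at *
  · exact h'.trans h
  · exact h.trans h'

/-- This is the coefficient of the turn from colour `a` to colour `d` in a crossing followed by its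
inverse. The first two terms turn in only one of the crossings. The sum turns in both, through a
colour strictly between `a` and `d`, and telescopes to their negative. -/
theorem turnWeight_comp (hq : q ≠ 0) (s o : Bool) (a d : Fin N) :
    (if s then q⁻¹ else q) * turnWeight q N (!s) (!o) a d +
      turnWeight q N s o a d * (if s then q else q⁻¹) +
      ∑ c, turnWeight q N s o a c * turnWeight q N (!s) (!o) c d = 0 := by
  have ha := pivot_ne_zero hq a
  have hd := pivot_ne_zero hq d
  -- The inverse crossing has the opposite slash and starts from reversed orientations, so both
  -- crossings use the same order of colours.
  have hso : ((!s) == (!o)) = (s == o) := by cases s <;> cases o <;> rfl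
  by_cases h : below (s == o) a d = true
  · have e : ∀ c, turnWeight q N s o a c * turnWeight q N (!s) (!o) c d =
        -((q - q⁻¹) * if o then pivot q N a else (pivot q N d)⁻¹) *
          (if below (s == o) a c = true ∧ below (s == o) c d = true then
            (q - q⁻¹) * (if o then (pivot q N c)⁻¹ else pivot q N c) else 0) := by
      intro c
      simp only [turnWeight, hso, ite_and]
      split_ifs <;> simp_all <;> ring
    simp only [e, ← Finset.mul_sum]
    cases o <;> cases s <;>
      simp [below] at h ⊢
    · rw [sum_between_pivot hq h]
      simp [turnWeight, below, h]
      field_simp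
      ring
    · simp only [and_comm (a := _ < a)]
      rw [sum_between_pivot hq h]
      simp [turnWeight, below, h]
      field_simp
      ring
    · simp only [and_comm (a := _ < a)]
      rw [sum_between_pivot_inv hq h]
      simp [turnWeight, below, h]
      field_simp
      ring
    · rw [sum_between_pivot_inv hq h]
      simp [turnWeight, below, h]
      field_simp
      ring
  · have e : ∀ c, turnWeight q N s o a c * turnWeight q N (!s) (!o) c d = 0 := by
      intro c
      by_cases h1 : below (s == o) a c = true
      · have h2 : ¬ below (s == o) c d = true := fun h2 => h (below_trans h1 h2)
        simp [turnWeight, hso, h2]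
      · simp [turnWeight, h1]
    rw [Finset.sum_eq_zero fun c _ => e c]
    simp [turnWeight, hso, h]

/-- Reidemeister II for antiparallel strands. -/
theorem act_cross_cross_antiparallel (hq : q ≠ 0) (s o : Bool) (F : List (Bool × Fin N) → K)
    (a b : Fin N) :
    act q [.cross 0 s, .cross 0 (!s)] F [(o, a), (!o, b)] = F [(o, a), (!o, b)] := by
  have e (G : List (Bool × Fin N) → K) (x y : Fin N) :=
    layerAct_cross_antiparallel (q := q) (!s) (!o) G x y []
  simp only [Bool.not_not] at e
  simp only [act, layerAct_cross_antiparallel, e]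
  rcases eq_or_ne a b with rfl | h
  · simp only [if_true, mul_add, Finset.sum_add_distrib, Finset.mul_sum]
    rw [Finset.sum_comm, add_assoc, ← add_assoc (Finset.sum _ _), ← Finset.sum_add_distrib,
      ← Finset.sum_add_distrib]
    rw [Finset.sum_eq_zero]
    · cases s <;> simp [hq]
    · intro d _
      -- The coefficient of each final colour `d` vanishes; only the strands that run through
      -- remain.
      rw [← mul_eq_zero_of_left (turnWeight_comp hq s o a d) (F [(o, d), (!o, d)])]
      simp only [add_mul, Finset.sum_mul]
      cases s <;> simp [mul_assoc]
  · simp [h, h.symm]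

/-- The skein relation for parallel strands. -/
theorem act_skein_parallel (o : Bool) (F : List (Bool × Fin N) → K) (a b : Fin N) :
    act q [.cross 0 true] F [(o, a), (o, b)] =
      act q [.cross 0 false] F [(o, a), (o, b)] + (q - q⁻¹) * F [(o, a), (o, b)] := by
  simp only [act, layerAct_cross_parallel]
  rcases lt_trichotomy a b with h | h | h
  · cases o <;> simp [below, h, h.ne, h.not_gt]
    ring
  · subst h
    cases o <;> simp [below] <;> ring
  · cases o <;> simp [below, h, h.ne', h.not_gt]
    ring

/-- The skein relation for antiparallel strands. -/
theorem act_skein_antiparallel (hq : q ≠ 0) (o : Bool) (F : List (Bool × Fin N) → K)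
    (a b : Fin N) :
    act q [.cross 0 false] F [(o, a), (!o, b)] =
      act q [.cross 0 true] F [(o, a), (!o, b)] +
        (q - q⁻¹) * act q [.cap 0, .cup 0 (!o)] F [(o, a), (!o, b)] := by
  simp only [act, layerAct_cross_antiparallel, layerAct_cap_zero, layerAct_cup_zero]
  rcases eq_or_ne a b with rfl | h
  · have h1 : ∀ c, turnWeight q N false o a c - turnWeight q N true o a c =
        (q - q⁻¹) * (capWeight q N o a * cupWeight q N (!o) c) -
          if c = a then (q - q⁻¹) else 0 := by
      intro c
      have ha := pivot_ne_zero hq a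
      rcases lt_trichotomy a c with h | h | h
      · cases o <;> simp [turnWeight, below, capWeight, cupWeight, h, h.ne', h.not_gt]
        ring
      · subst h
        cases o <;> simp [turnWeight, below, capWeight, cupWeight, ha]
      · cases o <;> simp [turnWeight, below, capWeight, cupWeight, h, h.ne, h.not_gt]
    have h2 : ∑ c, turnWeight q N false o a c * F [(!o, c), (o, c)] -
        ∑ c, turnWeight q N true o a c * F [(!o, c), (o, c)] =
        (q - q⁻¹) * (capWeight q N o a * ∑ c, cupWeight q N (!o) c * F [(!o, c), (o, c)]) -
          (q - q⁻¹) * F [(!o, a), (o, a)] := by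
      rw [← Finset.sum_sub_distrib]
      simp only [← sub_mul, h1]
      simp [sub_mul, Finset.sum_sub_distrib, Finset.mul_sum, mul_assoc]
    simp only [if_true, Bool.false_eq_true, if_false, Bool.not_not]
    linear_combination h2
  · simp [h]

/-- A positive curl at a local minimum. -/
theorem act_curl_cup (hq : q ≠ 0) (o : Bool) (F : List (Bool × Fin N) → K) :
    act q [.cup 0 o, .cross 0 false] F [] = q ^ N * act q [.cup 0 (!o)] F [] := by
  simp only [act, layerAct_cross_antiparallel, layerAct_cup_zero]
  simp only [if_true, Bool.false_eq_true, if_false, mul_add, Finset.sum_add_distrib,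
    Finset.mul_sum, Bool.not_not]
  -- The coefficients of a fixed final colour `c` are compared: the diagonal weight and the
  -- telescoped turn weights add up to `q ^ N`.
  rw [Finset.sum_comm, ← Finset.sum_add_distrib]
  refine Finset.sum_congr rfl fun c _ => ?_
  have hc := pivot_ne_zero hq c
  simp only [← mul_assoc, ← Finset.sum_mul, ← add_mul]
  congr 1
  cases o
  · have := sum_lt_pivot_inv hq c
    have e : ∀ a, cupWeight q N false a * turnWeight q N false false a c =
        if a < c then (q - q⁻¹) * (pivot q N a)⁻¹ else 0 := by
      intro a
      by_cases h : a < c <;> simp [cupWeight, turnWeight, below, h, mul_comm]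
    simp only [e, this]
    simp [cupWeight]
    ring
  · have := sum_gt_pivot hq c
    have e : ∀ a, cupWeight q N true a * turnWeight q N false true a c =
        (if c < a then (q - q⁻¹) * pivot q N a else 0) * (pivot q N c)⁻¹ := by
      intro a
      by_cases h : c < a <;> simp [cupWeight, turnWeight, below, h, mul_assoc]
    simp only [e, ← Finset.sum_mul, this]
    simp [cupWeight]
    field_simp
    ring

/-- A positive curl at a local maximum. -/
theorem act_curl_cap (hq : q ≠ 0) (o : Bool) (F : List (Bool × Fin N) → K) (a b : Fin N) :
    act q [.cross 0 false, .cap 0] F [(o, a), (!o, b)] =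
      q ^ N * act q [.cap 0] F [(o, a), (!o, b)] := by
  have e (x y : Fin N) := layerAct_cap_zero (q := q) (!o) x y F []
  simp only [Bool.not_not] at e
  simp only [act, layerAct_cross_antiparallel, layerAct_cap_zero, e]
  rcases eq_or_ne a b with rfl | h
  · have ha := pivot_ne_zero hq a
    simp only [if_true, Bool.false_eq_true, if_false]
    simp only [← mul_assoc, ← Finset.sum_mul, ← add_mul]
    congr 1
    cases o
    · have := sum_gt_pivot hq a
      have e : ∀ c, turnWeight q N false false a c * capWeight q N true c =
          if a < c then (q - q⁻¹) * pivot q N c else 0 := by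
        intro c
        by_cases h : a < c <;> simp [capWeight, turnWeight, below, h]
      simp only [Bool.not_false, e, this]
      simp [capWeight]
    · have := sum_lt_pivot_inv hq a
      have e : ∀ c, turnWeight q N false true a c * capWeight q N false c =
          (if c < a then (q - q⁻¹) * (pivot q N c)⁻¹ else 0) * pivot q N a := by
        intro c
        by_cases h : c < a <;> simp [capWeight, turnWeight, below, h]
        ring
      simp only [Bool.not_true, e, ← Finset.sum_mul, this]
      simp [capWeight]
      field_simp
      ring
  · simp [h, h.symm]

theorem cupWeight_mul_capWeight_not (hq : q ≠ 0) (o : Bool) (a : Fin N) :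
    cupWeight q N o a * capWeight q N (!o) a = 1 := by
  have := pivot_ne_zero hq a
  cases o <;> simp [cupWeight, capWeight, this]

theorem act_zigzag_left (hq : q ≠ 0) (o : Bool) (F : List (Bool × Fin N) → K) (a : Fin N) :
    act q [.cup 0 o, .cap 1] F [(o, a)] = F [(o, a)] := by
  have e (x y : Fin N) := layerAct_cap_zero (q := q) (!o) x y
  simp only [Bool.not_not] at e
  simp only [act, layerAct_cup_zero, layerAct_cap_succ _ _ _, e, mul_ite, mul_zero,
    Finset.sum_ite_eq', Finset.mem_univ, if_true]
  rw [← mul_assoc, cupWeight_mul_capWeight_not hq, one_mul]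

theorem act_zigzag_right (hq : q ≠ 0) (o : Bool) (F : List (Bool × Fin N) → K) (a : Fin N) :
    act q [.cup 1 (!o), .cap 0] F [(o, a)] = F [(o, a)] := by
  have e := cupWeight_mul_capWeight_not hq (!o) a
  rw [Bool.not_not] at e
  simp only [act, layerAct_cup_succ, layerAct_cup_zero, layerAct_cap_zero, mul_ite, mul_zero,
    Finset.sum_ite_eq, Finset.mem_univ, if_true, Bool.not_not]
  rw [← mul_assoc, e, one_mul]

theorem act_circle (hq : q ≠ 0) (hz : q - q⁻¹ ≠ 0) (o : Bool) (F : List (Bool × Fin N) → K) :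
    act q [.cup 0 o, .cap 0] F [] = (q - q⁻¹)⁻¹ * (q ^ N - (q ^ N)⁻¹) * F [] := by
  simp only [act, layerAct_cup_zero, layerAct_cap_zero, if_true, ← mul_assoc, ← Finset.sum_mul]
  congr 1
  cases o
  · rw [← sub_inv_mul_sum_pivot_inv hq, inv_mul_cancel_left₀ hz]
    simp [cupWeight, capWeight]
  · rw [← sub_inv_mul_sum_pivot hq, inv_mul_cancel_left₀ hz]
    simp [cupWeight, capWeight]

/-- Turning a crossing with the help of a cup. -/
theorem act_slide_cup (hq : q ≠ 0) (b o s : Bool) (F : List (Bool × Fin N) → K) (x : Fin N) :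
    act q [.cup 0 b, .cross 1 s] F [(o, x)] = act q [.cup 1 b, .cross 0 (!s)] F [(o, x)] := by
  have hx := pivot_ne_zero hq x
  simp only [act, layerAct_cup_zero, layerAct_cup_succ, layerAct_cross_succ]
  -- Sliding around the cup exchanges a crossing of parallel strands with one of antiparallel
  -- strands. The unpermuted term of the former matches the turn term of the latter, up to the
  -- pivots carried by the cups.
  rcases Bool.eq_or_eq_not o b with rfl | rfl
  · have e (G : List (Bool × Fin N) → K) (a c : Fin N) :=
      layerAct_cross_antiparallel (q := q) s (!o) G a c []
    simp only [Bool.not_not] at e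
    simp only [layerAct_cross_parallel, e, mul_add, Finset.sum_add_distrib, mul_ite, mul_zero,
      Finset.sum_ite_eq', Finset.mem_univ, if_true]
    congr 1
    · refine Finset.sum_congr rfl fun a _ => ?_
      congr 2
      cases s <;> simp [eq_comm]
    · simp only [Finset.mul_sum, ← mul_assoc]
      refine Finset.sum_congr rfl fun c _ => ?_
      congr 1
      cases s <;> cases o <;> simp [turnWeight, below, cupWeight] <;> split_ifs <;>
        field_simp
  · have e (G : List (Bool × Fin N) → K) (a c : Fin N) :=
      layerAct_cross_antiparallel (q := q) (!s) (!b) G a c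
    simp only [Bool.not_not] at e
    simp only [layerAct_cross_parallel, e, mul_add, Finset.sum_add_distrib, mul_ite, mul_zero,
      Finset.sum_ite_eq, Finset.mem_univ, if_true]
    congr 1
    · refine Finset.sum_congr rfl fun a _ => ?_
      congr 2
      cases s <;> simp [eq_comm]
    · simp only [Finset.mul_sum, ← mul_assoc]
      refine Finset.sum_congr rfl fun c _ => ?_
      congr 1
      cases s <;> cases b <;> simp [turnWeight, below, cupWeight] <;> split_ifs <;>
        field_simp

/-- Turning a crossing with the help of a cap. -/
theorem act_slide_cap (hq : q ≠ 0) (b o s : Bool) (F : List (Bool × Fin N) → K) (x y z : Fin N) :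
    act q [.cross 1 s, .cap 0] F [(b, x), (o, y), (!b, z)] =
      act q [.cross 0 (!s), .cap 1] F [(b, x), (o, y), (!b, z)] := by
  have hx := pivot_ne_zero hq x
  have hz := pivot_ne_zero hq z
  have hy := pivot_ne_zero hq y
  have e (b : Bool) (G : List (Bool × Fin N) → K) (a c : Fin N) :=
    layerAct_cap_zero (q := q) (!b) a c G
  have e' (b s : Bool) (G : List (Bool × Fin N) → K) (a c : Fin N) :=
    layerAct_cross_antiparallel (q := q) s (!b) G a c
  simp only [Bool.not_not] at e e'
  rcases Bool.eq_or_eq_not o b with rfl | rfl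
  · simp only [act, layerAct_cap_zero, layerAct_cap_succ, layerAct_cross_succ,
      layerAct_cross_parallel, layerAct_cross_antiparallel]
    congr 1
    · by_cases hxz : x = z
      · subst hxz; cases s <;> simp [eq_comm]
      · simp [hxz]
    · by_cases hyz : y = z
      · subst hyz
        cases s <;> cases o <;> simp [turnWeight, below, capWeight] <;> split_ifs <;> field_simp
      · simp [hyz]
  · simp only [act, layerAct_cap_zero, layerAct_cap_succ, layerAct_cross_succ,
      layerAct_cross_parallel, layerAct_cross_antiparallel]
    congr 1
    · by_cases hxz : x = z
      · subst hxz; cases s <;> simp [eq_comm]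
      · simp [hxz]
    · by_cases hyz : x = y
      · subst hyz
        cases s <;> cases b <;> simp [turnWeight, below, capWeight] <;> split_ifs <;> field_simp
      · simp [hyz]

/-- Reidemeister III for three downward strands. -/
theorem act_braid (hq : q ≠ 0) (F : List (Bool × Fin N) → K) (x y z : Fin N) :
    act q [.cross 0 true, .cross 1 false, .cross 0 false] F [(false, x), (false, y), (false, z)] =
      act q [.cross 1 false, .cross 0 false, .cross 1 true] F
        [(false, x), (false, y), (false, z)] := by
  simp only [act, layerAct_cross_succ, layerAct_cross_parallel]
  -- The weights depend only on the relative order of the colours, so every order type of `x`, `y`,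
  -- `z` leaves a polynomial identity in `q` and `q⁻¹`.
  rcases lt_trichotomy x y with h | rfl | h
  · rcases lt_trichotomy y z with h' | rfl | h'
    · have k := h.trans h'
      simp [below, h, h.ne, h.ne', h.not_gt, h', h'.ne, h'.ne', h'.not_gt, k, k.ne, k.not_gt]
      try field_simp
      try ring
    · simp [below, h, h.ne, h.ne', h.not_gt]
      try field_simp
      try ring
    · rcases lt_trichotomy x z with k | rfl | k
      · simp [below, h, h.ne, h.ne', h.not_gt, h', h'.ne, h'.ne', h'.not_gt, k, k.ne, k.not_gt]
        try field_simp
        try ring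
      · simp [below, h, h.ne, h.ne', h.not_gt]
        try field_simp
        try ring
      · simp [below, h, h.ne, h.ne', h.not_gt, h', h'.ne, h'.ne', h'.not_gt, k, k.ne', k.not_gt]
        try field_simp
        try ring
  · rcases lt_trichotomy x z with h' | rfl | h'
    · simp [below, h', h'.ne, h'.ne', h'.not_gt]
      try field_simp
      try ring
    · simp [below]
      try field_simp
      try ring
    · simp [below, h', h'.ne, h'.ne', h'.not_gt]
      try field_simp
      try ring
  · rcases lt_trichotomy y z with h' | rfl | h'
    · rcases lt_trichotomy x z with k | rfl | k
      · simp [below, h, h.ne, h.ne', h.not_gt, h', h'.ne, h'.ne', h'.not_gt, k, k.ne, k.not_gt]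
        try field_simp
        try ring
      · simp [below, h, h.ne, h.ne', h.not_gt]
        try field_simp
        try ring
      · simp [below, h, h.ne, h.ne', h.not_gt, h', h'.ne, h'.ne', h'.not_gt, k, k.ne', k.not_gt]
        try field_simp
        try ring
    · simp [below, h, h.ne, h.ne', h.not_gt]
      try field_simp
      try ring
    · have k := h'.trans h
      simp [below, h, h.ne, h.ne', h.not_gt, h', h'.ne, h'.ne', h'.not_gt, k, k.ne', k.not_gt]
      try field_simp
      try ring

end Coordinates

/-! ## The local relations between words -/

theorem exists_of_map_fst_one {α : Type*} {s : List (Bool × α)} {o : Bool}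
    (h : s.map Prod.fst = [o]) : ∃ a, s = [(o, a)] := by
  match s, h with
  | [(_, a)], h => exact ⟨a, by simpa using h⟩

theorem exists_of_map_fst_two {α : Type*} {s : List (Bool × α)} {o o' : Bool}
    (h : s.map Prod.fst = [o, o']) : ∃ a b, s = [(o, a), (o', b)] := by
  match s, h with
  | [(_, a), (_, b)], h => exact ⟨a, b, by simpa using h⟩

theorem exists_of_map_fst_three {α : Type*} {s : List (Bool × α)} {o o' o'' : Bool}
    (h : s.map Prod.fst = [o, o', o'']) : ∃ a b c, s = [(o, a), (o', b), (o'', c)] := by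
  match s, h with
  | [(_, a), (_, b), (_, c)], h => exact ⟨a, b, c, by simpa using h⟩

theorem ev_cross_cross (o o' s : Bool) :
    ev [o, o'] [.cross 0 s, .cross 0 (!s)] = ev [o, o'] [] := by
  refine ev_ext fun N F x hx => ?_
  obtain ⟨a, b, rfl⟩ := exists_of_map_fst_two hx
  rcases Bool.eq_or_eq_not o' o with rfl | rfl
  · exact act_cross_cross_parallel q₀_ne_zero s _ F a b
  · exact act_cross_cross_antiparallel q₀_ne_zero s o F a b

theorem ev_skein_parallel (o : Bool) :
    ev [o, o] [.cross 0 true] = (1 : Coeff) • ev [o, o] [.cross 0 false] + cz • ev [o, o] [] := by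
  rw [one_smul]
  funext ⟨N, F, x, hx⟩
  obtain ⟨a, b, rfl⟩ := exists_of_map_fst_two hx
  rw [Sem.add_apply, Sem.smul_apply, specialize_cz]
  exact act_skein_parallel o F a b

theorem ev_skein_antiparallel (o : Bool) :
    ev [o, !o] [.cross 0 false] =
      (1 : Coeff) • ev [o, !o] [.cross 0 true] + cz • ev [o, !o] [.cap 0, .cup 0 (!o)] := by
  rw [one_smul]
  funext ⟨N, F, x, hx⟩
  obtain ⟨a, b, rfl⟩ := exists_of_map_fst_two hx
  rw [Sem.add_apply, Sem.smul_apply, specialize_cz]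
  exact act_skein_antiparallel q₀_ne_zero o F a b

theorem ev_curl_cup (o : Bool) : ev [] [.cup 0 o, .cross 0 false] = cA • ev [] [.cup 0 (!o)] := by
  funext ⟨N, F, x, hx⟩
  obtain rfl := List.map_eq_nil_iff.mp hx
  rw [Sem.smul_apply, specialize_cA]
  exact act_curl_cup q₀_ne_zero o F

theorem ev_curl_cap (o : Bool) :
    ev [o, !o] [.cross 0 false, .cap 0] = cA • ev [o, !o] [.cap 0] := by
  funext ⟨N, F, x, hx⟩
  obtain ⟨a, b, rfl⟩ := exists_of_map_fst_two hx
  rw [Sem.smul_apply, specialize_cA]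
  exact act_curl_cap q₀_ne_zero o F a b

theorem ev_zigzag_left (o : Bool) : ev [o] [.cup 0 o, .cap 1] = ev [o] [] := by
  refine ev_ext fun N F x hx => ?_
  obtain ⟨a, rfl⟩ := exists_of_map_fst_one hx
  exact act_zigzag_left q₀_ne_zero o F a

theorem ev_zigzag_right (o : Bool) : ev [o] [.cup 1 (!o), .cap 0] = ev [o] [] := by
  refine ev_ext fun N F x hx => ?_
  obtain ⟨a, rfl⟩ := exists_of_map_fst_one hx
  exact act_zigzag_right q₀_ne_zero o F a

theorem ev_circle (o : Bool) : ev [] [.cup 0 o, .cap 0] = cD • ev [] [] := by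
  funext ⟨N, F, x, hx⟩
  obtain rfl := List.map_eq_nil_iff.mp hx
  rw [Sem.smul_apply, cD, map_mul, map_sub, specialize_C, specialize_cA, specialize_cAinv]
  exact act_circle q₀_ne_zero q₀_sub_inv_ne_zero o F

theorem ev_slide_cup (b o s : Bool) :
    ev [o] [.cup 0 b, .cross 1 s] = ev [o] [.cup 1 b, .cross 0 (!s)] := by
  refine ev_ext fun N F x hx => ?_
  obtain ⟨a, rfl⟩ := exists_of_map_fst_one hx
  exact act_slide_cup q₀_ne_zero b o s F a

theorem ev_slide_cap (b o s : Bool) :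
    ev [b, o, !b] [.cross 1 s, .cap 0] = ev [b, o, !b] [.cross 0 (!s), .cap 1] := by
  refine ev_ext fun N F x hx => ?_
  obtain ⟨x, y, z, rfl⟩ := exists_of_map_fst_three hx
  exact act_slide_cap q₀_ne_zero b o s F x y z

/-- A single version of Reidemeister III suffices; it serves `ev_tangle_tangle`. -/
theorem ev_braid :
    ev [false, false, false] [.cross 0 true, .cross 1 false, .cross 0 false] =
      ev [false, false, false] [.cross 1 false, .cross 0 false, .cross 1 true] := by
  refine ev_ext fun N F x hx => ?_
  obtain ⟨x, y, z, rfl⟩ := exists_of_map_fst_three hx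
  exact act_braid q₀_ne_zero F x y z

/-! ## Interchanges and planar simplification -/

/-- The position of the leftmost strand of a layer. -/
def Layer.pos : Layer → ℕ
  | .cup i _ => i
  | .cap i => i
  | .cross i _ => i

/-- The layer, moved to a given position. -/
def Layer.moveTo : Layer → ℕ → Layer
  | .cup _ o, i => .cup i o
  | .cap _, i => .cap i
  | .cross _ s, i => .cross i s

/-- The number of strands that enter a layer. -/
def Layer.source : Layer → ℕ
  | .cup _ _ => 0
  | .cap _ => 2
  | .cross _ _ => 2

/-- The number of strands that leave a layer. -/
def Layer.target : Layer → ℕ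
  | .cup _ _ => 2
  | .cap _ => 0
  | .cross _ _ => 2

theorem Layer.shift_moveTo (L : Layer) (i j : ℕ) : (L.moveTo j).shift i = L.moveTo (i + j) := by
  cases L <;> rfl

theorem Layer.moveTo_pos (L : Layer) : L.moveTo L.pos = L := by
  cases L <;> rfl

/-- It isolates the strands `mid` that a layer touches, so that interchanges and cancellations
reduce to equations between concatenated lists. -/
theorem Layer.next_decomp {L : Layer} {o o' : List Bool} (h : L.next o = some o') :
    ∃ pre mid mid' post, o = pre ++ mid ++ post ∧ o' = pre ++ mid' ++ post ∧
      pre.length = L.pos ∧ mid.length = L.source ∧ mid'.length = L.target ∧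
      (L.moveTo 0).next mid = some mid' := by
  cases L with
  | cup i b =>
    simp only [Layer.next] at h
    split at h
    · rename_i hi
      simp only [Option.some.injEq] at h
      exact ⟨o.take i, [], [b, !b], o.drop i, by simp, by simp [← h], by simp [Layer.pos, hi],
        rfl, rfl, rfl⟩
    · simp at h
  | cap i =>
    simp only [Layer.next] at h
    rcases hd : o.drop i with _ | ⟨o₁, _ | ⟨o₂, t⟩⟩
    · simp [hd] at h
    · simp [hd] at h
    · have hi : i ≤ o.length := by
        by_contra hc
        rw [List.drop_eq_nil_of_le (by omega)] at hd
        simp at hd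
      simp only [hd] at h
      split at h
      · rename_i h1
        simp only [Option.some.injEq] at h
        refine ⟨o.take i, [o₁, o₂], [], t, ?_, by simp [← h], by simp [Layer.pos, hi], rfl, rfl, ?_⟩
        · rw [List.append_assoc]
          exact (List.take_append_drop i o).symm.trans (by rw [hd]; rfl)
        · simp [Layer.moveTo, Layer.next, h1]
      · simp at h
  | cross i s =>
    simp only [Layer.next] at h
    rcases hd : o.drop i with _ | ⟨o₁, _ | ⟨o₂, t⟩⟩
    · simp [hd] at h
    · simp [hd] at h
    · have hi : i ≤ o.length := by
        by_contra hc
        rw [List.drop_eq_nil_of_le (by omega)] at hd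
        simp at hd
      simp only [hd, Option.some.injEq] at h
      refine ⟨o.take i, [o₁, o₂], [o₂, o₁], t, ?_, by simp [← h], by simp [Layer.pos, hi], rfl, rfl,
        rfl⟩
      rw [List.append_assoc]
      exact (List.take_append_drop i o).symm.trans (by rw [hd]; rfl)

theorem endOrientation_singleton {L : Layer} {o o' : List Bool} :
    endOrientation [L] o = some o' ↔ L.next o = some o' := by
  simp [endOrientation]

/-- Two consecutive layers, the second to the right of the first, can be interchanged. -/
theorem ev_swap_right {L L' : Layer} {O O₁ O₂ : List Bool} (h₁ : L.next O = some O₁)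
    (h₂ : L'.next O₁ = some O₂) (h : L.pos + L.target ≤ L'.pos) :
    ev O [L, L'] = ev O [L'.moveTo (L'.pos - L.target + L.source), L] ∧
      endOrientation [L'.moveTo (L'.pos - L.target + L.source), L] O = some O₂ := by
  obtain ⟨pre, mid, mid', post, rfl, rfl, hp, hm, hm', hn⟩ := Layer.next_decomp h₁
  obtain ⟨pre₂, mid₂, mid₂', post₂, he, rfl, hp₂, hl₂, -, hn₂⟩ := Layer.next_decomp h₂
  -- Here `u` consists of the strands that pass between the two layers.
  obtain ⟨u, rfl, hu⟩ : ∃ u, pre₂ = pre ++ mid' ++ u ∧ post = u ++ mid₂ ++ post₂ := by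
    rw [List.append_assoc (pre₂), List.append_eq_append_iff] at he
    rcases he with ⟨u, h3, h4⟩ | ⟨u, h3, h4⟩
    · exact ⟨u, h3, by rw [h4, List.append_assoc]⟩
    · have : u = [] := by
        have := congrArg List.length h3
        simp only [List.length_append] at this
        exact List.length_eq_zero_iff.mp (by omega)
      subst this
      exact ⟨[], by simpa using h3.symm, by simpa using h4.symm⟩
  subst hu
  have e1 : endOrientation [L.moveTo 0] (mid ++ u) = some (mid' ++ u) := by
    rw [endOrientation_singleton]
    have := Layer.next_shift hn [] u
    simpa [Layer.shift_moveTo] using this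
  have e2 : endOrientation [L'.moveTo 0] mid₂ = some mid₂' := by
    rwa [endOrientation_singleton]
  have := ctx_interchange (pre := pre) (post := post₂) [] [] (O := pre ++ mid ++ (u ++ mid₂ ++ post₂))
    (by simp [endOrientation]) e1 e2
  simp only [List.length_append] at hp₂
  simp only [shift, List.map_cons, List.map_nil, Layer.shift_moveTo, add_zero, List.nil_append,
    List.cons_append, List.length_append, hp, hm, hm', Layer.moveTo_pos] at this
  rw [show L.pos + (L.target + u.length) = L'.pos by omega, Layer.moveTo_pos] at this
  rw [this, show L'.pos - L.target + L.source = L.pos + (L.source + u.length) by omega]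
  refine ⟨rfl, ?_⟩
  have t1 := Layer.next_shift hn₂ (pre ++ mid ++ u) post₂
  have t2 := Layer.next_shift hn pre (u ++ mid₂' ++ post₂)
  simp only [Layer.shift_moveTo, List.length_append, hp, hm, add_zero, Layer.moveTo_pos,
    List.append_assoc] at t1 t2
  simp [endOrientation, t1, t2]

/-- Two consecutive layers, the second to the left of the first, can be interchanged. -/
theorem ev_swap_left {L L' : Layer} {O O₁ O₂ : List Bool} (h₁ : L.next O = some O₁)
    (h₂ : L'.next O₁ = some O₂) (h : L'.pos + L'.source ≤ L.pos) :
    ev O [L, L'] = ev O [L', L.moveTo (L.pos - L'.source + L'.target)] ∧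
      endOrientation [L', L.moveTo (L.pos - L'.source + L'.target)] O = some O₂ := by
  obtain ⟨pre, mid, mid', post, rfl, rfl, hp, hm, hm', hn⟩ := Layer.next_decomp h₁
  obtain ⟨pre₂, mid₂, mid₂', post₂, he, rfl, hp₂, hl₂, hl₂', hn₂⟩ := Layer.next_decomp h₂
  obtain ⟨u, rfl, hu⟩ : ∃ u, pre = pre₂ ++ mid₂ ++ u ∧ post₂ = u ++ mid' ++ post := by
    rw [List.append_assoc pre, List.append_eq_append_iff] at he
    rcases he with ⟨u, h3, h4⟩ | ⟨u, h3, h4⟩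
    · have : u = [] := by
        have := congrArg List.length h3
        simp only [List.length_append] at this
        exact List.length_eq_zero_iff.mp (by omega)
      subst this
      exact ⟨[], by simpa using h3.symm, by simpa using h4.symm⟩
    · exact ⟨u, h3, by rw [h4, List.append_assoc]⟩
  subst hu
  have e1 : endOrientation [L.moveTo 0] mid = some mid' := by
    rwa [endOrientation_singleton]
  have e2 : endOrientation [L'.moveTo 0] (mid₂ ++ u) = some (mid₂' ++ u) := by
    rw [endOrientation_singleton]
    have := Layer.next_shift hn₂ [] u
    simpa [Layer.shift_moveTo] using this
  have := ctx_interchange (pre := pre₂) (post := post) [] []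
    (O := pre₂ ++ mid₂ ++ u ++ mid ++ post) (by simp [endOrientation]) e2 e1
  simp only [List.length_append] at hp
  simp only [shift, List.map_cons, List.map_nil, Layer.shift_moveTo, add_zero, List.nil_append,
    List.cons_append, List.length_append, hp₂, hl₂, hl₂', Layer.moveTo_pos] at this
  rw [show L'.pos + (L'.source + u.length) = L.pos by omega, Layer.moveTo_pos] at this
  rw [← this, show L.pos - L'.source + L'.target = L'.pos + (L'.target + u.length) by omega]
  refine ⟨rfl, ?_⟩
  have t1 := Layer.next_shift hn₂ pre₂ (u ++ mid ++ post)
  have t2 := Layer.next_shift hn (pre₂ ++ mid₂' ++ u) post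
  simp only [Layer.shift_moveTo, List.length_append, hp₂, hl₂', add_zero, Layer.moveTo_pos,
    List.append_assoc] at t1 t2
  simp [endOrientation, t1, t2]

/-- A local relation inside a word, without a shift of the strands. -/
theorem ctx_zero {o O o₁ o₂ : List Bool} {w w₁ : List Layer} {c : Coeff} (p r : List Layer)
    (h : ev o w = c • ev o w₁) (hp : endOrientation p O = some o)
    (h₁ : endOrientation w o = some o₁) (h₂ : endOrientation w₁ o = some o₂) :
    ev O (p ++ (w ++ r)) = c • ev O (p ++ (w₁ ++ r)) := by
  have := ctx1 (pre := []) (post := []) p r h (by simpa using hp) h₁ h₂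
  simpa only [List.length_nil, shift_zero] using this

/-- Move a local maximum down as far as possible through a reversed word, and count the circles
that are split off. -/
def absorb : List Layer → ℕ → ℕ × List Layer
  | [], i => (0, [.cap i])
  | .cup j o :: r, i =>
    if i = j then (1, r)
    else if i = j + 1 then (0, r)
    else if i + 1 = j then (0, r)
    else if j + 1 < i then ((absorb r (i - 2)).1, .cup j o :: (absorb r (i - 2)).2)
    else ((absorb r i).1, .cup (j - 2) o :: (absorb r i).2)
  | .cap j :: r, i =>
    if j ≤ i then ((absorb r (i + 2)).1, .cap j :: (absorb r (i + 2)).2)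
    else (0, .cap i :: .cap j :: r)
  | .cross j s :: r, i =>
    if j + 1 < i then ((absorb r i).1, .cross j s :: (absorb r i).2)
    else if i + 1 < j then ((absorb r i).1, .cross (j - 2) s :: (absorb r i).2)
    else (0, .cap i :: .cross j s :: r)

theorem endOrientation_append_some {w w' : List Layer} {O O' : List Bool} :
    endOrientation (w ++ w') O = some O' ↔
      ∃ o, endOrientation w O = some o ∧ endOrientation w' o = some O' := by
  rw [endOrientation_append, Option.bind_eq_some_iff]

theorem endOrientation_pair {L L' : Layer} {O O' : List Bool} :
    endOrientation [L, L'] O = some O' ↔ ∃ o, L.next O = some o ∧ L'.next o = some O' := by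
  simp [endOrientation, Option.bind_eq_some_iff]

/-- The word `w'` can replace the word `w` at the cost of the scalar `c`. -/
def Reduces (O O' : List Bool) (w : List Layer) (c : Coeff) (w' : List Layer) : Prop :=
  ev O w = c • ev O w' ∧ endOrientation w' O = some O'

theorem reduces_refl {O O' : List Bool} {w : List Layer} (h : endOrientation w O = some O') :
    Reduces O O' w 1 w := ⟨(one_smul _ _).symm, h⟩

/-- Reduction of the last two layers. -/
theorem reduces_of_pair {O o O' : List Bool} {r v : List Layer} {L L' : Layer} {c : Coeff}
    (hr : endOrientation r O = some o) (hL : endOrientation [L, L'] o = some O')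
    (h : ev o [L, L'] = c • ev o v) (hv : endOrientation v o = some O') :
    Reduces O O' (r ++ [L] ++ [L']) c (r ++ v) := by
  have := ctx_zero r [] h hr hL hv
  refine ⟨by simpa using this, endOrientation_append_some.mpr ⟨o, hr, hv⟩⟩

/-- The cap descends by interchanges until it meets a cup. Meeting it squarely splits off a circle,
worth `cD`; overlapping it in one strand makes a zigzag, which straightens at no cost. If the cap is
blocked by a crossing or another cap it stays, which is harmless, because only an equality of words
is claimed. -/
theorem reduces_absorb (r : List Layer) (i : ℕ) {O O' : List Bool}
    (h : endOrientation (r.reverse ++ [.cap i]) O = some O') :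
    Reduces O O' (r.reverse ++ [.cap i]) (cD ^ (absorb r i).1) (absorb r i).2.reverse := by
  induction r generalizing i O' with
  | nil => simpa [absorb] using reduces_refl h
  | cons L r ih =>
    simp only [List.reverse_cons] at h ⊢
    rw [List.append_assoc] at h
    obtain ⟨o, hr, hL⟩ := endOrientation_append_some.mp h
    obtain ⟨o₁, h₁, h₂⟩ := endOrientation_pair.mp hL
    -- the two kinds of interchange
    have right (hpos : L.pos + L.target ≤ i) :
        Reduces O O' (r.reverse ++ [L] ++ [.cap i])
          (cD ^ (absorb r (i - L.target + L.source)).1)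
          (L :: (absorb r (i - L.target + L.source)).2).reverse := by
      obtain ⟨e1, e2⟩ := ev_swap_right h₁ h₂ hpos
      obtain ⟨o₂, k₁, k₂⟩ := endOrientation_pair.mp e2
      have hcap : endOrientation (r.reverse ++ [.cap (i - L.target + L.source)]) O = some o₂ :=
        endOrientation_append_some.mpr ⟨o, hr, endOrientation_singleton.mpr k₁⟩
      obtain ⟨f1, f2⟩ := ih _ hcap
      have a1 := ctx_zero r.reverse [] (e1.trans (one_smul Coeff _).symm) hr hL e2
      have a2 := ctx_zero [] [L] f1 rfl hcap f2
      rw [one_smul] at a1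
      refine ⟨?_, ?_⟩
      · simp only [List.append_nil, List.nil_append, List.append_assoc, List.reverse_cons,
          List.cons_append] at a1 a2 ⊢
        exact a1.trans a2
      · rw [List.reverse_cons]
        exact endOrientation_append_some.mpr ⟨o₂, f2, endOrientation_singleton.mpr k₂⟩
    have left (hpos : i + 2 ≤ L.pos) :
        Reduces O O' (r.reverse ++ [L] ++ [.cap i])
          (cD ^ (absorb r i).1)
          (L.moveTo (L.pos - 2) :: (absorb r i).2).reverse := by
      obtain ⟨e1, e2⟩ := ev_swap_left h₁ h₂ hpos
      simp only [Layer.source, Layer.target, add_zero] at e1 e2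
      obtain ⟨o₂, k₁, k₂⟩ := endOrientation_pair.mp e2
      have hcap : endOrientation (r.reverse ++ [.cap i]) O = some o₂ :=
        endOrientation_append_some.mpr ⟨o, hr, endOrientation_singleton.mpr k₁⟩
      obtain ⟨f1, f2⟩ := ih _ hcap
      have a1 := ctx_zero r.reverse [] (e1.trans (one_smul Coeff _).symm) hr hL e2
      have a2 := ctx_zero [] [L.moveTo (L.pos - 2)] f1 rfl hcap f2
      rw [one_smul] at a1
      refine ⟨?_, ?_⟩
      · simp only [List.append_nil, List.nil_append, List.append_assoc, List.reverse_cons,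
          List.cons_append] at a1 a2 ⊢
        exact a1.trans a2
      · rw [List.reverse_cons]
        exact endOrientation_append_some.mpr ⟨o₂, f2, endOrientation_singleton.mpr k₂⟩
    have stuck : Reduces O O' (r.reverse ++ [L] ++ [.cap i]) (cD ^ 0)
        (.cap i :: L :: r).reverse := by
      rw [pow_zero]
      have := reduces_refl (w := r.reverse ++ [L] ++ [.cap i]) (O := O) (O' := O')
        (by rw [List.append_assoc]; exact h)
      simpa using this
    cases L with
    | cup j b =>
      obtain ⟨pre, mid, mid', post, rfl, rfl, hp, hm, hm', hn⟩ := Layer.next_decomp h₁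
      obtain rfl : mid = [] := List.length_eq_zero_iff.mp hm
      simp only [Layer.moveTo, Layer.next, List.length_nil, le_refl, if_true, List.take_nil,
        List.drop_nil, List.nil_append, Option.some.injEq] at hn
      subst hn
      simp only [Layer.pos] at hp
      obtain ⟨pre₂, mid₂, mid₂', post₂, he, rfl, hp₂, hm₂, hm₂', hn₂⟩ := Layer.next_decomp h₂
      obtain rfl : mid₂' = [] := List.length_eq_zero_iff.mp hm₂'
      simp only [Layer.pos] at hp₂
      obtain ⟨x, y, rfl⟩ := List.length_eq_two.mp hm₂
      simp only [absorb]
      split_ifs with c1 c2 c3 c4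
      · -- a circle
        subst c1
        have hq : pre = pre₂ := by
          have := congrArg (List.take i) he
          simpa [hp, hp₂] using this
        subst hq
        have hpost : post = post₂ := by
          have := congrArg (List.drop (i + 2)) he
          simpa [List.drop_append, hp] using this
        subst hpost
        have e := ctx1 (pre := pre) (o := []) (post := post) (O := pre ++ [] ++ post) [] []
          (ev_circle b) rfl
          (endOrientation_pair.mpr ⟨_, rfl, by simp [Layer.next]; rfl⟩) rfl
        simp only [shift, Layer.shift, List.map_cons, List.map_nil, hp, add_zero, List.nil_append,
          List.append_nil] at e
        have := reduces_of_pair hr hL (by simpa using e) (by simp [endOrientation])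
        simpa using this
      · -- a zigzag
        subst c2
        obtain ⟨rfl, h5⟩ : pre₂ = pre ++ [b] ∧ (!b) :: post = x :: y :: post₂ := by
          have h6 : (pre ++ [b]) ++ ((!b) :: post) = pre₂ ++ (x :: y :: post₂) := by simpa using he
          exact List.append_inj h6 (by simp [hp, hp₂]) |>.imp_left Eq.symm
        obtain ⟨rfl, rfl⟩ := List.cons_eq_cons.mp h5
        obtain rfl : y = b := by
          simp only [Layer.moveTo, Layer.next, List.drop_zero] at hn₂
          simpa using hn₂
        have e := ctx (pre := pre) (o := [y]) (post := post₂) (O := pre ++ [y] ++ post₂) [] []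
          (ev_zigzag_left y) rfl (by simp [endOrientation, Layer.next]; rfl) rfl
        simp only [shift, Layer.shift, List.map_cons, List.map_nil, hp, add_zero, List.nil_append,
          List.append_nil] at e
        have := reduces_of_pair (c := 1) (v := []) hr hL (by
            rw [one_smul, show pre ++ [] ++ y :: post₂ = pre ++ [y] ++ post₂ by simp]; exact e)
          (by simp [endOrientation])
        simpa using this
      · -- a zigzag
        subst c3
        obtain ⟨rfl, h5⟩ : pre = pre₂ ++ [x] ∧ b :: (!b) :: post = y :: post₂ := by
          have h6 : pre ++ (b :: (!b) :: post) = (pre₂ ++ [x]) ++ (y :: post₂) := by simpa using he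
          exact List.append_inj h6 (by simp [hp, hp₂])
        obtain ⟨rfl, rfl⟩ := List.cons_eq_cons.mp h5
        obtain rfl : b = !x := by
          simp only [Layer.moveTo, Layer.next, List.drop_zero] at hn₂
          cases b <;> cases x <;> simp_all
        have e := ctx (pre := pre₂) (o := [x]) (post := post) (O := pre₂ ++ [x] ++ post) [] []
          (ev_zigzag_right x) rfl (by simp [endOrientation, Layer.next]; rfl) rfl
        simp only [shift, Layer.shift, List.map_cons, List.map_nil, hp₂, add_zero, List.nil_append,
          List.append_nil] at e
        have := reduces_of_pair (c := 1) (v := []) hr hL (by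
            rw [one_smul, show pre₂ ++ [x] ++ [] ++ post = pre₂ ++ [x] ++ post by simp]; exact e)
          (by simp [endOrientation])
        simpa using this
      · have := right (by simp only [Layer.target, Layer.pos]; omega)
        simpa only [Layer.target, Layer.source, add_zero] using this
      · have := left (by simp only [Layer.pos]; omega)
        simpa [Layer.pos, Layer.moveTo] using this
    | cap j =>
      simp only [absorb]
      split_ifs with c1
      · simpa [Layer.target, Layer.source, Layer.pos] using right c1
      · simpa using stuck
    | cross j s =>
      simp only [absorb]
      split_ifs with c1 c2
      · have := right (by simp only [Layer.target, Layer.pos]; omega)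
        simp only [Layer.target, Layer.source] at this
        rwa [show i - 2 + 2 = i by omega] at this
      · have := left (by simp only [Layer.pos]; omega)
        simpa [Layer.pos, Layer.moveTo] using this
      · simpa using stuck

/-- Continue the simplification of a word whose beginning is given in reversed form. -/
def simplifyFrom : ℕ × List Layer → List Layer → ℕ × List Layer
  | x, [] => (x.1, x.2.reverse)
  | x, .cap i :: w => simplifyFrom (x.1 + (absorb x.2 i).1, (absorb x.2 i).2) w
  | x, .cup i o :: w => simplifyFrom (x.1, .cup i o :: x.2) w
  | x, .cross i s :: w => simplifyFrom (x.1, .cross i s :: x.2) w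

/-- Remove zigzags and circles from a word by moving the local maxima down. -/
def simplify (w : List Layer) : ℕ × List Layer := simplifyFrom (0, []) w

/-- The invariant of the recursion: `v` is the part already read, `r` its simplified form in
reverse, and `n` the number of circles removed. -/
theorem reduces_simplifyFrom (w r v : List Layer) (n : ℕ) {O O' : List Bool}
    (h : ∃ o, Reduces O o v (cD ^ n) r.reverse ∧ endOrientation v O = some o ∧
      endOrientation w o = some O') :
    Reduces O O' (v ++ w) (cD ^ (simplifyFrom (n, r) w).1) (simplifyFrom (n, r) w).2 := by
  induction w generalizing n r v with
  | nil =>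
    obtain ⟨o, h1, -, h2⟩ := h
    simp only [endOrientation, Option.some.injEq] at h2
    subst h2
    simpa [simplifyFrom] using h1
  | cons L w ih =>
    obtain ⟨o, ⟨h1, h1'⟩, hv, h2⟩ := h
    obtain ⟨o₁, hL, hw⟩ : ∃ o₁, L.next o = some o₁ ∧ endOrientation w o₁ = some O' := by
      simpa [endOrientation, Option.bind_eq_some_iff] using h2
    have hv' : endOrientation (v ++ [L]) O = some o₁ :=
      endOrientation_append_some.mpr ⟨o, hv, endOrientation_singleton.mpr hL⟩
    have hr' : endOrientation (r.reverse ++ [L]) O = some o₁ :=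
      endOrientation_append_some.mpr ⟨o, h1', endOrientation_singleton.mpr hL⟩
    have e : ev O (v ++ [L]) = cD ^ n • ev O (r.reverse ++ [L]) := by
      simpa using ctx_zero [] [L] h1 rfl hv h1'
    rw [show v ++ L :: w = (v ++ [L]) ++ w by simp]
    cases L with
    | cap i =>
      obtain ⟨f1, f2⟩ := reduces_absorb r i hr'
      refine ih _ _ _ ⟨o₁, ⟨?_, f2⟩, hv', hw⟩
      rw [e, f1, smul_smul, pow_add]
    | cup i b => exact ih _ _ _ ⟨o₁, ⟨by simpa using e, by simpa using hr'⟩, hv', hw⟩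
    | cross i b => exact ih _ _ _ ⟨o₁, ⟨by simpa using e, by simpa using hr'⟩, hv', hw⟩

/-- With this, equalities between explicit planar tangles become computations settled by `rfl`. -/
theorem ev_simplify {O O' : List Bool} {w : List Layer} (h : endOrientation w O = some O') :
    ev O w = cD ^ (simplify w).1 • ev O (simplify w).2 := by
  have := reduces_simplifyFrom w [] [] 0 (O := O) (O' := O')
    ⟨O, by simpa using reduces_refl (O := O) (O' := O) (w := []) rfl, rfl, h⟩
  exact this.1

/-- The value of a closed word without crossings. -/
theorem ev_planar {w : List Layer} {n : ℕ} (h : simplify w = (n, []))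
    (hw : endOrientation w [] = some []) : ev [] w = cD ^ n • ev [] [] := by
  have := ev_simplify hw
  rwa [h] at this

/-- Words with the same simplification are equal. -/
theorem ev_eq_of_simplify {O O₁ O₂ : List Bool} {w w' : List Layer}
    (h : simplify w = simplify w') (hw : endOrientation w O = some O₁)
    (hw' : endOrientation w' O = some O₂) : ev O w = ev O w' := by
  rw [ev_simplify hw, ev_simplify hw', h]

/-! ## Rewriting inside concrete words -/

section Steps

variable {O o o₁ o₂ o₃ l : List Bool} {W W₁ W₂ w w₁ w₂ : List Layer} {c c₁ c₂ : Coeff}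

/-- For explicit words: the relation `h` is applied above the first `k` layers and to the right of
the first `n` strands. The side conditions are closed terms proved by `rfl`, which also determines
the new word. -/
theorem ev_step (k n : ℕ) (h : ev o w = ev o w₁)
    (hl : endOrientation (W.take k) O = some l := by rfl)
    (hn : l.take n ++ o ++ l.drop (n + o.length) = l := by rfl)
    (hlen : (l.take n).length = n := by rfl)
    (h₁ : endOrientation w o = some o₁ := by rfl) (h₂ : endOrientation w₁ o = some o₂ := by rfl)
    (hW : W.take k ++ (shift n w ++ W.drop (k + w.length)) = W := by rfl)
    (hW₁ : W.take k ++ (shift n w₁ ++ W.drop (k + w.length)) = W₁ := by rfl) :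
    ev O W = ev O W₁ := by
  have := ctx (W.take k) (W.drop (k + w.length)) h (hl.trans (congrArg some hn.symm)) h₁ h₂
  rw [hlen, hW, hW₁] at this
  exact this

theorem ev_step1 (k n : ℕ) (h : ev o w = c • ev o w₁)
    (hl : endOrientation (W.take k) O = some l := by rfl)
    (hn : l.take n ++ o ++ l.drop (n + o.length) = l := by rfl)
    (hlen : (l.take n).length = n := by rfl)
    (h₁ : endOrientation w o = some o₁ := by rfl) (h₂ : endOrientation w₁ o = some o₂ := by rfl)
    (hW : W.take k ++ (shift n w ++ W.drop (k + w.length)) = W := by rfl)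
    (hW₁ : W.take k ++ (shift n w₁ ++ W.drop (k + w.length)) = W₁ := by rfl) :
    ev O W = c • ev O W₁ := by
  have := ctx1 (W.take k) (W.drop (k + w.length)) h (hl.trans (congrArg some hn.symm)) h₁ h₂
  rw [hlen, hW, hW₁] at this
  exact this

theorem ev_step2 (k n : ℕ) (h : ev o w = c₁ • ev o w₁ + c₂ • ev o w₂)
    (hl : endOrientation (W.take k) O = some l := by rfl)
    (hn : l.take n ++ o ++ l.drop (n + o.length) = l := by rfl)
    (hlen : (l.take n).length = n := by rfl)
    (h₁ : endOrientation w o = some o₁ := by rfl) (h₂ : endOrientation w₁ o = some o₂ := by rfl)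
    (h₃ : endOrientation w₂ o = some o₃ := by rfl)
    (hW : W.take k ++ (shift n w ++ W.drop (k + w.length)) = W := by rfl)
    (hW₁ : W.take k ++ (shift n w₁ ++ W.drop (k + w.length)) = W₁ := by rfl)
    (hW₂ : W.take k ++ (shift n w₂ ++ W.drop (k + w.length)) = W₂ := by rfl) :
    ev O W = c₁ • ev O W₁ + c₂ • ev O W₂ := by
  have := ctx2 (W.take k) (W.drop (k + w.length)) h (hl.trans (congrArg some hn.symm)) h₁ h₂ h₃
  rw [hlen, hW, hW₁, hW₂] at this
  exact this

/-- Interchange of the layers number `k` and `k + 1`, if they do not interact. -/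
def swapAt (k : ℕ) (W : List Layer) : List Layer :=
  match W.drop k with
  | L :: L' :: r =>
    if L.pos + L.target ≤ L'.pos then
      W.take k ++ ([L'.moveTo (L'.pos - L.target + L.source), L] ++ r)
    else if L'.pos + L'.source ≤ L.pos then
      W.take k ++ ([L', L.moveTo (L.pos - L'.source + L'.target)] ++ r)
    else W
  | _ => W

/-- If the two layers interact, `swapAt` returns the word unchanged, so no hypothesis of
disjointness is needed. -/
theorem ev_swapAt (k : ℕ) (hW : endOrientation W O = some o := by rfl)
    (hW₁ : swapAt k W = W₁ := by rfl) : ev O W = ev O W₁ := by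
  subst hW₁
  unfold swapAt
  split
  · rename_i L L' r hd
    have hW' : W = W.take k ++ ([L, L'] ++ r) := by
      conv_lhs => rw [← List.take_append_drop k W, hd]
      rfl
    rw [hW'] at hW
    obtain ⟨l, h₁, h₂⟩ := endOrientation_append_some.mp hW
    obtain ⟨l', h₃, h₄⟩ := endOrientation_append_some.mp h₂
    obtain ⟨l'', h₅, h₆⟩ := endOrientation_pair.mp h₃
    split_ifs with c1 c2
    · obtain ⟨e1, e2⟩ := ev_swap_right h₅ h₆ c1
      have := ctx_zero (c := 1) (W.take k) r (e1.trans (one_smul _ _).symm) h₁ h₃ e2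
      rw [one_smul, ← hW'] at this
      exact this
    · obtain ⟨e1, e2⟩ := ev_swap_left h₅ h₆ c2
      have := ctx_zero (c := 1) (W.take k) r (e1.trans (one_smul _ _).symm) h₁ h₃ e2
      rw [one_smul, ← hW'] at this
      exact this
    · rfl
  · rfl

end Steps

/-! ## Derived local relations -/

/-- A cup followed by a crossing and its inverse is evaluated twice, removing either the curl or the
cancelling pair. -/
theorem ev_curl_cup_inv (o : Bool) :
    ev [] [.cup 0 o, .cross 0 true] = cAinv • ev [] [.cup 0 (!o)] := by
  have h : ev [] [.cup 0 (!o), .cross 0 false, .cross 0 true] =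
      cA • ev [] [.cup 0 o, .cross 0 true] := by
    cases o
    · exact ev_step1 0 0 (ev_curl_cup true)
    · exact ev_step1 0 0 (ev_curl_cup false)
  have h' : ev [] [.cup 0 (!o), .cross 0 false, .cross 0 true] = ev [] [.cup 0 (!o)] := by
    cases o
    · exact ev_step 1 0 (ev_cross_cross true false false)
    · exact ev_step 1 0 (ev_cross_cross false true false)
  rw [← h', h, smul_smul, mul_comm, cA_mul_cAinv, one_smul]

theorem ev_curl_cap_inv (o : Bool) :
    ev [o, !o] [.cross 0 true, .cap 0] = cAinv • ev [o, !o] [.cap 0] := by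
  have h : ev [o, !o] [.cross 0 true, .cross 0 false, .cap 0] =
      cA • ev [o, !o] [.cross 0 true, .cap 0] := by
    cases o
    · exact ev_step1 1 0 (ev_curl_cap true)
    · exact ev_step1 1 0 (ev_curl_cap false)
  have h' : ev [o, !o] [.cross 0 true, .cross 0 false, .cap 0] = ev [o, !o] [.cap 0] := by
    cases o
    · exact ev_step 0 0 (ev_cross_cross false true true)
    · exact ev_step 0 0 (ev_cross_cross true false true)
  rw [← h', h, smul_smul, mul_comm, cA_mul_cAinv, one_smul]

theorem ev_slide_cup' (b o s : Bool) :
    ev [o] [.cup 1 b, .cross 0 s] = ev [o] [.cup 0 b, .cross 1 (!s)] := by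
  rw [ev_slide_cup, Bool.not_not]

theorem ev_slide_cap' (b o s : Bool) :
    ev [b, o, !b] [.cross 0 s, .cap 1] = ev [b, o, !b] [.cross 1 (!s), .cap 0] := by
  rw [ev_slide_cap, Bool.not_not]

/-- A crossing slides around two nested cups. -/
theorem ev_slide_nested_cups (b o s : Bool) :
    ev [] [.cup 0 b, .cup 1 o, .cross 2 s] = ev [] [.cup 0 o, .cup 1 b, .cross 0 s] := by
  cases b <;> cases o <;> cases s <;> exact
    ((ev_step 1 1 (ev_slide_cup _ _ _)).trans (ev_swapAt 0)).trans (ev_step 1 0 (ev_slide_cup _ _ _))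

/-- A crossing slides around two nested caps. -/
theorem ev_slide_nested_caps (b o s : Bool) :
    ev [b, o, !b, !o] [.cross 2 s, .cap 1, .cap 0] =
      ev [b, o, !b, !o] [.cross 0 s, .cap 1, .cap 0] := by
  cases b <;> cases o <;> cases s
  · exact ((ev_step 0 1 (ev_slide_cap false true false)).trans (ev_swapAt 1)).trans
      (ev_step 0 0 (ev_slide_cap false false true))
  · exact ((ev_step 0 1 (ev_slide_cap false true true)).trans (ev_swapAt 1)).trans
      (ev_step 0 0 (ev_slide_cap false false false))
  · exact ((ev_step 0 1 (ev_slide_cap true true false)).trans (ev_swapAt 1)).trans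
      (ev_step 0 0 (ev_slide_cap false true true))
  · exact ((ev_step 0 1 (ev_slide_cap true true true)).trans (ev_swapAt 1)).trans
      (ev_step 0 0 (ev_slide_cap false true false))
  · exact ((ev_step 0 1 (ev_slide_cap false false false)).trans (ev_swapAt 1)).trans
      (ev_step 0 0 (ev_slide_cap true false true))
  · exact ((ev_step 0 1 (ev_slide_cap false false true)).trans (ev_swapAt 1)).trans
      (ev_step 0 0 (ev_slide_cap true false false))
  · exact ((ev_step 0 1 (ev_slide_cap true false false)).trans (ev_swapAt 1)).trans
      (ev_step 0 0 (ev_slide_cap true true true))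
  · exact ((ev_step 0 1 (ev_slide_cap true false true)).trans (ev_swapAt 1)).trans
      (ev_step 0 0 (ev_slide_cap true true false))

/-- The strands of `n` half twists. -/
def flip (n : ℕ) (a b : Bool) : Bool := if Even n then a else b

theorem flip_succ (n : ℕ) (a b : Bool) : flip (n + 1) a b = flip n b a := by
  by_cases h : Even n <;> simp [flip, h, Nat.even_add_one]

theorem flip_flip (n : ℕ) (a b : Bool) : flip n (flip n a b) (flip n b a) = a := by
  by_cases h : Even n <;> simp [flip, h]

theorem endOrientation_replicate (n : ℕ) (s a b : Bool) :
    endOrientation (List.replicate n (.cross 0 s)) [a, b] = some [flip n a b, flip n b a] := by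
  induction n generalizing a b with
  | zero => rfl
  | succ n ih =>
    rw [List.replicate_succ, flip_succ, flip_succ, ← ih]
    rfl

theorem shift_replicate (i j n : ℕ) (s : Bool) :
    shift i (List.replicate n (.cross j s)) = List.replicate n (.cross (i + j) s) := by
  simp [shift, Layer.shift]

theorem shift_cons (i : ℕ) (L : Layer) (w : List Layer) :
    shift i (L :: w) = L.shift i :: shift i w := rfl

theorem endOrientation_replicate_nested (n : ℕ) (s a b : Bool) (post : List Bool) :
    endOrientation (List.replicate n (.cross 0 s)) (a :: b :: post) =
      some (flip n a b :: flip n b a :: post) := by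
  have := endOrientation_shift (endOrientation_replicate n s a b) [] post
  simpa [shift_zero] using this

/-- Opposite twists on the two sides of two nested cups cancel. -/
theorem ev_nested_cups_twists (n : ℕ) (b o s : Bool) :
    ev [] ([.cup 0 b, .cup 1 o] ++ (List.replicate n (.cross 0 s) ++
      List.replicate n (.cross 2 (!s)))) = ev [] [.cup 0 (flip n b o), .cup 1 (flip n o b)] := by
  induction n generalizing b o with
  | zero => rfl
  | succ n ih =>
    rw [flip_succ, flip_succ, ← ih]
    -- One crossing slides around the cups from the left to the right (`h1`), is lifted past the
    -- remaining left crossings (`h2`) and cancels the first crossing on the right (`h3`).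
    have h1 := ctx (pre := []) (post := []) (O := []) [] (List.replicate n (.cross 0 s) ++
      List.replicate (n + 1) (.cross 2 (!s))) (ev_slide_nested_cups o b s).symm rfl rfl rfl
    have h2 := ctx_interchange (pre := []) (post := []) (O := [])
      [.cup 0 o, .cup 1 b] (List.replicate (n + 1) (.cross 2 (!s)))
      (w := List.replicate n (.cross 0 s)) (w' := [.cross 0 s]) (o₁ := [o, b]) (o₂ := [!b, !o])
      rfl (endOrientation_replicate n s o b) rfl
    have h3 := ctx (pre := [flip n o b, flip n b o]) (post := []) (O := [])
      ([.cup 0 o, .cup 1 b] ++ List.replicate n (.cross 0 s)) (List.replicate n (.cross 2 (!s)))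
      (ev_cross_cross (!b) (!o) s)
      ((endOrientation_append_of (o' := [o, b, !b, !o]) rfl).trans
        (endOrientation_replicate_nested n s o b _)) rfl rfl
    simp only [shift_replicate, shift_zero, shift_cons, Layer.shift, List.length_nil,
      List.length_cons, zero_add, Nat.reduceAdd, List.replicate_succ, List.cons_append,
      List.nil_append, add_zero] at h1 h2 h3 ⊢
    exact h1.trans (h2.symm.trans h3)

/-- Opposite twists on the two sides of two nested caps cancel. -/
theorem ev_nested_caps_twists (n : ℕ) (b o s : Bool) :
    ev [flip n b o, flip n o b, flip n (!o) (!b), flip n (!b) (!o)]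
      (List.replicate n (.cross 0 s) ++ (List.replicate n (.cross 2 (!s)) ++ [.cap 1, .cap 0])) =
    ev [flip n b o, flip n o b, flip n (!o) (!b), flip n (!b) (!o)] [.cap 1, .cap 0] := by
  induction n generalizing b o with
  | zero => rfl
  | succ n ih =>
    set O : List Bool := [flip (n + 1) b o, flip (n + 1) o b, flip (n + 1) (!o) (!b),
      flip (n + 1) (!b) (!o)] with hO
    have hO' : O = [flip n o b, flip n b o, flip n (!b) (!o), flip n (!o) (!b)] := by
      simp only [hO, flip_succ]
    have t1 : endOrientation (List.replicate n (.cross 0 s)) O =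
        some [o, b, flip n (!b) (!o), flip n (!o) (!b)] := by
      rw [hO', endOrientation_replicate_nested, flip_flip, flip_flip]
    have t2 (c : List Bool) (hc : c.length = 2) :
        endOrientation (List.replicate n (.cross 2 (!s)))
          (c ++ [flip n (!b) (!o), flip n (!o) (!b)]) = some (c ++ [!b, !o]) := by
      have := endOrientation_shift (endOrientation_replicate n (!s) (flip n (!b) (!o))
        (flip n (!o) (!b))) c []
      simpa [hc, shift_replicate, flip_flip] using this
    have e1 : ∀ r, List.replicate (n + 1) (Layer.cross 2 (!s)) ++ r =
        List.replicate n (.cross 2 (!s)) ++ ([.cross 2 (!s)] ++ r) := fun r => by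
      rw [List.replicate_succ', List.append_assoc]
    have e0 : ∀ r, List.replicate (n + 1) (Layer.cross 0 s) ++ r =
        List.replicate n (.cross 0 s) ++ ([.cross 0 s] ++ r) := fun r => by
      rw [List.replicate_succ', List.append_assoc]
    have h1 := ctx (pre := []) (post := []) (O := O)
      (List.replicate n (.cross 0 s) ++ ([.cross 0 s] ++ List.replicate n (.cross 2 (!s)))) []
      (ev_slide_nested_caps b o (!s))
      ((endOrientation_append_of t1).trans ((endOrientation_append_of rfl).trans (t2 [b, o] rfl)))
      (by cases b <;> cases o <;> rfl) (by cases b <;> cases o <;> rfl)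
    have h2 := ctx_interchange (pre := []) (post := []) (O := O)
      (List.replicate n (.cross 0 s)) [.cross 0 (!s), .cap 1, .cap 0]
      (w := [.cross 0 s]) (w' := List.replicate n (.cross 0 (!s))) (o₁ := [o, b])
      (o₂ := [flip n (!b) (!o), flip n (!o) (!b)])
      t1 rfl (endOrientation_replicate n (!s) _ _)
    have h3 := ctx (pre := []) (post := [!b, !o]) (O := O)
      (List.replicate n (.cross 0 s) ++ List.replicate n (.cross 2 (!s))) [.cap 1, .cap 0]
      (ev_cross_cross o b s) ((endOrientation_append_of t1).trans (t2 [o, b] rfl)) rfl rfl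
    have ih' := ih o b
    rw [← hO'] at ih'
    simp only [shift_replicate, shift_zero, shift_cons, Layer.shift, List.length_nil,
      List.length_cons, zero_add, Nat.reduceAdd, List.cons_append,
      List.nil_append, List.append_assoc, add_zero, List.append_nil] at h1 h2 h3 ih' e0 e1 ⊢
    rw [e1, e0]
    exact h1.trans (h2.trans (h3.trans ih'))

/-! ## The tangles in the boxes -/

/-- The Laurent polynomial `φ`. -/
noncomputable def cphi : Coeff := cA * cz

/-- The Laurent polynomial `φ̄`. -/
noncomputable def cphiBar : Coeff := -(cAinv * cz)

/-! ### Bookkeeping of scalars -/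

section Combine

variable {M : Type*} [AddCommGroup M] [Module Coeff M] {X Y Y₁ Y₂ Z₁ Z₂ : M}
  {c c' c₁ c₂ d₁ d₂ e₁ e₂ : Coeff}

theorem eq_one_smul (h : X = Y) : X = (1 : Coeff) • Y := h.trans (one_smul _ _).symm

theorem eq_smul_trans (h : X = c • Y) (h₁ : Y = d₁ • Z₁) (e : c * d₁ = e₁) : X = e₁ • Z₁ := by
  rw [h, h₁, smul_smul, e]

theorem eq_add_trans (h : X = c₁ • Y₁ + c₂ • Y₂) (h₁ : Y₁ = d₁ • Z₁) (h₂ : Y₂ = d₂ • Z₂)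
    (e : c₁ * d₁ = e₁) (e' : c₂ * d₂ = e₂) : X = e₁ • Z₁ + e₂ • Z₂ := by
  rw [h, h₁, h₂, smul_smul, smul_smul, e, e']

end Combine

section Combine

variable {R M : Type*} [CommRing R] [AddCommGroup M] [Module R M] {a b c d e f g : R}

theorem smul_add_smul_collect (x y : M) (h₁ : a * c = f) (h₂ : a * d + b = g) :
    a • (c • x + d • y) + b • y = f • x + g • y := by
  subst h₁ h₂; module

theorem smul_add_smul_collect' (x y : M) (h₁ : a * d = f) (h₂ : a * c + b * e = g) :
    a • (c • y + d • x) + b • (e • y) = f • x + g • y := by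
  subst h₁ h₂; module

end Combine

/-- The skein relation at the lower crossing leaves either a cancelling pair or a turnback followed
by a positive curl; the latter has the coefficient `z A = φ`. -/
theorem ev_twist_twist (o : Bool) :
    ev [o, !o] [.cross 0 false, .cross 0 false] =
      (1 : Coeff) • ev [o, !o] [] + cphi • ev [o, !o] [.cap 0, .cup 0 o] := by
  have e : cz * cA = cphi := mul_comm _ _
  cases o
  · exact eq_add_trans (ev_step2 0 0 (ev_skein_antiparallel false))
      (eq_one_smul (ev_step 0 0 (ev_cross_cross false true true)))
      (ev_step1 1 0 (ev_curl_cup true)) (mul_one 1) e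
  · exact eq_add_trans (ev_step2 0 0 (ev_skein_antiparallel true))
      (eq_one_smul (ev_step 0 0 (ev_cross_cross true false true)))
      (ev_step1 1 0 (ev_curl_cup false)) (mul_one 1) e

theorem ev_skein_antiparallel' (o : Bool) :
    ev [o, !o] [.cross 0 true] =
      (1 : Coeff) • ev [o, !o] [.cross 0 false] + (-cz) • ev [o, !o] [.cap 0, .cup 0 (!o)] := by
  rw [ev_skein_antiparallel, one_smul, one_smul, neg_smul, add_neg_cancel_right]

theorem ev_untwist_untwist (o : Bool) :
    ev [o, !o] [.cross 0 true, .cross 0 true] =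
      (1 : Coeff) • ev [o, !o] [] + cphiBar • ev [o, !o] [.cap 0, .cup 0 o] := by
  have e : -cz * cAinv = cphiBar := by rw [cphiBar, neg_mul, mul_comm]
  cases o
  · exact eq_add_trans (ev_step2 0 0 (ev_skein_antiparallel' false))
      (eq_one_smul (ev_step 0 0 (ev_cross_cross false true false)))
      (ev_step1 1 0 (ev_curl_cup_inv true)) (mul_one 1) e
  · exact eq_add_trans (ev_step2 0 0 (ev_skein_antiparallel' true))
      (eq_one_smul (ev_step 0 0 (ev_cross_cross true false false)))
      (ev_step1 1 0 (ev_curl_cup_inv false)) (mul_one 1) e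

/-- Sliding the crossings around the cup and the cap turns the clasp into two inverse half twists on
a rotated pair of strands. The rotation exchanges the turnback and the identity in
`ev_untwist_untwist`. -/
theorem ev_opposite_verticalLock (o : Bool) :
    ev [o, !o] (verticalLock 0 false o) =
      (1 : Coeff) • ev [o, !o] [.cap 0, .cup 0 o] + cphiBar • ev [o, !o] [] := by
  cases o
  · have h : ev [false, true] (verticalLock 0 false false) =
        ev [false, true] [.cup 0 false, .cross 1 true, .cross 1 true, .cap 2] :=
      (ev_step 0 0 (ev_slide_cup' false false false)).trans
        (ev_step 2 1 (ev_slide_cap false true false))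
    have h' := h.trans (ev_step2 1 1 (ev_untwist_untwist true))
    exact eq_add_trans h'
      (eq_one_smul (ev_eq_of_simplify rfl rfl rfl)) (eq_one_smul (ev_eq_of_simplify rfl rfl rfl))
      (mul_one _) (mul_one _)
  · have h : ev [true, false] (verticalLock 0 false true) =
        ev [true, false] [.cup 0 true, .cross 1 true, .cross 1 true, .cap 2] :=
      (ev_step 0 0 (ev_slide_cup' true true false)).trans
        (ev_step 2 1 (ev_slide_cap true false false))
    have h' := h.trans (ev_step2 1 1 (ev_untwist_untwist false))
    exact eq_add_trans h'
      (eq_one_smul (ev_eq_of_simplify rfl rfl rfl)) (eq_one_smul (ev_eq_of_simplify rfl rfl rfl))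
      (mul_one _) (mul_one _)

theorem ev_verticalLock : ev [true, false] (verticalLock 0 true true) =
    (1 : Coeff) • ev [true, false] [.cap 0, .cup 0 true] + cphi • ev [true, false] [] := by
  have h : ev [true, false] (verticalLock 0 true true) =
      ev [true, false] [.cup 0 true, .cross 1 false, .cross 1 false, .cap 2] :=
    (ev_step 0 0 (ev_slide_cup' true true true)).trans
      (ev_step 2 1 (ev_slide_cap true false true))
  have h' := h.trans (ev_step2 1 1 (ev_twist_twist false))
  exact eq_add_trans h'
    (eq_one_smul (ev_eq_of_simplify rfl rfl rfl)) (eq_one_smul (ev_eq_of_simplify rfl rfl rfl))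
    (mul_one _) (mul_one _)

theorem shift_boxLayers (i : ℕ) (o : Bool) (u : List Piece) :
    boxLayers i o u = shift i (boxLayers 0 o u) := by
  induction u generalizing o with
  | nil => rfl
  | cons a u ih =>
    cases a
    · exact congrArg _ (ih _)
    · exact congrArg _ (ih _)
    · rw [boxLayers, boxLayers, shift_append, ← ih]
      rfl

/-- The orientation of the top left end of a box. -/
def boxEnd (o : Bool) (u : List Piece) : Bool := if Even (twistNumber u) then o else !o

theorem boxEnd_twist (o : Bool) (u : List Piece) : boxEnd o (.twist :: u) = boxEnd (!o) u := by
  by_cases h : Even (twistNumber u) <;> simp [boxEnd, twistNumber, h, parity_simps]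

theorem boxEnd_untwist (o : Bool) (u : List Piece) : boxEnd o (.untwist :: u) = boxEnd (!o) u := by
  by_cases h : Even (twistNumber u) <;> simp [boxEnd, twistNumber, h, parity_simps]

theorem endOrientation_boxLayers (o : Bool) (u : List Piece) :
    endOrientation (boxLayers 0 o u) [o, !o] = some [boxEnd o u, !boxEnd o u] := by
  induction u generalizing o with
  | nil => rfl
  | cons a u ih =>
    cases a
    · rw [boxEnd_twist, ← ih, Bool.not_not]
      rfl
    · rw [boxEnd_untwist, ← ih, Bool.not_not]
      rfl
    · rw [boxLayers, endOrientation_append_of (o' := [o, !o]) (by cases o <;> rfl), ih]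
      rfl

/-- The tangle without locks and with at most one half twist whose number of half twists has the
parity of a given box. -/
def boxParity (u : List Piece) : List Layer :=
  if Even (twistNumber u) then [] else [.cross 0 false]

theorem endOrientation_boxParity (o : Bool) (u : List Piece) :
    endOrientation (boxParity u) [o, !o] = some [boxEnd o u, !boxEnd o u] := by
  by_cases h : Even (twistNumber u) <;> cases o <;> simp [boxParity, boxEnd, h] <;> rfl

/-- The coefficient of the turnback in the expansion of a box. -/
noncomputable def boxCoeff : List Piece → Coeff
  | [] => 0
  | .twist :: u => cA * boxCoeff u +
      if Even (twistNumber u) then 0 else cphiBar ^ lockNumber u * cphi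
  | .untwist :: u => cAinv * boxCoeff u +
      if Even (twistNumber u) then -(cz * cphiBar ^ lockNumber u) else 0
  | .lock :: u => (cphiBar + cD) * boxCoeff u +
      cphiBar ^ lockNumber u * if Even (twistNumber u) then 1 else cA

theorem endOrientation_turnback (o e : Bool) :
    endOrientation [.cap 0, .cup 0 e] [o, !o] = some [e, !e] := by
  cases o <;> rfl

/-- The turnback is an eigenvector of the pieces of a box: a half twist acts on it by `A`, its
inverse by `A⁻¹`, another turnback by `D`. -/
theorem ev_twist_turnback (o e : Bool) :
    ev [o, !o] [.cross 0 false, .cap 0, .cup 0 e] = cA • ev [o, !o] [.cap 0, .cup 0 e] := by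
  have h := ctx1 (pre := []) (post := []) (O := [o, !o]) [] [.cup 0 e] (ev_curl_cap o) rfl
    (o₁ := []) (o₂ := []) (by cases o <;> rfl) (by cases o <;> rfl)
  exact h

theorem ev_untwist_turnback (o e : Bool) :
    ev [o, !o] [.cross 0 true, .cap 0, .cup 0 e] = cAinv • ev [o, !o] [.cap 0, .cup 0 e] := by
  have h := ctx1 (pre := []) (post := []) (O := [o, !o]) [] [.cup 0 e] (ev_curl_cap_inv o) rfl
    (o₁ := []) (o₂ := []) (by cases o <;> rfl) (by cases o <;> rfl)
  exact h

theorem ev_turnback_turnback (o o' e : Bool) :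
    ev [o, !o] [.cap 0, .cup 0 o', .cap 0, .cup 0 e] = cD • ev [o, !o] [.cap 0, .cup 0 e] := by
  have h := ctx1 (pre := []) (post := []) (O := [o, !o]) [.cap 0] [.cup 0 e] (ev_circle o')
    (o₁ := []) (o₂ := []) (by cases o <;> rfl) (by cases o' <;> rfl) rfl
  exact h

theorem ev_turnback_twist (o e : Bool) :
    ev [o, !o] [.cap 0, .cup 0 e, .cross 0 false] = cA • ev [o, !o] [.cap 0, .cup 0 (!e)] := by
  have h := ctx1 (pre := []) (post := []) (O := [o, !o]) [.cap 0] [] (ev_curl_cup e)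
    (o₁ := [!e, e]) (o₂ := [!e, !!e]) (by cases o <;> rfl) rfl rfl
  exact h

/-- The expansion of the tangle in a box. -/
theorem ev_boxLayers (o : Bool) (u : List Piece) :
    ev [o, !o] (boxLayers 0 o u) = cphiBar ^ lockNumber u • ev [o, !o] (boxParity u) +
      boxCoeff u • ev [o, !o] [.cap 0, .cup 0 (boxEnd o u)] := by
  induction u generalizing o with
  | nil => simp [boxLayers, boxParity, boxCoeff, lockNumber, twistNumber]
  | cons a u ih =>
    have step (s : Bool) := ctx2 (pre := []) (post := []) (O := [o, !o]) [.cross 0 s] [] (ih (!o))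
      (congrArg (fun b => some [!o, b]) (Bool.not_not o).symm) (endOrientation_boxLayers _ _)
      (endOrientation_boxParity _ _) (endOrientation_turnback _ _)
    simp only [List.length_nil, shift_zero, List.append_nil, List.singleton_append] at step
    cases a
    · have hl : lockNumber (.twist :: u) = lockNumber u := rfl
      rw [boxLayers, step, boxEnd_twist, boxCoeff, hl, ev_twist_turnback, smul_smul,
        mul_comm (boxCoeff u)]
      by_cases h : Even (twistNumber u)
      -- On an even box the new half twist is itself the parity tangle. On an odd box it completes a
      -- lock, and `φ` times a turnback appears.
      · have h' : ¬ Even (twistNumber (.twist :: u)) := by simpa [twistNumber, parity_simps] using h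
        rw [boxParity, boxParity, if_pos h, if_pos h, if_neg h', add_zero]
      · have h' : Even (twistNumber (.twist :: u)) := by
          simpa [twistNumber, parity_simps] using h
        rw [boxParity, boxParity, if_neg h, if_neg h, if_pos h', boxEnd, if_neg h, Bool.not_not,
          ev_twist_twist]
        exact smul_add_smul_collect _ _ (mul_one _) (add_comm _ _)
    · have hl : lockNumber (.untwist :: u) = lockNumber u := rfl
      rw [boxLayers, step, boxEnd_untwist, boxCoeff, hl, ev_untwist_turnback, smul_smul,
        mul_comm (boxCoeff u)]
      by_cases h : Even (twistNumber u)
      -- The parity tangle is by convention a positive half twist, so an inverse half twist on an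
      -- even box is exchanged for it by the skein relation. On an odd box it simply cancels.
      · have h' : ¬ Even (twistNumber (.untwist :: u)) := by
          simpa [twistNumber, parity_simps] using h
        rw [boxParity, boxParity, if_pos h, if_pos h, if_neg h', boxEnd, if_pos h,
          ev_skein_antiparallel']
        exact smul_add_smul_collect _ _ (mul_one _) (by ring)
      · have h' : Even (twistNumber (.untwist :: u)) := by
          simpa [twistNumber, parity_simps] using h
        have h'' : ev [o, !o] [.cross 0 true, .cross 0 false] = ev [o, !o] [] :=
          ev_cross_cross o (!o) true
        rw [boxParity, boxParity, if_neg h, if_neg h, if_pos h', add_zero, h'']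
    · have step' := ctx2 (pre := []) (post := []) (O := [o, !o]) (verticalLock 0 false o) [] (ih o)
        (by cases o <;> rfl) (endOrientation_boxLayers _ _) (endOrientation_boxParity _ _)
        (endOrientation_turnback _ _)
      have e₁ := ctx2 (pre := []) (post := []) (O := [o, !o]) [] (boxParity u)
        (ev_opposite_verticalLock o) rfl (o₁ := [o, !o]) (o₂ := [o, !o]) (by cases o <;> rfl)
        (endOrientation_turnback _ _) rfl
      have e₂ := ctx2 (pre := []) (post := []) (O := [o, !o]) [] [.cap 0, .cup 0 (boxEnd o u)]
        (ev_opposite_verticalLock o) rfl (o₁ := [o, !o]) (o₂ := [o, !o]) (by cases o <;> rfl)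
        (endOrientation_turnback _ _) rfl
      simp only [List.length_nil, shift_zero, List.append_nil, List.nil_append, List.cons_append]
        at step' e₁ e₂
      have hp : boxParity (.lock :: u) = boxParity u := rfl
      have he : boxEnd o (.lock :: u) = boxEnd o u := rfl
      rw [boxLayers, step', e₁, e₂, ev_turnback_turnback, hp, he, boxCoeff, lockNumber, smul_smul,
        ← add_smul]
      -- The turnback of the lock meets the parity tangle: it is unchanged if that is empty and
      -- gains `A` if it is a half twist.
      by_cases h : Even (twistNumber u)
      · rw [boxParity, if_pos h, boxEnd, if_pos h, if_pos h]
        exact smul_add_smul_collect' _ _ (by ring) (by ring)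
      · rw [boxParity, if_neg h, boxEnd, if_neg h, if_neg h, ev_turnback_twist, smul_smul]
        exact smul_add_smul_collect' _ _ (by ring) (by ring)

theorem laurentToField_cphi : laurentToField cphi = phi := by
  rw [cphi, map_mul, laurentToField_cA, laurentToField_cz]; rfl

theorem laurentToField_cphiBar : laurentToField cphiBar = phiBar := by
  rw [cphiBar, map_neg, map_mul, laurentToField_cAinv, laurentToField_cz]; rfl

theorem q_sub_inv_ne_zero : q - q⁻¹ ≠ 0 := by
  rw [q, ← map_inv₀, ← map_sub]
  exact fun h => q₀_sub_inv_ne_zero (RatFunc.C.injective (h.trans (map_zero _).symm))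

theorem sub_inv_mul_dimD : (q - q⁻¹) * dimD = A - A⁻¹ := mul_div_cancel₀ _ q_sub_inv_ne_zero

/-- Equivalently, a lock acts on a turnback by `1 + φ D = A ^ 2`, the square of the curl factor. -/
theorem phi_mul_dimD : phi * dimD = A ^ 2 - 1 := by
  rw [phi, mul_assoc, sub_inv_mul_dimD, mul_sub, mul_inv_cancel₀ A_ne_zero, sq]

theorem phiBar_mul_dimD : phiBar * dimD = A⁻¹ ^ 2 - 1 := by
  rw [phiBar, neg_mul, mul_assoc, sub_inv_mul_dimD, mul_sub, inv_mul_cancel₀ A_ne_zero, neg_sub, sq]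

/-- The coefficient of the turnback, from the eigenvalue of a capped box. -/
theorem laurentToField_boxCoeff (u : List Piece) :
    laurentToField (boxCoeff u) * dimD =
      A ^ twistNumber u * (dimD + phiBar) ^ lockNumber u -
        (if Even (twistNumber u) then 1 else A) * phiBar ^ lockNumber u := by
  induction u with
  | nil => simp [boxCoeff, twistNumber, lockNumber]
  | cons a u ih =>
    have hA := A_ne_zero
    have h1 := phi_mul_dimD
    have h2 := phiBar_mul_dimD
    have h3 := sub_inv_mul_dimD
    have h4 : A * A⁻¹ = 1 := mul_inv_cancel₀ hA
    cases a <;> by_cases h : Even (twistNumber u) <;>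
      simp only [boxCoeff, twistNumber, lockNumber, h, if_true, if_false, map_add, map_mul, map_pow,
        map_neg, map_zero, map_one, laurentToField_cA, laurentToField_cAinv, laurentToField_cz,
        laurentToField_cphi, laurentToField_cphiBar, laurentToField_cD, zpow_add₀ hA, zpow_sub₀ hA,
        zpow_one, Int.even_add_one, Int.even_sub_one, not_true, not_false_eq_true, div_eq_mul_inv]
        at ih ⊢
    · linear_combination A * ih
    · linear_combination A * ih + phiBar ^ lockNumber u * h1
    · linear_combination A⁻¹ * ih - phiBar ^ lockNumber u * h3
    · linear_combination A⁻¹ * ih - phiBar ^ lockNumber u * h4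
    · linear_combination (phiBar + dimD) * ih
    · linear_combination (phiBar + dimD) * ih

theorem shift_nil (i : ℕ) : shift i [] = [] := rfl

/-! ## The two halves of the diagrams -/

/-- The lower half of the diagrams, on the middle strands: a cup, the two lower chains and the
`p`-box. -/
def lowerHalf (e : Bool) (X X' U : List Layer) : List Layer :=
  [.cup 1 e] ++ (X ++ (shift 2 X' ++ shift 1 U))

/-- The upper half of the diagrams: the `q`-box, the two upper chains and a cap. -/
def upperHalf (V Y Y' : List Layer) : List Layer :=
  shift 1 V ++ (Y ++ (shift 2 Y' ++ [.cap 1]))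

/-- The diagram with given lower and upper halves. -/
def joinHalves (L R : List Layer) : List Layer :=
  [.cup 0 true, .cup 1 false, .cup 2 true] ++ (shift 3 L ++ (R ++ [.cap 1, .cap 0, .cap 0]))

theorem endOrientation_lowerHalf {e : Bool} {X X' U : List Layer}
    (hX : endOrientation X [false, e] = some [false, e])
    (hX' : endOrientation X' [!e, true] = some [!e, true])
    (hU : endOrientation U [e, !e] = some [true, false]) :
    endOrientation (lowerHalf e X X' U) [false, true] = some [false, true, false, true] := by
  have h1 := endOrientation_shift hX [] [!e, true]
  have h2 := endOrientation_shift hX' [false, e] []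
  have h3 := endOrientation_shift hU [false] [true]
  simp only [List.length_nil, List.length_cons, shift_zero, List.nil_append, List.append_nil,
    List.cons_append, zero_add, Nat.reduceAdd] at h1 h2 h3
  rw [lowerHalf, endOrientation_append_of (o' := [false, e, !e, true]) rfl,
    endOrientation_append_of h1, endOrientation_append_of h2, h3]

theorem endOrientation_upperHalf {f : Bool} {V Y Y' : List Layer}
    (hV : endOrientation V [false, true] = some [f, !f])
    (hY : endOrientation Y [true, f] = some [true, f])
    (hY' : endOrientation Y' [!f, false] = some [!f, false]) :
    endOrientation (upperHalf V Y Y') [true, false, true, false] = some [true, false] := by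
  have h1 := endOrientation_shift hV [true] [false]
  have h2 := endOrientation_shift hY [] [!f, false]
  have h3 := endOrientation_shift hY' [true, f] []
  simp only [List.length_nil, List.length_cons, shift_zero, List.nil_append, List.append_nil,
    List.cons_append, zero_add, Nat.reduceAdd] at h1 h2 h3
  rw [upperHalf, endOrientation_append_of h1, endOrientation_append_of h2,
    endOrientation_append_of h3]
  cases f <;> rfl

/-- The boxes are moved to separate the two halves. -/
theorem ev_joinHalves {e f : Bool} {X X' U V Y Y' : List Layer}
    (hX : endOrientation X [false, e] = some [false, e])
    (hX' : endOrientation X' [!e, true] = some [!e, true])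
    (hU : endOrientation U [e, !e] = some [true, false])
    (hV : endOrientation V [false, true] = some [f, !f])
    (hY : endOrientation Y [true, f] = some [true, f])
    (hY' : endOrientation Y' [!f, false] = some [!f, false]) :
    ev [] ([.cup 0 true, .cup 1 false, .cup 2 true, .cup 4 e] ++ shift 1 V ++ shift 3 X ++
      shift 5 X' ++ Y ++ shift 2 Y' ++ shift 4 U ++ topCaps) =
    ev [] (joinHalves (lowerHalf e X X' U) (upperHalf V Y Y')) := by
  have k1 := endOrientation_shift hV [true] [false, e, !e, true, false]
  have k2 := endOrientation_shift hX [true, f, !f] [!e, true, false]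
  have k3 := endOrientation_shift hX' [true, f, !f, false, e] [false]
  have k4 := endOrientation_shift hY [] [!f, false]
  have k5 := endOrientation_shift hY' [true, f] []
  have k6 := endOrientation_shift hU [true, f, !f, false] [true, false]
  have k4' := endOrientation_shift hY [] [!f, false, true, false, true, false]
  have k5' := endOrientation_shift hY' [true, f] [true, false, true, false]
  simp only [List.length_nil, List.length_cons, shift_zero, List.nil_append, List.append_nil,
    List.cons_append, zero_add, Nat.reduceAdd] at k1 k2 k3 k4 k5 k6 k4' k5'
  set c : List Layer := [.cup 0 true, .cup 1 false, .cup 2 true, .cup 4 e]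
  have hc : endOrientation c [] = some [true, false, true, false, e, !e, true, false] := rfl
  have p1 : endOrientation (c ++ (shift 1 V ++ (shift 3 X ++ shift 5 X'))) [] =
      some [true, f, !f, false, e, !e, true, false] := by
    rw [endOrientation_append_of hc, endOrientation_append_of k1, endOrientation_append_of k2, k3]
  -- The interchanges: `s1` puts the `p`-box below the upper chains; `s2` reorders two caps so that
  -- the middle one closes the upper half; `s4` and `s3` lift the `q`-box first above the cup and
  -- then above the whole lower half.
  have s1 := ctx_interchange (pre := []) (post := [true, false]) (o₁ := [true, f, !f, false])
    (o₂ := [e, !e]) _ topCaps p1 ((endOrientation_append_of k4).trans k5) hU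
  have s2 := ctx_interchange (pre := [true]) (post := [false, true, false]) (o₁ := [f, !f])
    (o₂ := [false, true]) (o₁' := []) (o₂' := []) (w := [.cap 0]) (w' := [.cap 0])
    ((c ++ (shift 1 V ++ (shift 3 X ++ shift 5 X'))) ++ (shift 4 U ++ (Y ++ shift 2 Y')))
    [.cap 0, .cap 0]
    (by rw [endOrientation_append_of p1, endOrientation_append_of k6, endOrientation_append_of k4',
          k5']; rfl) (by cases f <;> rfl) rfl
  have s3 := ctx_interchange (pre := [true]) (post := [false]) (o₁ := [false, true])
    (o₂ := [false, true]) (O := []) [.cup 0 true, .cup 1 false, .cup 2 true]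
    (Y ++ (shift 2 Y' ++ [.cap 1, .cap 1, .cap 0, .cap 0])) rfl hV
    (endOrientation_lowerHalf hX hX' hU)
  have s4 := ctx_interchange (pre := [true]) (post := [false]) (o₁ := [false, true])
    (o₂ := [false, true]) (O := []) (w' := [.cup 1 e]) (o₂' := [false, e, !e, true])
    [.cup 0 true, .cup 1 false, .cup 2 true]
    (shift 3 X ++ (shift 5 X' ++ (shift 4 U ++ (Y ++ (shift 2 Y' ++
      [.cap 1, .cap 1, .cap 0, .cap 0]))))) rfl hV rfl
  simp only [shift_nil, joinHalves, lowerHalf, upperHalf, topCaps, List.length_nil, List.length_cons,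
    shift_zero, shift_append, shift_cons, shift_shift, Layer.shift, List.append_assoc,
    List.nil_append, List.cons_append, zero_add, Nat.reduceAdd, add_zero, c] at s1 s2 s3 ⊢
  exact s1.trans (s2.symm.trans (s4.symm.trans s3))

/-! ### Linearity of the closed diagram in each half -/

section Linear

variable {L L₁ L₂ L₃ L₄ R R₁ R₂ R₃ R₄ : List Layer} {c₁ c₂ c₃ c₄ : Coeff}

theorem exists_joinHalves_left (R : List Layer) :
    ∃ Φ : Sem [false, true] →ₗ[Coeff] Sem [], ∀ L,
      endOrientation L [false, true] = some [false, true, false, true] →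
        Φ (ev _ L) = ev [] (joinHalves L R) := by
  obtain ⟨Φ, hΦ⟩ := exists_whisker [.cup 0 true, .cup 1 false, .cup 2 true]
    (R ++ [.cap 1, .cap 0, .cap 0]) [true, false, true] [false] [false, true] [] rfl
  exact ⟨Φ, fun L hL => hΦ L _ hL⟩

theorem exists_joinHalves_right (hL : endOrientation L [false, true] =
      some [false, true, false, true]) :
    ∃ Φ : Sem [true, false, true, false] →ₗ[Coeff] Sem [], ∀ R,
      endOrientation R [true, false, true, false] = some [true, false] →
        Φ (ev _ R) = ev [] (joinHalves L R) := by
  have h := endOrientation_shift hL [true, false, true] [false]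
  obtain ⟨Φ, hΦ⟩ := exists_whisker ([.cup 0 true, .cup 1 false, .cup 2 true] ++ shift 3 L)
    [.cap 1, .cap 0, .cap 0] [] [true, false, true, false] [true, false, true, false] []
    ((endOrientation_append_of (o' := [true, false, true, false, true, false]) rfl).trans h)
  refine ⟨Φ, fun R hR => (hΦ R _ hR).trans ?_⟩
  rw [List.length_nil, shift_zero, List.append_assoc, joinHalves]

end Linear

/-- An upper half that is capped off. -/
theorem ev_upperHalf_cap {f : Bool} {V Y Y' : List Layer}
    (hV : endOrientation V [false, true] = some [f, !f])
    (hY : endOrientation Y [true, f] = some [true, f])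
    (hY' : endOrientation Y' [!f, false] = some [!f, false])
    (hYY : ev [true, f, !f, false] (Y ++ (shift 2 Y' ++ [.cap 1, .cap 0])) =
      ev [true, f, !f, false] [.cap 1, .cap 0])
    {c : Coeff} (hVc : ev [false, true] (V ++ [.cap 0]) = c • ev [false, true] [.cap 0]) :
    ev [true, false, true, false] (upperHalf V Y Y' ++ [.cap 0]) =
      c • ev [true, false, true, false] [.cap 1, .cap 0] := by
  have k1 := endOrientation_shift hV [true] [false]
  have k2 := endOrientation_shift hY [] [!f, false]
  have k3 := endOrientation_shift hY' [true, f] []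
  simp only [List.length_nil, List.length_cons, shift_zero, List.nil_append, List.append_nil,
    List.cons_append, zero_add, Nat.reduceAdd] at k1 k2 k3
  have h1 := ctx (pre := []) (post := []) (O := [true, false, true, false]) (shift 1 V) [] hYY k1
    (by rw [endOrientation_append_of k2, endOrientation_append_of k3]; cases f <;> rfl) (o₁ := [])
    (o₂ := []) (by cases f <;> rfl)
  have h2 := ctx1 (pre := [true]) (post := [false]) (O := [true, false, true, false]) [] [.cap 0]
    hVc rfl (o₁ := []) (o₂ := []) (by rw [endOrientation_append_of hV]; cases f <;> rfl) rfl
  simp only [upperHalf, List.length_nil, List.length_cons, shift_nil,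
    shift_zero, shift_append, shift_cons, shift_shift, Layer.shift, List.append_assoc,
    List.nil_append, List.cons_append, zero_add, add_zero, List.append_nil]
    at h1 h2 ⊢
  exact h1.trans h2

/-- The turnback in the `p`-box splits the diagram. -/
theorem ev_joinHalves_turnback_left {e : Bool} {X X' R : List Layer}
    (hX : endOrientation X [false, e] = some [false, e])
    (hX' : endOrientation X' [!e, true] = some [!e, true])
    (hXX : ev [] ([.cup 0 false, .cup 1 e] ++ (X ++ shift 2 X')) =
      ev [] [.cup 0 false, .cup 1 e])
    (hR : endOrientation R [true, false, true, false] = some [true, false])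
    {c : Coeff} (hRc : ev [true, false, true, false] (R ++ [.cap 0]) =
      c • ev [true, false, true, false] [.cap 1, .cap 0]) :
    ev [] (joinHalves (lowerHalf e X X' [.cap 0, .cup 0 true]) R) = (c * cD ^ 2) • ev [] [] := by
  set M : List Layer := [.cup 1 e] ++ (X ++ (shift 2 X' ++ [.cap 1]))
  set c₀ : List Layer := [.cup 0 true, .cup 1 false, .cup 2 true]
  have hc₀ : endOrientation c₀ [] = some [true, false, true, false, true, false] := rfl
  have hM : endOrientation M [false, true] = some [false, true] := by
    have k2 := endOrientation_shift hX [] [!e, true]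
    have k3 := endOrientation_shift hX' [false, e] []
    simp only [List.length_nil, List.length_cons, shift_zero, List.nil_append, List.append_nil,
      List.cons_append, zero_add, Nat.reduceAdd] at k2 k3
    simp only [M]
    rw [endOrientation_append_of (o' := [false, e, !e, true]) rfl, endOrientation_append_of k2,
      endOrientation_append_of k3]
    cases e <;> rfl
  have hM' := endOrientation_shift hM [true, false, true] [false]
  have hR' := endOrientation_shift hR [] [true, false]
  have hp : endOrientation (c₀ ++ shift 3 M) [] = some [true, false, true, false, true, false] :=
    (endOrientation_append_of hc₀).trans hM'
  rw [List.length_nil, shift_zero] at hR'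
  -- The cup of the turnback rises above the upper half and straightens against a cap (`s2`). The
  -- upper half is now capped off and becomes two caps (`s3`).
  have s1 := ctx_interchange (pre := []) (post := [true, false]) (o₁ := [true, false, true, false])
    (o₂ := []) (w' := [.cup 0 true]) (o₂' := [true, false]) _ [.cap 1, .cap 0, .cap 0] hp hR rfl
  have s2 := ctx (pre := [true]) (post := [true, false])
    (c₀ ++ shift 3 M ++ R) [.cap 0, .cap 0]
    (ev_zigzag_right false) ((endOrientation_append_of hp).trans hR') rfl rfl
  have s3 := ctx1 (pre := []) (post := [true, false]) (c₀ ++ shift 3 M) [.cap 0] hRc hp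
    (by rw [endOrientation_append_of hR]; rfl) rfl
  -- One of these caps descends and straightens against a cup (`s5`), which leaves the lower chains
  -- on nested cups, where they cancel (`s6`). Two circles remain.
  have s4 := ctx_interchange (pre := [true]) (post := [false]) (o₁ := [false, true])
    (o₂ := [false, true]) (w := [.cap 0]) (o₁' := []) c₀ [.cap 0, .cap 0] hc₀ rfl hM
  have s5 := ctx (pre := [true]) (post := [true, false]) (O := []) [.cup 0 true, .cup 1 false]
    (shift 1 M ++ [.cap 0, .cap 0]) (ev_zigzag_right false) rfl rfl rfl
  have s6 := ctx (pre := [true]) (post := [false]) (O := []) [.cup 0 true] [.cap 2, .cap 0, .cap 0]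
    hXX rfl (o₁ := [false, e, !e, true]) (o₂ := [false, e, !e, true]) (by
      have k2 := endOrientation_shift hX [] [!e, true]
      have k3 := endOrientation_shift hX' [false, e] []
      simp only [List.length_nil, List.length_cons, shift_zero, List.nil_append, List.append_nil,
        List.cons_append, zero_add, Nat.reduceAdd] at k2 k3
      rw [endOrientation_append_of (o' := [false, e, !e, true]) rfl, endOrientation_append_of k2,
        k3]) rfl
  have s7 : ev [] [.cup 0 true, .cup 1 false, .cup 2 e, .cap 2, .cap 0, .cap 0] =
      cD ^ 2 • ev [] [] := by
    cases e <;> exact ev_planar rfl rfl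
  rw [mul_smul, ← s7]
  simp only [joinHalves, lowerHalf, List.length_nil, List.length_cons, shift_nil, M, c₀,
    shift_zero, shift_append, shift_cons, shift_shift, Layer.shift, List.append_assoc, Bool.not_false,
    List.nil_append, List.cons_append, zero_add, Nat.reduceAdd, add_zero]
    at s1 s2 s3 s4 s5 s6 ⊢
  rw [← s1, s2, s3, ← s4, s5, s6]

/-- The turnback in the `q`-box splits the diagram. -/
theorem ev_joinHalves_turnback_right {f : Bool} {Y Y' L : List Layer}
    (hY : endOrientation Y [true, f] = some [true, f])
    (hY' : endOrientation Y' [!f, false] = some [!f, false])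
    (hYY : ev [true, f, !f, false] (Y ++ (shift 2 Y' ++ [.cap 1, .cap 0])) =
      ev [true, f, !f, false] [.cap 1, .cap 0])
    (hL : endOrientation L [false, true] = some [false, true, false, true])
    {c : Coeff} (hLc : ev [] ([.cup 0 false] ++ L) = c • ev [] [.cup 0 false, .cup 1 true]) :
    ev [] (joinHalves L (upperHalf [.cap 0, .cup 0 f] Y Y')) = (c * cD ^ 2) • ev [] [] := by
  have k2 := endOrientation_shift hY [] [!f, false]
  have k3 := endOrientation_shift hY' [true, f] []
  simp only [List.length_nil, List.length_cons, shift_zero, List.nil_append, List.append_nil,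
    List.cons_append, zero_add, Nat.reduceAdd] at k2 k3
  set M : List Layer := [.cup 1 f] ++ (Y ++ (shift 2 Y' ++ [.cap 1]))
  set c₀ : List Layer := [.cup 0 true, .cup 1 false, .cup 2 true]
  have hc₀ : endOrientation c₀ [] = some [true, false, true, false, true, false] := rfl
  have hM : endOrientation M [true, false] = some [true, false] := by
    simp only [M]
    rw [endOrientation_append_of (o' := [true, f, !f, false]) rfl, endOrientation_append_of k2,
      endOrientation_append_of k3]
    cases f <;> rfl
  have hM' := endOrientation_shift hM [] [true, false]
  rw [List.length_nil, shift_zero] at hM'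
  -- The same argument upside down: the cap of the turnback descends below the lower half,
  -- straightens against a cup, and reduces the lower half to two cups.
  have s1 := ctx_interchange (pre := [true]) (post := [false]) (o₁ := [false, true])
    (o₂ := [false, true]) (w := [.cap 0]) (o₁' := []) c₀ (M ++ [.cap 1, .cap 0, .cap 0])
    hc₀ rfl hL
  have s2 := ctx (pre := [true]) (post := [true, false]) (O := []) [.cup 0 true, .cup 1 false]
    (shift 1 L ++ (M ++ [.cap 1, .cap 0, .cap 0])) (ev_zigzag_right false) rfl rfl rfl
  have s3 := ctx1 (pre := [true]) (post := [false]) (O := []) [.cup 0 true]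
    (M ++ [.cap 1, .cap 0, .cap 0]) hLc rfl ((endOrientation_append_of rfl).trans hL) rfl
  have s4 := ctx_interchange (pre := []) (post := [true, false]) (o₁ := [true, false]) (O := [])
    (o₂ := []) (w' := [.cup 0 true]) (o₂' := [true, false]) [.cup 0 true, .cup 1 false]
    [.cap 1, .cap 0, .cap 0] rfl hM rfl
  have s5 := ctx (pre := [true]) (post := [true, false]) (O := [])
    ([.cup 0 true, .cup 1 false] ++ M) [.cap 0, .cap 0]
    (ev_zigzag_right false) ((endOrientation_append_of rfl).trans hM') rfl rfl
  have s6 := ctx (pre := []) (post := [true, false]) (O := [])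
    [.cup 0 true, .cup 1 false, .cup 1 f] [.cap 0]
    hYY rfl (o₁ := []) (o₂ := [])
    (by rw [endOrientation_append_of k2, endOrientation_append_of k3]; cases f <;> rfl)
    (by cases f <;> rfl)
  have s7 : ev [] [.cup 0 true, .cup 1 false, .cup 1 f, .cap 1, .cap 0, .cap 0] =
      cD ^ 2 • ev [] [] := by
    cases f <;> exact ev_planar rfl rfl
  rw [mul_smul, ← s7]
  simp only [joinHalves, upperHalf, List.length_nil, List.length_cons, shift_nil, M, c₀,
    shift_zero, shift_append, shift_cons, shift_shift, Layer.shift, List.append_assoc,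
    List.nil_append, List.cons_append, zero_add, Nat.reduceAdd, add_zero, Bool.not_false]
    at s1 s2 s3 s4 s5 s6 ⊢
  rw [← s1, s2, s3, ← s4, s5, s6]

/-! ## Chains of locks -/

theorem endOrientation_replicate_even {n : ℕ} (hn : Even n) (s a b : Bool) :
    endOrientation (List.replicate n (.cross 0 s)) [a, b] = some [a, b] := by
  rw [endOrientation_replicate, flip, flip, if_pos hn, if_pos hn]

/-- The coefficient of the turnback in the expansion of a lock. -/
noncomputable def lockCoeff (s : Bool) : Coeff := if s then cphiBar else cphi

theorem ev_lock (o s : Bool) : ev [o, !o] [.cross 0 s, .cross 0 s] =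
    (1 : Coeff) • ev [o, !o] [] + lockCoeff s • ev [o, !o] [.cap 0, .cup 0 o] := by
  cases s
  · exact ev_twist_twist o
  · exact ev_untwist_untwist o

/-- A chain of locks between antiparallel strands. -/
theorem exists_ev_replicate_antiparallel {n : ℕ} (hn : Even n) (s o : Bool) :
    ∃ c : Coeff, ev [o, !o] (List.replicate n (.cross 0 s)) =
      (1 : Coeff) • ev [o, !o] [] + c • ev [o, !o] [.cap 0, .cup 0 o] := by
  obtain ⟨m, rfl⟩ := hn
  induction m with
  | zero => exact ⟨0, by simp⟩
  | succ m ih =>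
    obtain ⟨c, ih⟩ := ih
    have h₁ := ctx2 (pre := []) (post := []) (O := [o, !o]) [.cross 0 s, .cross 0 s] [] ih rfl
      (endOrientation_replicate_even ⟨m, rfl⟩ _ _ _) rfl (endOrientation_turnback _ _)
    have h₂ := ctx2 (pre := []) (post := []) (O := [o, !o]) [] [.cap 0, .cup 0 o] (ev_lock o s) rfl
      (o₁ := [o, !o]) (o₂ := [o, !o]) rfl rfl (endOrientation_turnback _ _)
    simp only [List.length_nil, shift_zero, List.append_nil, List.nil_append, List.cons_append]
      at h₁ h₂
    -- With T the turnback and T² = D T, this is the coefficient of T in `(1 + λ T) (1 + c T)`,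
    -- where `λ` is `lockCoeff s`.
    refine ⟨lockCoeff s + c * (1 + lockCoeff s * cD), ?_⟩
    rw [show m + 1 + (m + 1) = (m + m) + 2 by ring, List.replicate_succ, List.replicate_succ, h₁, h₂,
      ev_lock, ev_turnback_turnback, smul_smul, ← add_smul, smul_smul, one_smul, add_assoc,
      ← add_smul]

/-- The coefficient of the skein relation. -/
noncomputable def skeinCoeff (s : Bool) : Coeff := if s then cz else -cz

theorem ev_cross_parallel (o s : Bool) : ev [o, o] [.cross 0 s] =
    skeinCoeff s • ev [o, o] [] + (1 : Coeff) • ev [o, o] [.cross 0 (!s)] := by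
  have h := ev_skein_parallel o
  cases s
  · rw [Bool.not_false, h]
    simp [skeinCoeff]
  · rw [h, add_comm]
    rfl

theorem ev_cross_cross_parallel (o s : Bool) : ev [o, o] [.cross 0 s, .cross 0 s] =
    (1 : Coeff) • ev [o, o] [] + skeinCoeff s • ev [o, o] [.cross 0 s] := by
  have h := ctx2 (pre := []) (post := []) (O := [o, o]) [.cross 0 s] [] (ev_cross_parallel o s)
    rfl (o₁ := [o, o]) (o₂ := [o, o]) (o₃ := [o, o]) rfl rfl rfl
  simp only [List.length_nil, shift_zero, List.append_nil, List.cons_append, List.nil_append] at h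
  rw [h, ev_cross_cross, add_comm]

/-- A braid of two parallel strands. -/
theorem exists_ev_replicate_parallel (n : ℕ) (s t o : Bool) :
    ∃ a b : Coeff, ev [o, o] (List.replicate n (.cross 0 s)) =
      a • ev [o, o] [] + b • ev [o, o] [.cross 0 t] := by
  have key : ∃ a b : Coeff, ev [o, o] (List.replicate n (.cross 0 s)) =
      a • ev [o, o] [] + b • ev [o, o] [.cross 0 s] := by
    induction n with
    | zero => exact ⟨1, 0, by simp⟩
    | succ n ih =>
      obtain ⟨a, b, ih⟩ := ih
      have h := ctx2 (pre := []) (post := []) (O := [o, o]) [.cross 0 s] [] ih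
        rfl (o₂ := [o, o]) (o₃ := [o, o]) (endOrientation_replicate n s o o) rfl rfl
      simp only [List.length_nil, shift_zero, List.append_nil, List.cons_append,
        List.nil_append] at h
      -- The product of a crossing `σ` with `a + b σ`, where `σ² = 1 + skeinCoeff s • σ`.
      refine ⟨b, a + b * skeinCoeff s, ?_⟩
      rw [List.replicate_succ, h, ev_cross_cross_parallel, smul_add, smul_smul, smul_smul, mul_one,
        add_smul]
      abel
  obtain ⟨a, b, h⟩ := key
  by_cases hst : t = s
  · exact ⟨a, b, hst ▸ h⟩
  · obtain rfl : t = !s := Bool.eq_not_of_ne hst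
    refine ⟨a + b * skeinCoeff s, b, ?_⟩
    rw [h, ev_cross_parallel, smul_add, smul_smul, smul_smul, mul_one, add_smul, add_assoc]

/-! ## Expansions of the two halves -/

section Expansions

variable {a c a' c' : Coeff} {X X' U V Y Y' X₁ X₂ X₁' X₂' Y₁ Y₂ Y₁' Y₂' : List Layer}

theorem ev_lowerHalf_expand {e : Bool}
    (hX : endOrientation X [false, e] = some [false, e])
    (hX₁ : endOrientation X₁ [false, e] = some [false, e])
    (hX₂ : endOrientation X₂ [false, e] = some [false, e])
    (hX' : endOrientation X' [!e, true] = some [!e, true])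
    (hX₁' : endOrientation X₁' [!e, true] = some [!e, true])
    (hX₂' : endOrientation X₂' [!e, true] = some [!e, true])
    (h : ev [false, e] X = a • ev [false, e] X₁ + c • ev [false, e] X₂)
    (h' : ev [!e, true] X' = a' • ev [!e, true] X₁' + c' • ev [!e, true] X₂') :
    ev [false, true] (lowerHalf e X X' U) =
      (a * a') • ev [false, true] (lowerHalf e X₁ X₁' U) +
      (a * c') • ev [false, true] (lowerHalf e X₁ X₂' U) +
      (c * a') • ev [false, true] (lowerHalf e X₂ X₁' U) +
      (c * c') • ev [false, true] (lowerHalf e X₂ X₂' U) := by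
  have s₁ := ctx2 (pre := []) (post := [!e, true]) (O := [false, true]) [.cup 1 e]
    (shift 2 X' ++ shift 1 U) h rfl hX hX₁ hX₂
  have s₂ (Z : List Layer) (hZ : endOrientation Z [false, e] = some [false, e]) :=
    ctx2 (pre := [false, e]) (post := []) (O := [false, true]) ([.cup 1 e] ++ Z)
    (shift 1 U) h' ((endOrientation_append_of rfl).trans
      (by simpa [shift_zero] using endOrientation_shift hZ [] [!e, true])) hX' hX₁' hX₂'
  have s₃ := s₂ X₁ hX₁
  have s₄ := s₂ X₂ hX₂
  simp only [List.length_nil, List.length_cons, shift_zero, List.append_assoc, zero_add,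
    Nat.reduceAdd] at s₁ s₃ s₄
  rw [lowerHalf, s₁, s₃, s₄, smul_add, smul_add, smul_smul, smul_smul, smul_smul, smul_smul,
    ← add_assoc]
  rfl

theorem ev_upperHalf_expand {f : Bool}
    (hV : endOrientation V [false, true] = some [f, !f])
    (hY : endOrientation Y [true, f] = some [true, f])
    (hY₁ : endOrientation Y₁ [true, f] = some [true, f])
    (hY₂ : endOrientation Y₂ [true, f] = some [true, f])
    (hY' : endOrientation Y' [!f, false] = some [!f, false])
    (hY₁' : endOrientation Y₁' [!f, false] = some [!f, false])
    (hY₂' : endOrientation Y₂' [!f, false] = some [!f, false])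
    (h : ev [true, f] Y = a • ev [true, f] Y₁ + c • ev [true, f] Y₂)
    (h' : ev [!f, false] Y' = a' • ev [!f, false] Y₁' + c' • ev [!f, false] Y₂') :
    ev [true, false, true, false] (upperHalf V Y Y') =
      (a * a') • ev [true, false, true, false] (upperHalf V Y₁ Y₁') +
      (a * c') • ev [true, false, true, false] (upperHalf V Y₁ Y₂') +
      (c * a') • ev [true, false, true, false] (upperHalf V Y₂ Y₁') +
      (c * c') • ev [true, false, true, false] (upperHalf V Y₂ Y₂') := by
  have hV' : endOrientation (shift 1 V) [true, false, true, false] = some [true, f, !f, false] :=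
    endOrientation_shift hV [true] [false]
  have s₁ := ctx2 (pre := []) (post := [!f, false]) (O := [true, false, true, false]) (shift 1 V)
    (shift 2 Y' ++ [.cap 1]) h hV' hY hY₁ hY₂
  have s₂ (Z : List Layer) (hZ : endOrientation Z [true, f] = some [true, f]) :=
    ctx2 (pre := [true, f]) (post := []) (O := [true, false, true, false]) (shift 1 V ++ Z)
    [.cap 1] h' ((endOrientation_append_of hV').trans
      (by simpa [shift_zero] using endOrientation_shift hZ [] [!f, false])) hY' hY₁' hY₂'
  have s₃ := s₂ Y₁ hY₁
  have s₄ := s₂ Y₂ hY₂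
  simp only [List.length_nil, List.length_cons, shift_zero, List.append_assoc, zero_add,
    Nat.reduceAdd] at s₁ s₃ s₄
  rw [upperHalf, s₁, s₃, s₄, smul_add, smul_add, smul_smul, smul_smul, smul_smul, smul_smul,
    ← add_assoc]
  rfl

end Expansions

/-! The tangles that occur in the expansions of the lower half. -/

/-- A cup in the middle. -/
def lowerMid : List Layer := [.cup 1 true]

/-- A cup on the left. -/
def lowerLeft : List Layer := [.cup 0 false]

/-- A cup on the right. -/
def lowerRight : List Layer := [.cup 2 false]

/-- A cup on the left and a turnback on the right. -/
def lowerBoth : List Layer := [.cup 0 false, .cap 2, .cup 2 false]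

/-- A turnback and a cup in the middle. -/
def lowerTurn : List Layer := [.cap 0, .cup 0 false, .cup 1 true]

/-- A cup that crosses both strands. -/
def lowerTangle : List Layer := [.cup 1 false, .cross 0 false, .cross 2 true, .cross 1 false]

/-! The tangles that occur in the expansions of the upper half. -/

/-- A cap in the middle. -/
def upperMid : List Layer := [.cap 1]

/-- A cap on the left. -/
def upperLeft : List Layer := [.cap 0]

/-- A cap on the right. -/
def upperRight : List Layer := [.cap 2]

/-- Two caps and a cup. -/
def upperBoth : List Layer := [.cap 0, .cap 0, .cup 0 true]

/-- A cap in the middle and a turnback. -/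
def upperTurn : List Layer := [.cap 1, .cap 0, .cup 0 true]

/-- A cap that crosses both strands. -/
def upperTangle : List Layer := [.cross 1 false, .cross 0 true, .cross 2 false, .cap 1]

section

variable {a c a' c' : Coeff} {X X' Y Y' : List Layer}

/-- The chains are antiparallel, so each one is a combination of the identity and the turnback. The
four products are planar. -/
theorem ev_lowerHalf_even
    (hX : endOrientation X [false, true] = some [false, true])
    (hX' : endOrientation X' [false, true] = some [false, true])
    (h : ev [false, true] X = a • ev [false, true] [] + c • ev [false, true] [.cap 0, .cup 0 false])
    (h' : ev [false, true] X' =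
      a' • ev [false, true] [] + c' • ev [false, true] [.cap 0, .cup 0 false]) :
    ev [false, true] (lowerHalf true X X' []) =
      (a * a') • ev [false, true] lowerMid + (a * c') • ev [false, true] lowerRight +
      (c * a') • ev [false, true] lowerLeft + (c * c') • ev [false, true] lowerBoth := by
  rw [ev_lowerHalf_expand (e := true) hX rfl rfl hX' rfl rfl h h']
  congr 2
  · congr 2
    exact ev_eq_of_simplify rfl rfl rfl
  · congr 1
    exact ev_eq_of_simplify rfl rfl rfl
  · exact ev_eq_of_simplify rfl rfl rfl

theorem ev_upperHalf_even
    (hY : endOrientation Y [true, false] = some [true, false])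
    (hY' : endOrientation Y' [true, false] = some [true, false])
    (h : ev [true, false] Y = a • ev [true, false] [] + c • ev [true, false] [.cap 0, .cup 0 true])
    (h' : ev [true, false] Y' =
      a' • ev [true, false] [] + c' • ev [true, false] [.cap 0, .cup 0 true]) :
    ev [true, false, true, false] (upperHalf [] Y Y') =
      (a * a') • ev [true, false, true, false] upperMid +
      (a * c') • ev [true, false, true, false] upperRight +
      (c * a') • ev [true, false, true, false] upperLeft +
      (c * c') • ev [true, false, true, false] upperBoth := by
  rw [ev_upperHalf_expand (f := false) rfl hY rfl rfl hY' rfl rfl h h']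
  congr 2
  · congr 2
    exact ev_eq_of_simplify rfl rfl rfl
  · congr 1
    exact ev_eq_of_simplify rfl rfl rfl
  · exact ev_eq_of_simplify rfl rfl rfl

/-- The chains are now parallel, and the basis is the identity and a crossing. The signs of the
crossings are chosen so that a left crossing alone cancels the half twist of the box and a right one
alone makes a lock with it. Only both together give the tangle `lowerTangle`. -/
theorem ev_lowerHalf_odd
    (hX : endOrientation X [false, false] = some [false, false])
    (hX' : endOrientation X' [true, true] = some [true, true])
    (h : ev [false, false] X =
      a • ev [false, false] [] + c • ev [false, false] [.cross 0 false])
    (h' : ev [true, true] X' = a' • ev [true, true] [] + c' • ev [true, true] [.cross 0 true]) :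
    ev [false, true] (lowerHalf false X X' [.cross 0 false]) =
      (a * a' * cA + a * c' * cphi) • ev [false, true] lowerMid +
      (a * c') • ev [false, true] lowerRight +
      (c * a') • ev [false, true] lowerLeft + (c * c') • ev [false, true] lowerTangle := by
  rw [ev_lowerHalf_expand (e := false) hX rfl rfl hX' rfl rfl h h']
  have e₁ : ev [false, true] (lowerHalf false [] [] [.cross 0 false]) =
      cA • ev [false, true] lowerMid := ev_step1 0 1 (ev_curl_cup false)
  have e₂ : ev [false, true] (lowerHalf false [] [.cross 0 true] [.cross 0 false]) =
      (1 : Coeff) • ev [false, true] lowerRight + cphi • ev [false, true] lowerMid := by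
    have s₁ : ev [false, true] (lowerHalf false [] [.cross 0 true] [.cross 0 false]) =
      ev [false, true] [.cup 2 false, .cross 1 false, .cross 1 false] :=
      ev_step 0 1 (ev_slide_cup false true true)
    have s₂ := s₁.trans (ev_step2 1 1 (ev_twist_twist true))
    exact eq_add_trans s₂ (eq_one_smul rfl) (eq_one_smul (ev_eq_of_simplify rfl rfl rfl))
      (mul_one _) (mul_one _)
  have e₃ : ev [false, true] (lowerHalf false [.cross 0 false] [] [.cross 0 false]) =
      ev [false, true] lowerLeft :=
    (ev_step 0 0 (ev_slide_cup' false false false)).trans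
      (ev_step 1 1 (ev_cross_cross true false true))
  have e₄ : lowerHalf false [.cross 0 false] [.cross 0 true] [.cross 0 false] = lowerTangle := rfl
  rw [e₁, e₂, e₃, e₄, smul_add, smul_smul, smul_smul, smul_smul, mul_one, add_smul]
  abel

theorem ev_upperHalf_odd
    (hY : endOrientation Y [true, true] = some [true, true])
    (hY' : endOrientation Y' [false, false] = some [false, false])
    (h : ev [true, true] Y = a • ev [true, true] [] + c • ev [true, true] [.cross 0 true])
    (h' : ev [false, false] Y' =
      a' • ev [false, false] [] + c' • ev [false, false] [.cross 0 false]) :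
    ev [true, false, true, false] (upperHalf [.cross 0 false] Y Y') =
      (a * a' * cA + c * a' * cphi) • ev [true, false, true, false] upperMid +
      (a * c') • ev [true, false, true, false] upperRight +
      (c * a') • ev [true, false, true, false] upperLeft +
      (c * c') • ev [true, false, true, false] upperTangle := by
  rw [ev_upperHalf_expand (f := true) rfl hY rfl rfl hY' rfl rfl h h']
  have e₁ : ev [true, false, true, false] (upperHalf [.cross 0 false] [] []) =
      cA • ev [true, false, true, false] upperMid := ev_step1 0 1 (ev_curl_cap false)
  have e₂ : ev [true, false, true, false] (upperHalf [.cross 0 false] [.cross 0 true] []) =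
      (1 : Coeff) • ev [true, false, true, false] upperLeft +
        cphi • ev [true, false, true, false] upperMid := by
    have s₁ : ev [true, false, true, false] (upperHalf [.cross 0 false] [.cross 0 true] []) =
      ev [true, false, true, false] [.cross 1 false, .cross 1 false, .cap 0] :=
      ev_step 1 0 (ev_slide_cap' true true true)
    have s₂ := s₁.trans (ev_step2 0 1 (ev_twist_twist false))
    exact eq_add_trans s₂ (eq_one_smul rfl) (eq_one_smul (ev_eq_of_simplify rfl rfl rfl))
      (mul_one _) (mul_one _)
  have e₃ : ev [true, false, true, false] (upperHalf [.cross 0 false] [] [.cross 0 false]) =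
      ev [true, false, true, false] upperRight :=
    (ev_step 1 1 (ev_slide_cap true false false)).trans
      (ev_step 0 1 (ev_cross_cross false true false))
  have e₄ : upperHalf [.cross 0 false] [.cross 0 true] [.cross 0 false] = upperTangle := rfl
  rw [e₁, e₂, e₃, e₄, smul_add, smul_smul, smul_smul, smul_smul, mul_one, add_smul]
  abel

end

/-! ## Values of the closed diagrams -/

theorem cAinv_mul_cphi : cAinv * cphi = cz := by
  rw [cphi, ← mul_assoc, mul_comm cAinv, cA_mul_cAinv, one_mul]

/-- Sliding one crossing around the cap produces a cancelling pair; what is left is a single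
positive curl. -/
theorem ev_lowerTangle_capLeft :
    ev [false, true] (lowerTangle ++ [.cap 0]) = cA • ev [false, true] [] := by
  have h := (Eq.refl (ev [false, true] (lowerTangle ++ [.cap 0]))).trans
    (((((ev_step 3 0 (ev_slide_cap false false false)).trans (ev_swapAt 1)).trans
    (ev_step 2 0 (ev_cross_cross false false false))).trans
    (ev_step 1 1 (ev_slide_cap false true true))).trans (ev_step1 0 1 (ev_curl_cup false)))
  exact eq_smul_trans h
    (eq_one_smul (ev_eq_of_simplify rfl rfl rfl)) (mul_one _)

theorem ev_lowerTangle_capMid :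
    ev [false, true] (lowerTangle ++ [.cap 1]) = cA • ev [false, true] [.cap 0, .cup 0 false] := by
  have h := (Eq.refl (ev [false, true] (lowerTangle ++ [.cap 1]))).trans
    (ev_step1 3 1 (ev_curl_cap false))
  have h' : ev [false, true] [.cup 1 false, .cross 0 false, .cross 2 true, .cap 1] =
      ev [false, true] [.cup 0 false, .cap 2] :=
    ((ev_step 2 1 (ev_slide_cap false true true)).trans
      (ev_step 0 0 (ev_slide_cup' false false false))).trans
      (ev_step 1 1 (ev_cross_cross true false true))
  exact eq_smul_trans h (eq_one_smul (h'.trans (ev_eq_of_simplify rfl rfl rfl))) (mul_one _)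

/-- One crossing becomes a negative curl, worth `A⁻¹`. The other two become a lock, whose turnback
has the coefficient `A⁻¹ φ = z`. -/
theorem ev_lowerTangle_turn :
    ev [true] ([.cup 0 true] ++ shift 1 lowerTangle ++ [.cap 0]) =
      cAinv • ev [true] [.cup 1 false] + cz • ev [true] [.cup 0 true] := by
  have h₁ : ev [true] ([.cup 0 true] ++ shift 1 lowerTangle ++ [.cap 0]) =
      ev [true] [.cup 0 true, .cross 0 true, .cup 2 false, .cap 1, .cross 1 true, .cross 0 false] :=
    (((ev_swapAt 4).trans (ev_swapAt 3)).trans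
      (ev_step 2 0 (ev_slide_cap true false false))).trans (ev_swapAt 1)
  have h₂ : ev [true] [.cup 0 false, .cup 2 false, .cap 1, .cross 1 true, .cross 0 false] =
      ev [true] [.cup 1 false, .cross 0 false, .cross 0 false] :=
    (ev_step 1 1 (ev_zigzag_right true)).trans (ev_step 0 0 (ev_slide_cup false true true))
  have h₃ := h₂.trans (ev_step2 1 0 (ev_twist_twist true))
  have h₄ := eq_add_trans (Z₁ := ev [true] [.cup 1 false]) (Z₂ := ev [true] [.cup 0 true]) h₃
    (eq_one_smul rfl) (eq_one_smul (ev_eq_of_simplify rfl rfl rfl)) (mul_one _) (mul_one _)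
  have h₅ := h₁.trans (ev_step1 0 0 (ev_curl_cup_inv true))
  refine h₅.trans ((congrArg _ h₄).trans ?_)
  rw [smul_add, smul_smul, smul_smul, mul_one, cAinv_mul_cphi]

theorem ev_upperTangle_cup :
    ev [true, false] ([.cup 2 true] ++ upperTangle) = cA • ev [true, false] [] := by
  have h := (Eq.refl (ev [true, false] ([.cup 2 true] ++ upperTangle))).trans
    (((((ev_step 0 1 (ev_slide_cup' true false false)).trans (ev_swapAt 1)).trans
    (ev_step 2 2 (ev_cross_cross false false true))).trans
    (ev_step 1 0 (ev_slide_cap' true true true))).trans (ev_step1 0 1 (ev_curl_cup true)))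
  exact eq_smul_trans h
    (eq_one_smul (ev_eq_of_simplify rfl rfl rfl)) (mul_one _)

theorem ev_upperTangle_turn :
    ev [true, false, true] ([.cup 3 false] ++ upperTangle ++ [.cap 1]) =
      cAinv • ev [true, false, true] [.cap 0] + cz • ev [true, false, true] [.cap 1] := by
  have h₁ : ev [true, false, true] ([.cup 3 false] ++ upperTangle ++ [.cap 1]) =
      ev [true, false, true] [.cup 3 false, .cross 3 true, .cross 1 false, .cross 0 true, .cap 2,
        .cap 1] :=
    (((ev_swapAt 4).trans (ev_step 3 2 (ev_slide_cap' false false false))).trans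
      (ev_swapAt 2)).trans (ev_swapAt 1)
  have h₂ : ev [true, false, true] [.cup 3 true, .cross 1 false, .cross 0 true, .cap 2, .cap 1] =
      ev [true, false, true] [.cross 1 false, .cross 1 false, .cap 0] :=
    (((ev_swapAt 0).trans (ev_swapAt 1)).trans (ev_step 2 2 (ev_zigzag_right false))).trans
      (ev_step 1 0 (ev_slide_cap' true true true))
  have h₃ := h₂.trans (ev_step2 0 1 (ev_twist_twist false))
  have h₄ := eq_add_trans (Z₁ := ev [true, false, true] [.cap 0])
    (Z₂ := ev [true, false, true] [.cap 1]) h₃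
    (eq_one_smul rfl) (eq_one_smul (ev_eq_of_simplify rfl rfl rfl)) (mul_one _) (mul_one _)
  have h₅ := h₁.trans (ev_step1 0 3 (ev_curl_cup_inv false))
  refine h₅.trans ((congrArg _ h₄).trans ?_)
  rw [smul_add, smul_smul, smul_smul, mul_one, cAinv_mul_cphi]

theorem ev_tangle_mid : ev [] (joinHalves lowerTangle upperMid) = (cA * cD ^ 1) • ev [] [] := by
  have h := (Eq.refl (ev [] (joinHalves lowerTangle upperMid))).trans
    (((((ev_swapAt 6).trans (ev_swapAt 5)).trans (ev_swapAt 4)).trans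
    (ev_swapAt 3)).trans (ev_step1 4 1 ev_lowerTangle_capLeft))
  exact eq_smul_trans h (ev_planar rfl rfl) rfl

theorem ev_tangle_left : ev [] (joinHalves lowerTangle upperLeft) = (cA * cD ^ 2) • ev [] [] := by
  have h := (Eq.refl (ev [] (joinHalves lowerTangle upperLeft))).trans
    (((((ev_swapAt 6).trans (ev_swapAt 5)).trans (ev_swapAt 4)).trans
    (ev_swapAt 3)).trans (ev_step1 4 1 ev_lowerTangle_capLeft))
  exact eq_smul_trans h (ev_planar rfl rfl) rfl

theorem ev_tangle_both : ev [] (joinHalves lowerTangle upperBoth) = (cA * cD ^ 1) • ev [] [] := by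
  have h : ev [true, false, true, false, true, false, true, false]
      [.cap 0, .cap 0, .cup 0 true, .cap 1, .cap 0, .cap 0] =
      ev [true, false, true, false, true, false, true, false] [.cap 4, .cap 0, .cap 0, .cap 0] :=
    ev_eq_of_simplify rfl rfl rfl
  have h' := (Eq.refl (ev [] (joinHalves lowerTangle upperBoth))).trans
    ((ev_step 7 0 h).trans (ev_step1 3 3 ev_lowerTangle_capMid))
  exact eq_smul_trans h'
    (ev_planar rfl rfl) rfl

theorem ev_tangle_right : ev [] (joinHalves lowerTangle upperRight) =
    (cAinv * cD ^ 2 + cz * cD ^ 1) • ev [] [] := by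
  rw [add_smul]
  have h' := (Eq.refl (ev [] (joinHalves lowerTangle upperRight))).trans (ev_step2 2 2 ev_lowerTangle_turn)
  exact eq_add_trans h' (ev_planar rfl rfl) (ev_planar rfl rfl)
    rfl rfl

theorem ev_mid_tangle : ev [] (joinHalves lowerMid upperTangle) = (cA * cD ^ 1) • ev [] [] := by
  have h := (Eq.refl (ev [] (joinHalves lowerMid upperTangle))).trans
    ((ev_swapAt 2).trans (ev_step1 3 0 ev_upperTangle_cup))
  exact eq_smul_trans h (ev_planar rfl rfl) rfl

theorem ev_right_tangle : ev [] (joinHalves lowerRight upperTangle) = (cA * cD ^ 2) • ev [] [] := by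
  have h := (Eq.refl (ev [] (joinHalves lowerRight upperTangle))).trans
    ((ev_swapAt 2).trans (ev_step1 3 0 ev_upperTangle_cup))
  exact eq_smul_trans h (ev_planar rfl rfl) rfl

theorem ev_left_tangle : ev [] (joinHalves lowerLeft upperTangle) =
    (cAinv * cD ^ 2 + cz * cD ^ 1) • ev [] [] := by
  rw [add_smul]
  have h' := (Eq.refl (ev [] (joinHalves lowerLeft upperTangle))).trans (ev_step2 3 0 ev_upperTangle_turn)
  exact eq_add_trans h' (ev_planar rfl rfl) (ev_planar rfl rfl)
    rfl rfl

theorem ev_both_tangle : ev [] (joinHalves lowerBoth upperTangle) =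
    (cAinv * cD ^ 1 + cz * cD ^ 2) • ev [] [] := by
  rw [add_smul]
  have h' := (Eq.refl (ev [] (joinHalves lowerBoth upperTangle))).trans
    (((ev_swapAt 3).trans (ev_swapAt 4)).trans (ev_step2 5 0 ev_upperTangle_turn))
  exact eq_add_trans h'
    (ev_planar rfl rfl) (ev_planar rfl rfl) rfl rfl

/-- The one closed diagram of the tables in which a triangle of crossings must be moved. After
Reidemeister III, crossings slide around nested cups and caps and cancel in pairs until a single
lock remains. Its two terms close up to three circles and, with the factor `φ`, to two circles. -/
theorem ev_tangle_tangle : ev [] (joinHalves lowerTangle upperTangle) =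
    (cD ^ 3 + cphi * cD ^ 2) • ev [] [] := by
  have h₁ : ev [] (joinHalves lowerTangle upperTangle) =
      ev [] ([.cup 0 true, .cup 1 false, .cup 1 true, .cup 4 false, .cross 2 true, .cross 3 false,
        .cross 2 false, .cross 5 true, .cross 4 false, .cross 0 true] ++
        [.cap 1, .cap 1, .cap 0, .cap 0]) :=
    ((((((((ev_swapAt 6).trans (ev_swapAt 5)).trans (ev_swapAt 4)).trans (ev_swapAt 3)).trans
      (ev_step 2 1 (ev_slide_cup' true false false))).trans (ev_swapAt 3)).trans
      (ev_swapAt 8)).trans (ev_swapAt 7)).trans (ev_swapAt 6)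
  have h₂ : ev [] ([.cup 0 true, .cup 1 false, .cup 1 true, .cup 4 false, .cross 2 true,
        .cross 3 false, .cross 2 false, .cross 5 true, .cross 4 false, .cross 0 true] ++
        [.cap 1, .cap 1, .cap 0, .cap 0]) =
      ev [] [.cup 0 true, .cup 1 false, .cup 1 false, .cup 2 true, .cross 1 true, .cross 4 true,
        .cross 3 true, .cross 5 true, .cross 4 false, .cross 1 false, .cap 0, .cap 1, .cap 0,
        .cap 0] :=
    (((((ev_step 4 2 ev_braid).trans (ev_step 9 0 (ev_slide_cap' true true true))).trans
      (ev_step 3 3 (ev_slide_cup' false false false))).trans (ev_swapAt 4)).trans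
      (ev_swapAt 2)).trans (ev_step 3 1 (ev_slide_cup true false false))
  have h₃ : ev [] [.cup 0 true, .cup 1 false, .cup 1 false, .cup 2 true, .cross 1 true,
        .cross 4 true, .cross 3 true, .cross 5 true, .cross 4 false, .cross 1 false, .cap 0, .cap 1,
        .cap 0, .cap 0] =
      ev [] [.cup 0 true, .cup 1 false, .cup 1 false, .cup 2 true, .cross 4 true,
        .cross 3 true, .cross 5 true, .cross 4 false, .cap 0, .cap 1, .cap 0, .cap 0] :=
    ((((ev_swapAt 8).trans (ev_swapAt 7)).trans (ev_swapAt 6)).trans (ev_swapAt 5)).trans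
      (ev_step 4 1 (ev_cross_cross false true true))
  have h₄ : ev [] [.cup 0 true, .cup 1 false, .cup 1 false, .cup 2 true, .cross 4 true,
        .cross 3 true, .cross 5 true, .cross 4 false, .cap 0, .cap 1, .cap 0, .cap 0] =
      ev [] [.cup 0 true, .cup 1 false, .cross 0 true, .cup 0 true, .cross 1 true, .cross 3 true,
        .cross 2 false, .cap 1, .cap 0, .cap 0] :=
    ((((((ev_swapAt 7).trans (ev_swapAt 6)).trans (ev_swapAt 5)).trans (ev_swapAt 4)).trans
      (ev_swapAt 3)).trans (ev_step 2 0 (ev_zigzag_right true))).trans (ev_swapAt 2)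
  have h₅ : ev [] [.cup 0 true, .cup 1 false, .cross 0 true, .cup 0 true, .cross 1 true,
        .cross 3 true, .cross 2 false, .cap 1, .cap 0, .cap 0] =
      ev [] [.cup 0 false, .cup 1 true, .cup 0 true, .cross 4 true, .cross 1 true, .cross 3 true,
        .cap 4, .cross 0 false, .cap 1, .cap 0] :=
    (((((ev_step 0 0 (ev_slide_nested_cups false true true).symm).trans (ev_swapAt 2)).trans
      (ev_step 6 0 (ev_slide_nested_caps true false false))).trans (ev_swapAt 8)).trans
      (ev_swapAt 7)).trans (ev_swapAt 6)
  have h₆ : ev [] [.cup 0 false, .cup 1 true, .cup 0 true, .cross 4 true, .cross 1 true,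
        .cross 3 true, .cap 4, .cross 0 false, .cap 1, .cap 0] =
      ev [] [.cup 0 false, .cup 1 true, .cup 1 true, .cross 0 false, .cross 0 false, .cap 3,
        .cap 1, .cap 0] :=
    ((((ev_step 5 3 (ev_slide_cap' true true true)).trans (ev_swapAt 4)).trans
      (ev_step 3 4 (ev_cross_cross false true true))).trans
      (ev_step 2 0 (ev_slide_cup true false true))).trans (ev_swapAt 4)
  have h := (((((h₁.trans h₂).trans h₃).trans h₄).trans h₅).trans h₆).trans
    (ev_step2 3 0 (ev_twist_twist false))
  rw [add_smul]
  exact eq_add_trans h (ev_planar rfl rfl) (ev_planar rfl rfl) (one_mul _) rfl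

/-! ## Expansion of the closed diagrams -/

/-- The value of a diagram whose halves are expanded. -/
theorem ev_joinHalves_sum {ι κ : Type*} [Fintype ι] [Fintype κ] {L R : List Layer}
    {b : ι → List Layer} {t : κ → List Layer} {c : ι → Coeff} {d : κ → Coeff} {g : ι → κ → Coeff}
    (hL : endOrientation L [false, true] = some [false, true, false, true])
    (hR : endOrientation R [true, false, true, false] = some [true, false])
    (hb : ∀ i, endOrientation (b i) [false, true] = some [false, true, false, true])
    (ht : ∀ j, endOrientation (t j) [true, false, true, false] = some [true, false])
    (h : ev [false, true] L = ∑ i, c i • ev [false, true] (b i))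
    (h' : ev [true, false, true, false] R = ∑ j, d j • ev [true, false, true, false] (t j))
    (hg : ∀ i j, ev [] (joinHalves (b i) (t j)) = g i j • ev [] []) :
    ev [] (joinHalves L R) = (∑ i, ∑ j, c i * d j * g i j) • ev [] [] := by
  obtain ⟨Φ, hΦ⟩ := exists_joinHalves_left R
  rw [← hΦ L hL, h, map_sum, Finset.sum_smul]
  refine Finset.sum_congr rfl fun i _ => ?_
  obtain ⟨Ψ, hΨ⟩ := exists_joinHalves_right (hb i)
  rw [map_smul, hΦ _ (hb i), ← hΨ R hR, h', map_sum, Finset.smul_sum, Finset.sum_smul]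
  refine Finset.sum_congr rfl fun j _ => ?_
  rw [map_smul, hΨ _ (ht j), hg, smul_smul, smul_smul]

/-- The diagram with the tangles `U` and `V` in the boxes, for given chains. -/
def boxDiagram (e : Bool) (X X' Y Y' U V : List Layer) : List Layer :=
  joinHalves (lowerHalf e X X' U) (upperHalf V Y Y')

/-! ### Bilinear expansion in the contents of the two boxes -/

section Boxes

variable {e f : Bool} {X X' Y Y' : List Layer}

theorem ev_boxDiagram_left
    (hX : endOrientation X [false, e] = some [false, e])
    (hX' : endOrientation X' [!e, true] = some [!e, true]) {U U₁ U₂ V : List Layer} {c₁ c₂ : Coeff}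
    (hU : endOrientation U [e, !e] = some [true, false])
    (hU₁ : endOrientation U₁ [e, !e] = some [true, false])
    (hU₂ : endOrientation U₂ [e, !e] = some [true, false])
    (h : ev [e, !e] U = c₁ • ev [e, !e] U₁ + c₂ • ev [e, !e] U₂) :
    ev [] (boxDiagram e X X' Y Y' U V) = c₁ • ev [] (boxDiagram e X X' Y Y' U₁ V) +
      c₂ • ev [] (boxDiagram e X X' Y Y' U₂ V) := by
  have k₁ := endOrientation_shift hX [] [!e, true]
  have k₂ := endOrientation_shift hX' [false, e] []
  simp only [List.length_nil, List.length_cons, shift_zero, List.nil_append, List.append_nil,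
    List.cons_append, zero_add, Nat.reduceAdd] at k₁ k₂
  have s := ctx2 (pre := [false]) (post := [true]) (O := [false, true])
    ([.cup 1 e] ++ (X ++ shift 2 X')) [] h
    (by rw [endOrientation_append_of (o' := [false, e, !e, true]) rfl,
      endOrientation_append_of k₁, k₂]; rfl) hU hU₁ hU₂
  simp only [List.length_cons, List.length_nil, List.append_assoc, List.append_nil, zero_add] at s
  obtain ⟨Φ, hΦ⟩ := exists_joinHalves_left (upperHalf V Y Y')
  have s' := congrArg Φ s
  rw [map_add, map_smul, map_smul] at s'
  rw [boxDiagram, boxDiagram, boxDiagram, ← hΦ _ (endOrientation_lowerHalf hX hX' hU),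
    ← hΦ _ (endOrientation_lowerHalf hX hX' hU₁), ← hΦ _ (endOrientation_lowerHalf hX hX' hU₂)]
  exact s'

theorem ev_boxDiagram_right
    (hX : endOrientation X [false, e] = some [false, e])
    (hX' : endOrientation X' [!e, true] = some [!e, true])
    (hY : endOrientation Y [true, f] = some [true, f])
    (hY' : endOrientation Y' [!f, false] = some [!f, false])
    {U V V₁ V₂ : List Layer} {c₁ c₂ : Coeff}
    (hU : endOrientation U [e, !e] = some [true, false])
    (hV : endOrientation V [false, true] = some [f, !f])
    (hV₁ : endOrientation V₁ [false, true] = some [f, !f])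
    (hV₂ : endOrientation V₂ [false, true] = some [f, !f])
    (h : ev [false, true] V = c₁ • ev [false, true] V₁ + c₂ • ev [false, true] V₂) :
    ev [] (boxDiagram e X X' Y Y' U V) = c₁ • ev [] (boxDiagram e X X' Y Y' U V₁) +
      c₂ • ev [] (boxDiagram e X X' Y Y' U V₂) := by
  have s := ctx2 (pre := [true]) (post := [false]) (O := [true, false, true, false])
    [] (Y ++ (shift 2 Y' ++ [.cap 1])) h rfl hV hV₁ hV₂
  simp only [List.length_cons, List.length_nil, List.nil_append, zero_add] at s
  obtain ⟨Ψ, hΨ⟩ := exists_joinHalves_right (endOrientation_lowerHalf hX hX' hU)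
  have s' := congrArg Ψ s
  rw [map_add, map_smul, map_smul] at s'
  rw [boxDiagram, boxDiagram, boxDiagram, ← hΨ _ (endOrientation_upperHalf hV hY hY'),
    ← hΨ _ (endOrientation_upperHalf hV₁ hY hY'), ← hΨ _ (endOrientation_upperHalf hV₂ hY hY')]
  exact s'

/-- The expansion of both boxes. -/
theorem ev_boxDiagram_boxes {u v : List Piece} (he : boxEnd e u = true) (hf : boxEnd false v = f)
    (hX : endOrientation X [false, e] = some [false, e])
    (hX' : endOrientation X' [!e, true] = some [!e, true])
    (hY : endOrientation Y [true, f] = some [true, f])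
    (hY' : endOrientation Y' [!f, false] = some [!f, false]) {c₁ c₂ c₃ c₄ : Coeff}
    (h₁ : ev [] (boxDiagram e X X' Y Y' (boxParity u) (boxParity v)) = c₁ • ev [] [])
    (h₂ : ev [] (boxDiagram e X X' Y Y' (boxParity u) [.cap 0, .cup 0 f]) = c₂ • ev [] [])
    (h₃ : ev [] (boxDiagram e X X' Y Y' [.cap 0, .cup 0 true] (boxParity v)) = c₃ • ev [] [])
    (h₄ : ev [] (boxDiagram e X X' Y Y' [.cap 0, .cup 0 true] [.cap 0, .cup 0 f]) =
      c₄ • ev [] []) :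
    ev [] (boxDiagram e X X' Y Y' (boxLayers 0 e u) (boxLayers 0 false v)) =
      (cphiBar ^ (lockNumber v + lockNumber u) * c₁ + cphiBar ^ lockNumber u * boxCoeff v * c₂ +
        cphiBar ^ lockNumber v * boxCoeff u * c₃ + boxCoeff u * boxCoeff v * c₄) • ev [] [] := by
  have tu := endOrientation_boxLayers e u
  have tv := endOrientation_boxLayers false v
  have pu := endOrientation_boxParity e u
  have pv := endOrientation_boxParity false v
  have ru := endOrientation_turnback e true
  have rv := endOrientation_turnback false f
  have bu := ev_boxLayers e u
  have bv := ev_boxLayers false v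
  rw [he] at tu pu bu
  rw [hf] at tv pv bv
  rw [ev_boxDiagram_left hX hX' tu pu ru bu, ev_boxDiagram_right hX hX' hY hY' pu tv pv rv bv,
    ev_boxDiagram_right hX hX' hY hY' ru tv pv rv bv, h₁, h₂, h₃, h₄]
  simp only [smul_smul, ← add_smul]
  congr 1
  ring

/-- The values of the diagrams with a turnback in a box. -/
theorem ev_boxDiagram_turnbacks {u v : List Piece} (he : boxEnd e u = true)
    (hf : boxEnd false v = f)
    (hX : endOrientation X [false, e] = some [false, e])
    (hX' : endOrientation X' [!e, true] = some [!e, true])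
    (hY : endOrientation Y [true, f] = some [true, f])
    (hY' : endOrientation Y' [!f, false] = some [!f, false])
    (hXX : ev [] ([.cup 0 false, .cup 1 e] ++ (X ++ shift 2 X')) =
      ev [] [.cup 0 false, .cup 1 e])
    (hYY : ev [true, f, !f, false] (Y ++ (shift 2 Y' ++ [.cap 1, .cap 0])) =
      ev [true, f, !f, false] [.cap 1, .cap 0]) :
    ev [] (boxDiagram e X X' Y Y' (boxParity u) [.cap 0, .cup 0 f]) =
        ((if Even (twistNumber u) then 1 else cA) * cD ^ 2) • ev [] [] ∧
      ev [] (boxDiagram e X X' Y Y' [.cap 0, .cup 0 true] (boxParity v)) =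
        ((if Even (twistNumber v) then 1 else cA) * cD ^ 2) • ev [] [] ∧
      ev [] (boxDiagram e X X' Y Y' [.cap 0, .cup 0 true] [.cap 0, .cup 0 f]) =
        (cD * cD ^ 2) • ev [] [] := by
  have pu := endOrientation_boxParity e u
  have pv := endOrientation_boxParity false v
  rw [he] at pu
  rw [hf] at pv
  refine ⟨?_, ?_, ?_⟩
  -- Below the turnback of the `q`-box the lower chains sit on nested cups and cancel. A half twist
  -- left in the `p`-box is then a curl, worth `A`.
  · refine ev_joinHalves_turnback_right hY hY' hYY (endOrientation_lowerHalf hX hX' pu) ?_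
    have k₁ := endOrientation_shift hX [] [!e, true]
    have k₂ := endOrientation_shift hX' [false, e] []
    simp only [List.length_nil, List.length_cons, shift_zero, List.nil_append, List.append_nil,
      List.cons_append, zero_add, Nat.reduceAdd] at k₁ k₂
    have s := ctx (pre := []) (post := []) (O := []) [] (shift 1 (boxParity u)) hXX rfl
      (by rw [endOrientation_append_of (o' := [false, e, !e, true]) rfl,
        endOrientation_append_of k₁, k₂]) rfl
    have s' : ev [] ([.cup 0 false] ++ lowerHalf e X X' (boxParity u)) =
        ev [] ([.cup 0 false, .cup 1 e] ++ shift 1 (boxParity u)) := by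
      simpa [lowerHalf, shift_zero] using s
    rw [s']
    by_cases h : Even (twistNumber u)
    · rw [boxEnd, if_pos h] at he
      rw [boxParity, if_pos h, if_pos h, one_smul, he]
      rfl
    · rw [boxEnd, if_neg h] at he
      obtain rfl : e = false := by simpa using he
      rw [boxParity, if_neg h, if_neg h]
      exact ev_step1 1 1 (ev_curl_cup false)
  · refine ev_joinHalves_turnback_left hX hX' hXX (endOrientation_upperHalf pv hY hY')
      (ev_upperHalf_cap pv hY hY' hYY ?_)
    by_cases h : Even (twistNumber v)
    · rw [boxParity, if_pos h, if_pos h, one_smul]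
      rfl
    · rw [boxParity, if_neg h, if_neg h]
      exact ev_curl_cap false
  · have rv := endOrientation_turnback false f
    refine ev_joinHalves_turnback_left hX hX' hXX (endOrientation_upperHalf rv hY hY')
      (ev_upperHalf_cap rv hY hY' hYY ?_)
    have h := ctx1 (pre := []) (post := []) (O := [false, true]) [.cap 0] [] (ev_circle f)
      (o₁ := []) (o₂ := []) rfl (by cases f <;> rfl) rfl
    exact h

end Boxes

/-! ## The tables of values -/

/-- The tangles in the lower half, for an even number of half twists in the `p`-box. -/
def lowerEven : Fin 4 → List Layer := ![lowerMid, lowerRight, lowerLeft, lowerBoth]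

/-- The tangles in the lower half, for an odd number of half twists in the `p`-box. -/
def lowerOdd : Fin 4 → List Layer := ![lowerMid, lowerRight, lowerLeft, lowerTangle]

/-- The tangles in the upper half, for an even number of half twists in the `q`-box. -/
def upperEven : Fin 4 → List Layer := ![upperMid, upperRight, upperLeft, upperBoth]

/-- The tangles in the upper half, for an odd number of half twists in the `q`-box. -/
def upperOdd : Fin 4 → List Layer := ![upperMid, upperRight, upperLeft, upperTangle]

/-- The values of the planar diagrams. -/
def planarExponent : Fin 4 → Fin 4 → ℕ := ![![1, 2, 2, 3], ![2, 3, 1, 2], ![2, 1, 3, 2], ![3, 2, 2, 1]]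

/-- Values for even numbers of half twists in the boxes. -/
noncomputable def tableEvenEven (i j : Fin 4) : Coeff := cD ^ planarExponent i j

/-- Values for an odd number of half twists in the `p`-box. -/
noncomputable def tableOddEven (i j : Fin 4) : Coeff :=
  if i = 3 then ![cA * cD, cAinv * cD ^ 2 + cz * cD, cA * cD ^ 2, cA * cD] j
  else tableEvenEven i j

/-- Values for an odd number of half twists in the `q`-box. -/
noncomputable def tableEvenOdd (i j : Fin 4) : Coeff :=
  if j = 3 then ![cA * cD, cA * cD ^ 2, cAinv * cD ^ 2 + cz * cD, cAinv * cD + cz * cD ^ 2] i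
  else tableEvenEven i j

/-- Values for odd numbers of half twists in the boxes. -/
noncomputable def tableOddOdd (i j : Fin 4) : Coeff :=
  if i = 3 then if j = 3 then cD ^ 3 + cphi * cD ^ 2 else tableOddEven i j else tableEvenOdd i j

theorem ev_even_even (i j : Fin 4) :
    ev [] (joinHalves (lowerEven i) (upperEven j)) = tableEvenEven i j • ev [] [] := by
  fin_cases i <;> fin_cases j <;> exact ev_planar rfl rfl

/-- The first three lower tangles are the same for both parities, so only the last row is new. -/
theorem ev_odd_even (i j : Fin 4) :
    ev [] (joinHalves (lowerOdd i) (upperEven j)) = tableOddEven i j • ev [] [] := by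
  rcases Fin.eq_castSucc_or_eq_last i with ⟨i, rfl⟩ | rfl
  · have h : lowerOdd i.castSucc = lowerEven i.castSucc := by fin_cases i <;> rfl
    have h' : i.castSucc ≠ 3 := (Fin.castSucc_lt_last i).ne
    rw [h, tableOddEven, if_neg h', ev_even_even]
  · have h := ev_tangle_mid
    have h' := ev_tangle_both
    have h'' := ev_tangle_right
    rw [pow_one] at h h' h''
    fin_cases j
    · exact h
    · exact h''
    · exact ev_tangle_left
    · exact h'

theorem ev_even_odd (i j : Fin 4) :
    ev [] (joinHalves (lowerEven i) (upperOdd j)) = tableEvenOdd i j • ev [] [] := by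
  rcases Fin.eq_castSucc_or_eq_last j with ⟨j, rfl⟩ | rfl
  · have h : upperOdd j.castSucc = upperEven j.castSucc := by fin_cases j <;> rfl
    have h' : j.castSucc ≠ 3 := (Fin.castSucc_lt_last j).ne
    rw [h, tableEvenOdd, if_neg h', ev_even_even]
  · have h := ev_mid_tangle
    have h' := ev_left_tangle
    have h'' := ev_both_tangle
    rw [pow_one] at h h' h''
    fin_cases i
    · exact h
    · exact ev_right_tangle
    · exact h'
    · exact h''

theorem ev_odd_odd (i j : Fin 4) :
    ev [] (joinHalves (lowerOdd i) (upperOdd j)) = tableOddOdd i j • ev [] [] := by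
  rcases Fin.eq_castSucc_or_eq_last i with ⟨i, rfl⟩ | rfl
  · have h : lowerOdd i.castSucc = lowerEven i.castSucc := by fin_cases i <;> rfl
    have h' : i.castSucc ≠ 3 := (Fin.castSucc_lt_last i).ne
    rw [h, tableOddOdd, if_neg h', ev_even_odd]
  · rcases Fin.eq_castSucc_or_eq_last j with ⟨j, rfl⟩ | rfl
    · have h : upperOdd j.castSucc = upperEven j.castSucc := by fin_cases j <;> rfl
      have h' : j.castSucc ≠ 3 := (Fin.castSucc_lt_last j).ne
      rw [h, tableOddOdd, if_pos (show Fin.last 3 = 3 from rfl), if_neg h', ev_odd_even]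
    · exact ev_tangle_tangle

theorem endOrientation_lowerEven (i : Fin 4) :
    endOrientation (lowerEven i) [false, true] = some [false, true, false, true] := by
  fin_cases i <;> rfl

theorem endOrientation_lowerOdd (i : Fin 4) :
    endOrientation (lowerOdd i) [false, true] = some [false, true, false, true] := by
  fin_cases i <;> rfl

theorem endOrientation_upperEven (i : Fin 4) :
    endOrientation (upperEven i) [true, false, true, false] = some [true, false] := by
  fin_cases i <;> rfl

theorem endOrientation_upperOdd (i : Fin 4) :
    endOrientation (upperOdd i) [true, false, true, false] = some [true, false] := by
  fin_cases i <;> rfl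

/-- The tangle of a box without locks and with no half twist or one. -/
def halfTwist (even : Bool) : List Layer := if even then [] else [.cross 0 false]

section Chains

variable {X X' Y Y' : List Layer}

theorem sum_lowerEven {a c a' c' : Coeff}
    (hX : endOrientation X [false, true] = some [false, true])
    (hX' : endOrientation X' [false, true] = some [false, true])
    (h : ev [false, true] X = a • ev [false, true] [] + c • ev [false, true] [.cap 0, .cup 0 false])
    (h' : ev [false, true] X' =
      a' • ev [false, true] [] + c' • ev [false, true] [.cap 0, .cup 0 false]) :
    ev [false, true] (lowerHalf true X X' []) =
      ∑ i, ![a * a', a * c', c * a', c * c'] i • ev [false, true] (lowerEven i) := by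
  rw [ev_lowerHalf_even hX hX' h h', Fin.sum_univ_four]
  rfl

theorem sum_upperEven {a c a' c' : Coeff}
    (hY : endOrientation Y [true, false] = some [true, false])
    (hY' : endOrientation Y' [true, false] = some [true, false])
    (h : ev [true, false] Y = a • ev [true, false] [] + c • ev [true, false] [.cap 0, .cup 0 true])
    (h' : ev [true, false] Y' =
      a' • ev [true, false] [] + c' • ev [true, false] [.cap 0, .cup 0 true]) :
    ev [true, false, true, false] (upperHalf [] Y Y') =
      ∑ i, ![a * a', a * c', c * a', c * c'] i • ev [true, false, true, false] (upperEven i) := by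
  rw [ev_upperHalf_even hY hY' h h', Fin.sum_univ_four]
  rfl

theorem sum_lowerOdd {a c a' c' : Coeff}
    (hX : endOrientation X [false, false] = some [false, false])
    (hX' : endOrientation X' [true, true] = some [true, true])
    (h : ev [false, false] X =
      a • ev [false, false] [] + c • ev [false, false] [.cross 0 false])
    (h' : ev [true, true] X' = a' • ev [true, true] [] + c' • ev [true, true] [.cross 0 true]) :
    ev [false, true] (lowerHalf false X X' [.cross 0 false]) =
      ∑ i, ![a * a' * cA + a * c' * cphi, a * c', c * a', c * c'] i •
        ev [false, true] (lowerOdd i) := by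
  rw [ev_lowerHalf_odd hX hX' h h', Fin.sum_univ_four]
  rfl

theorem sum_upperOdd {a c a' c' : Coeff}
    (hY : endOrientation Y [true, true] = some [true, true])
    (hY' : endOrientation Y' [false, false] = some [false, false])
    (h : ev [true, true] Y = a • ev [true, true] [] + c • ev [true, true] [.cross 0 true])
    (h' : ev [false, false] Y' =
      a' • ev [false, false] [] + c' • ev [false, false] [.cross 0 false]) :
    ev [true, false, true, false] (upperHalf [.cross 0 false] Y Y') =
      ∑ i, ![a * a' * cA + c * a' * cphi, a * c', c * a', c * c'] i •
        ev [true, false, true, false] (upperOdd i) := by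
  rw [ev_upperHalf_odd hY hY' h h', Fin.sum_univ_four]
  rfl

end Chains

/-- Every diagram with at most one half twist in each box has a value. -/
theorem exists_ev_boxDiagram_halfTwist {n m : ℕ} (hn : Even n) (hm : Even m) (s t p p' : Bool) :
    ∃ c : Coeff, ev [] (boxDiagram p (List.replicate n (.cross 0 s))
      (List.replicate n (.cross 0 (!s))) (List.replicate m (.cross 0 t))
      (List.replicate m (.cross 0 (!t))) (halfTwist p) (halfTwist p')) = c • ev [] [] := by
  have tn := endOrientation_replicate_even hn
  have tm := endOrientation_replicate_even hm
  -- The parity of each box decides whether the chains attached to it are parallel or antiparallel,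
  -- and hence which expansion and which table apply.
  cases p
  · obtain ⟨a, c, h⟩ := exists_ev_replicate_parallel n s false false
    obtain ⟨a', c', h'⟩ := exists_ev_replicate_parallel n (!s) true true
    have hl := sum_lowerOdd (tn _ _ _) (tn _ _ _) h h'
    have tl := endOrientation_lowerHalf (e := false) (U := [.cross 0 false]) (tn s false false)
      (tn (!s) true true) rfl
    cases p'
    · obtain ⟨b, d, k⟩ := exists_ev_replicate_parallel m t true true
      obtain ⟨b', d', k'⟩ := exists_ev_replicate_parallel m (!t) false false
      exact ⟨_, ev_joinHalves_sum tl (endOrientation_upperHalf (f := true) rfl (tm _ _ _)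
        (tm _ _ _)) endOrientation_lowerOdd endOrientation_upperOdd hl
        (sum_upperOdd (tm _ _ _) (tm _ _ _) k k') ev_odd_odd⟩
    · obtain ⟨d, k⟩ := exists_ev_replicate_antiparallel hm t true
      obtain ⟨d', k'⟩ := exists_ev_replicate_antiparallel hm (!t) true
      exact ⟨_, ev_joinHalves_sum tl (endOrientation_upperHalf (f := false) rfl (tm _ _ _)
        (tm _ _ _)) endOrientation_lowerOdd endOrientation_upperEven hl
        (sum_upperEven (tm _ _ _) (tm _ _ _) k k') ev_odd_even⟩
  · obtain ⟨c, h⟩ := exists_ev_replicate_antiparallel hn s false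
    obtain ⟨c', h'⟩ := exists_ev_replicate_antiparallel hn (!s) false
    have hl := sum_lowerEven (tn _ _ _) (tn _ _ _) h h'
    have tl := endOrientation_lowerHalf (e := true) (U := []) (tn s false true)
      (tn (!s) false true) rfl
    cases p'
    · obtain ⟨b, d, k⟩ := exists_ev_replicate_parallel m t true true
      obtain ⟨b', d', k'⟩ := exists_ev_replicate_parallel m (!t) false false
      exact ⟨_, ev_joinHalves_sum tl (endOrientation_upperHalf (f := true) rfl (tm _ _ _)
        (tm _ _ _)) endOrientation_lowerEven endOrientation_upperOdd hl
        (sum_upperOdd (tm _ _ _) (tm _ _ _) k k') ev_even_odd⟩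
    · obtain ⟨d, k⟩ := exists_ev_replicate_antiparallel hm t true
      obtain ⟨d', k'⟩ := exists_ev_replicate_antiparallel hm (!t) true
      exact ⟨_, ev_joinHalves_sum tl (endOrientation_upperHalf (f := false) rfl (tm _ _ _)
        (tm _ _ _)) endOrientation_lowerEven endOrientation_upperEven hl
        (sum_upperEven (tm _ _ _) (tm _ _ _) k k') ev_even_even⟩

/-- For the usual four locks, the two diagrams with one half twist have the same value. -/
theorem exists_ev_boxDiagram_oneTwist :
    ∃ c c' : Coeff, laurentToField c = laurentToField c' ∧
      ev [] (boxDiagram false (List.replicate 2 (.cross 0 true)) (List.replicate 2 (.cross 0 false))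
        (List.replicate 2 (.cross 0 true)) (List.replicate 2 (.cross 0 false))
        (halfTwist false) (halfTwist true)) = c • ev [] [] ∧
      ev [] (boxDiagram true (List.replicate 2 (.cross 0 true)) (List.replicate 2 (.cross 0 false))
        (List.replicate 2 (.cross 0 true)) (List.replicate 2 (.cross 0 false))
        (halfTwist true) (halfTwist false)) = c' • ev [] [] := by
  -- The tables use a fixed crossing on each parallel pair. In `h₁` and `h₂` the chain consists of
  -- the inverse crossing, which the skein relation converts; hence the terms `cz * cz`.
  have h₁ : ev [false, false] [.cross 0 true, .cross 0 true] =
      (1 + cz * cz) • ev [false, false] [] + cz • ev [false, false] [.cross 0 false] := by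
    rw [ev_cross_cross_parallel, ev_cross_parallel false true, skeinCoeff, if_pos rfl, smul_add,
      smul_smul, smul_smul, mul_one, add_smul, add_assoc]
    rfl
  have h₂ : ev [true, true] [.cross 0 false, .cross 0 false] =
      (1 + cz * cz) • ev [true, true] [] + (-cz) • ev [true, true] [.cross 0 true] := by
    rw [ev_cross_cross_parallel, ev_cross_parallel true false, skeinCoeff, smul_add,
      smul_smul, smul_smul, mul_one, add_smul, add_assoc, if_neg Bool.false_ne_true, neg_mul_neg]
    rfl
  have h₃ : ev [true, true] [.cross 0 true, .cross 0 true] =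
      (1 : Coeff) • ev [true, true] [] + cz • ev [true, true] [.cross 0 true] :=
    ev_cross_cross_parallel true true
  have h₄ : ev [false, false] [.cross 0 false, .cross 0 false] =
      (1 : Coeff) • ev [false, false] [] + (-cz) • ev [false, false] [.cross 0 false] :=
    ev_cross_cross_parallel false false
  refine ⟨_, _, ?_, ev_joinHalves_sum (endOrientation_lowerHalf rfl rfl rfl)
    (endOrientation_upperHalf (f := false) rfl rfl rfl)
    endOrientation_lowerOdd endOrientation_upperEven (sum_lowerOdd rfl rfl h₁ h₂)
    (sum_upperEven rfl rfl (ev_untwist_untwist true) (ev_twist_twist true)) ev_odd_even,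
    ev_joinHalves_sum (endOrientation_lowerHalf rfl rfl rfl)
    (endOrientation_upperHalf (f := true) rfl rfl rfl)
    endOrientation_lowerEven endOrientation_upperOdd
    (sum_lowerEven rfl rfl (ev_untwist_untwist false) (ev_twist_twist false))
    (sum_upperOdd rfl rfl h₃ h₄) ev_even_odd⟩
  -- Both values are explicit sums over the tables; their equality is an identity of rational
  -- functions in `A` and `z = q - q⁻¹`.
  have hA := A_ne_zero
  have hz := q_sub_inv_ne_zero
  simp only [Fin.sum_univ_four, tableOddEven, tableEvenOdd, tableEvenEven, planarExponent]
  simp [laurentToField_cphi, laurentToField_cphiBar, phi, phiBar, dimD]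
  generalize q - q⁻¹ = z at hz
  field_simp
  ring

/-! ## Orientations and writhes of composite words -/

theorem Layer.sign_shift {L : Layer} {o o' : List Bool} (h : L.next o = some o')
    (p r : List Bool) : (L.shift p.length).sign (p ++ o ++ r) = L.sign o := by
  cases L with
  | cup i b => rfl
  | cap i => rfl
  | cross i s =>
    simp only [Layer.next] at h
    rcases hd : o.drop i with _ | ⟨o₁, _ | ⟨o₂, t⟩⟩
    · simp [hd] at h
    · simp [hd] at h
    · have hi : i ≤ o.length := by
        by_contra hc
        rw [List.drop_eq_nil_of_le (by omega)] at hd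
        simp at hd
      have e : (p ++ o ++ r).drop (p.length + i) = o₁ :: o₂ :: (t ++ r) := by
        rw [List.append_assoc, ← List.drop_drop, List.drop_left, List.drop_append_of_le_length hi, hd]
        rfl
      simp only [Layer.shift, Layer.sign, e, hd]

/-- The word `w` goes from the orientations `o` to `o'` and has writhe `k`. -/
def HasWrithe (w : List Layer) (o o' : List Bool) (k : ℤ) : Prop :=
  endOrientation w o = some o' ∧ writheFrom w o = k

theorem hasWrithe_nil (o : List Bool) : HasWrithe [] o o 0 := ⟨rfl, rfl⟩

theorem hasWrithe_cons {L : Layer} {w : List Layer} {o o' o'' : List Bool} {k : ℤ}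
    (h : L.next o = some o') (hw : HasWrithe w o' o'' k) :
    HasWrithe (L :: w) o o'' (L.sign o + k) := by
  refine ⟨?_, ?_⟩
  · rw [endOrientation, h]; exact hw.1
  · rw [writheFrom, h, ← hw.2]; rfl

theorem HasWrithe.append {w w' : List Layer} {o o' o'' : List Bool} {k k' : ℤ}
    (h : HasWrithe w o o' k) (h' : HasWrithe w' o' o'' k') :
    HasWrithe (w ++ w') o o'' (k + k') := by
  induction w generalizing o k with
  | nil =>
    obtain ⟨h₁, rfl⟩ := h
    obtain rfl : o = o' := Option.some.inj h₁
    simpa [writheFrom] using h'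
  | cons L w ih =>
    obtain ⟨h₁, rfl⟩ := h
    rw [endOrientation, Option.bind_eq_some_iff] at h₁
    obtain ⟨o₁, hL, h₁⟩ := h₁
    rw [writheFrom, hL, Option.map_some, Option.getD_some, add_assoc]
    exact hasWrithe_cons hL (ih ⟨h₁, rfl⟩)

theorem HasWrithe.shift {w : List Layer} {o o' : List Bool} {k : ℤ} (h : HasWrithe w o o' k)
    (p r : List Bool) :
    HasWrithe (KanenobuHomfly.shift p.length w) (p ++ o ++ r) (p ++ o' ++ r) k := by
  induction w generalizing o k with
  | nil =>
    obtain ⟨h₁, rfl⟩ := h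
    obtain rfl : o = o' := Option.some.inj h₁
    exact hasWrithe_nil _
  | cons L w ih =>
    obtain ⟨h₁, rfl⟩ := h
    rw [endOrientation, Option.bind_eq_some_iff] at h₁
    obtain ⟨o₁, hL, h₁⟩ := h₁
    rw [writheFrom, hL, Option.map_some, Option.getD_some, ← Layer.sign_shift hL p r]
    exact hasWrithe_cons (Layer.next_shift hL p r) (ih ⟨h₁, rfl⟩)

/-- An opposite vertical lock contributes `-2` to the writhe but `+2` to `crossingNumber`. This is
why each lock produces `A ^ 4` in the final formulas. -/
theorem hasWrithe_boxLayers (o : Bool) (u : List Piece) :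
    HasWrithe (boxLayers 0 o u) [o, !o] [boxEnd o u, !boxEnd o u]
      (twistNumber u - 2 * lockNumber u) := by
  refine ⟨endOrientation_boxLayers o u, ?_⟩
  induction u generalizing o with
  | nil => rfl
  | cons a u ih =>
    have h := ih (!o)
    rw [Bool.not_not] at h
    cases a
    · rw [boxLayers, writheFrom, twistNumber]
      have e : (Layer.cross 0 false).sign [o, !o] = 1 := by cases o <;> rfl
      have e' : (Layer.cross 0 false).next [o, !o] = some [!o, o] := rfl
      have e'' : lockNumber (.twist :: u) = lockNumber u := rfl
      rw [e, e', e'', Option.map_some, Option.getD_some, h]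
      ring
    · rw [boxLayers, writheFrom, twistNumber]
      have e : (Layer.cross 0 true).sign [o, !o] = -1 := by cases o <;> rfl
      have e' : (Layer.cross 0 true).next [o, !o] = some [!o, o] := rfl
      have e'' : lockNumber (.untwist :: u) = lockNumber u := rfl
      rw [e, e', e'', Option.map_some, Option.getD_some, h]
      ring
    · have e : HasWrithe (verticalLock 0 false o) [o, !o] [o, !o] (-2) := by
        cases o <;> exact ⟨rfl, rfl⟩
      rw [boxLayers, (e.append ⟨endOrientation_boxLayers o u, ih o⟩).2, twistNumber, lockNumber]
      push_cast
      ring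

theorem hasWrithe_replicate_even {n : ℕ} (hn : Even n) (s a b : Bool) :
    HasWrithe (List.replicate n (.cross 0 s)) [a, b] [a, b] (n * crossingSign s a b) := by
  obtain ⟨m, rfl⟩ := hn
  induction m with
  | zero => simpa using hasWrithe_nil _
  | succ m ih =>
    have e : HasWrithe [.cross 0 s, .cross 0 s] [a, b] [a, b] (2 * crossingSign s a b) := by
      refine ⟨rfl, ?_⟩
      cases s <;> cases a <;> cases b <;> rfl
    have h := e.append ih
    rw [show m + 1 + (m + 1) = (m + m) + 2 by ring, List.replicate_succ, List.replicate_succ]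
    have e' : ((m + m + 2 : ℕ) : ℤ) * crossingSign s a b =
        2 * crossingSign s a b + ((m + m : ℕ) : ℤ) * crossingSign s a b := by
      push_cast
      ring
    rw [e']
    exact h

/-- The writhe of a composite diagram. -/
theorem hasWrithe_word {e f : Bool} {X X' U V Y Y' : List Layer} {a b x x' y y' : ℤ}
    (hX : HasWrithe X [false, e] [false, e] x)
    (hX' : HasWrithe X' [!e, true] [!e, true] x')
    (hU : HasWrithe U [e, !e] [true, false] a)
    (hV : HasWrithe V [false, true] [f, !f] b)
    (hY : HasWrithe Y [true, f] [true, f] y)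
    (hY' : HasWrithe Y' [!f, false] [!f, false] y') :
    HasWrithe ([.cup 0 true, .cup 1 false, .cup 2 true, .cup 4 e] ++ shift 1 V ++ shift 3 X ++
      shift 5 X' ++ Y ++ shift 2 Y' ++ shift 4 U ++ topCaps) [] []
      (a + b + (x + x') + (y + y')) := by
  have k₁ := hV.shift [true] [false, e, !e, true, false]
  have k₂ := hX.shift [true, f, !f] [!e, true, false]
  have k₃ := hX'.shift [true, f, !f, false, e] [false]
  have k₄ := hY.shift [] [!f, false, e, !e, true, false]
  have k₅ := hY'.shift [true, f] [e, !e, true, false]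
  have k₆ := hU.shift [true, f, !f, false] [true, false]
  have k₀ : HasWrithe [.cup 0 true, .cup 1 false, .cup 2 true, .cup 4 e] []
    [true, false, true, false, e, !e, true, false] 0 := ⟨rfl, rfl⟩
  have k₇ : HasWrithe topCaps [true, f, !f, false, true, false, true, false] [] 0 := by
    cases f <;> exact ⟨rfl, rfl⟩
  simp only [List.length_nil, List.length_cons, shift_zero, List.nil_append,
    List.cons_append, zero_add, Nat.reduceAdd] at k₁ k₂ k₃ k₄ k₅ k₆
  have h := ((((((k₀.append k₁).append k₂).append k₃).append k₄).append k₅).append k₆).append k₇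
  convert h using 1
  ring

/-- The HOMFLY polynomial of a diagram from its value and its writhe. -/
theorem isHomfly_of_ev {w : List Layer} {k : ℤ} {c : Coeff} (h : HasWrithe w [] [] k)
    (hc : ev [] w = c • ev [] []) : IsHomfly w (A ^ (-k) * laurentToField c) := by
  refine ⟨h.1, LaurentPolynomial.T (-k) * c, ?_, fun N _ => ?_⟩
  · rw [map_mul, laurentToField_T]
  · rw [map_mul, specialize_T, topologicalPolynomial, writhe, h.2, verticalPolynomial_of_ev hc]

/-! ## The values of the Kanenobu diagrams -/

theorem shift_twistLayers (i : ℕ) (t : ℤ) : twistLayers i t = shift i (twistLayers 0 t) := by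
  rw [twistLayers, twistLayers, shift_replicate, add_zero]

/-- The two chains of a row. -/
theorem exists_twistLayers (j : ℤ) : ∃ (n : ℕ) (s : Bool), Even n ∧
    twistLayers 0 (-2 * j) = List.replicate n (.cross 0 s) ∧
    twistLayers 0 (2 * j) = List.replicate n (.cross 0 (!s)) := by
  refine ⟨(2 * j).natAbs, decide (-2 * j < 0), ?_, ?_, ?_⟩
  · simp [Int.natAbs_mul]
  · rw [twistLayers, neg_mul, Int.natAbs_neg]
  -- For `j = 0` the two slashes are not opposite, but there are no crossings to carry them.
  · rcases eq_or_ne j 0 with rfl | hj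
    · rfl
    · have : decide (2 * j < 0) = !decide (-2 * j < 0) := by
        rw [← decide_not, decide_eq_decide]
        omega
      rw [twistLayers, this]

theorem boxEnd_decide (u : List Piece) : boxEnd (decide (Even (twistNumber u))) u = true := by
  by_cases h : Even (twistNumber u) <;> simp [boxEnd, h]

theorem halfTwist_decide (u : List Piece) :
    halfTwist (decide (Even (twistNumber u))) = boxParity u := by
  by_cases h : Even (twistNumber u) <;> simp [halfTwist, boxParity, h]

theorem hasWrithe_boxLayers_decide (u : List Piece) :
    HasWrithe (boxLayers 0 (decide (Even (twistNumber u))) u)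
      [decide (Even (twistNumber u)), !decide (Even (twistNumber u))] [true, false]
      (twistNumber u - 2 * lockNumber u) := by
  have h := hasWrithe_boxLayers (decide (Even (twistNumber u))) u
  rwa [boxEnd_decide] at h

/-- The two pairs of strands are both parallel or both antiparallel, and the slashes are opposite.
The chains of a row therefore do not contribute to the writhe. -/
theorem crossingSign_cancel (n : ℕ) (s e : Bool) :
    (n : ℤ) * crossingSign s false e + n * crossingSign (!s) (!e) true = 0 := by
  cases s <;> cases e <;> simp [crossingSign, isPositive]

theorem crossingSign_cancel' (n : ℕ) (s f : Bool) :
    (n : ℤ) * crossingSign s true f + n * crossingSign (!s) (!f) false = 0 := by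
  cases s <;> cases f <;> simp [crossingSign, isPositive]

theorem kanGen_eq (u v : List Piece) (j i : ℤ) : kanGen u v j i =
    [.cup 0 true, .cup 1 false, .cup 2 true, .cup 4 (decide (Even (twistNumber u)))] ++
      shift 1 (boxLayers 0 false v) ++ shift 3 (twistLayers 0 (-2 * j)) ++
      shift 5 (twistLayers 0 (2 * j)) ++ twistLayers 0 (-2 * i) ++
      shift 2 (twistLayers 0 (2 * i)) ++
      shift 4 (boxLayers 0 (decide (Even (twistNumber u))) u) ++ topCaps := by
  rw [kanGen, lowerPart, ← shift_boxLayers, ← shift_boxLayers, ← shift_twistLayers,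
    ← shift_twistLayers, ← shift_twistLayers]

theorem hasWrithe_kanGen (u v : List Piece) (j i : ℤ) :
    HasWrithe (kanGen u v j i) [] []
      (twistNumber u - 2 * lockNumber u + (twistNumber v - 2 * lockNumber v)) := by
  obtain ⟨n, s, hn, e₁, e₂⟩ := exists_twistLayers j
  obtain ⟨m, t, hm, e₃, e₄⟩ := exists_twistLayers i
  rw [kanGen_eq, e₁, e₂, e₃, e₄]
  have h := hasWrithe_word (hasWrithe_replicate_even hn s _ _) (hasWrithe_replicate_even hn (!s) _ _)
    (hasWrithe_boxLayers_decide u) (hasWrithe_boxLayers false v)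
    (hasWrithe_replicate_even hm t _ _) (hasWrithe_replicate_even hm (!t) _ _)
  rwa [crossingSign_cancel, crossingSign_cancel', add_zero, add_zero] at h

/-- All dependence on the chains is in `c`; the terms with a turnback do not see them, because the
chains cancel around nested cups and caps. -/
theorem ev_kanGen_eq {u v : List Piece} {j i : ℤ} {n m : ℕ} {s t : Bool} (hn : Even n) (hm : Even m)
    (e₁ : twistLayers 0 (-2 * j) = List.replicate n (.cross 0 s))
    (e₂ : twistLayers 0 (2 * j) = List.replicate n (.cross 0 (!s)))
    (e₃ : twistLayers 0 (-2 * i) = List.replicate m (.cross 0 t))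
    (e₄ : twistLayers 0 (2 * i) = List.replicate m (.cross 0 (!t))) {c : Coeff}
    (hc : ev [] (boxDiagram (decide (Even (twistNumber u))) (List.replicate n (.cross 0 s))
      (List.replicate n (.cross 0 (!s))) (List.replicate m (.cross 0 t))
      (List.replicate m (.cross 0 (!t))) (halfTwist (decide (Even (twistNumber u))))
      (halfTwist (decide (Even (twistNumber v))))) = c • ev [] []) :
    ev [] (kanGen u v j i) =
      (cphiBar ^ (lockNumber v + lockNumber u) * c +
        cphiBar ^ lockNumber u * boxCoeff v *
          ((if Even (twistNumber u) then 1 else cA) * cD ^ 2) +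
        cphiBar ^ lockNumber v * boxCoeff u *
          ((if Even (twistNumber v) then 1 else cA) * cD ^ 2) +
        boxCoeff u * boxCoeff v * (cD * cD ^ 2)) • ev [] [] := by
  have tn := endOrientation_replicate_even hn
  have tm := endOrientation_replicate_even hm
  set e := decide (Even (twistNumber u)) with he
  have hb : boxEnd e u = true := boxEnd_decide u
  have hXX := ev_nested_cups_twists n false e s
  have hYY := ev_nested_caps_twists m true (boxEnd false v) t
  have hfm (a b : Bool) : flip m a b = a := if_pos hm
  simp only [flip, if_pos hn] at hXX
  rw [hfm, hfm, hfm, hfm] at hYY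
  rw [halfTwist_decide, he, halfTwist_decide, ← he] at hc
  obtain ⟨h₂, h₃, h₄⟩ := ev_boxDiagram_turnbacks (u := u) (v := v) hb rfl (tn s false e)
    (tn (!s) (!e) true) (tm t true _) (tm (!t) _ false)
    (by rw [shift_replicate, add_zero]; exact hXX) (by rw [shift_replicate, add_zero]; exact hYY)
  have hw := ev_joinHalves (tn s false e) (tn (!s) (!e) true)
    (hasWrithe_boxLayers_decide u).1 (endOrientation_boxLayers false v) (tm t true _)
    (tm (!t) _ false)
  rw [kanGen_eq, e₁, e₂, e₃, e₄]
  refine hw.trans ?_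
  exact ev_boxDiagram_boxes hb rfl (tn s false e) (tn (!s) (!e) true) (tm t true _)
    (tm (!t) _ false) hc h₂ h₃ h₄

/-- The value of a generalised Kanenobu diagram. -/
theorem exists_ev_kanGen (p p' : Bool) (j i : ℤ) : ∃ c : Coeff, ∀ u v : List Piece,
    decide (Even (twistNumber u)) = p → decide (Even (twistNumber v)) = p' →
    ev [] (kanGen u v j i) =
      (cphiBar ^ (lockNumber v + lockNumber u) * c +
        cphiBar ^ lockNumber u * boxCoeff v * ((if p then 1 else cA) * cD ^ 2) +
        cphiBar ^ lockNumber v * boxCoeff u * ((if p' then 1 else cA) * cD ^ 2) +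
        boxCoeff u * boxCoeff v * (cD * cD ^ 2)) • ev [] [] := by
  obtain ⟨n, s, hn, e₁, e₂⟩ := exists_twistLayers j
  obtain ⟨m, t, hm, e₃, e₄⟩ := exists_twistLayers i
  -- The constant is fixed by the parities and the chains before the boxes are introduced, so it is
  -- common to all boxes of these parities.
  obtain ⟨c, hc⟩ := exists_ev_boxDiagram_halfTwist hn hm s t p p'
  refine ⟨c, ?_⟩
  rintro u v rfl rfl
  have h := ev_kanGen_eq hn hm e₁ e₂ e₃ e₄ hc
  simp only [decide_eq_true_eq]
  exact h

/-! ## The deformed diagrams -/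

theorem ev_planar_turn : ∀ i : Fin 4,
    ev [] (joinHalves (lowerEven i) upperTurn) = cD ^ (![2, 1, 1, 2] i : ℕ) • ev [] [] ∧
    ev [] (joinHalves lowerTurn (upperEven i)) = cD ^ (![2, 1, 1, 2] i : ℕ) • ev [] [] := by
  intro i
  fin_cases i <;> exact ⟨ev_planar rfl rfl, ev_planar rfl rfl⟩

theorem ev_turn_turn : ev [] (joinHalves lowerTurn upperTurn) = cD ^ 3 • ev [] [] :=
  ev_planar rfl rfl

/-- The cap of the turnback in the box merges three of the four products into multiples of one
tangle: no chain turns back (a circle splits off), or exactly one does. -/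
theorem sum_lowerTurn {X X' : List Layer} {a c a' c' : Coeff}
    (hX : endOrientation X [false, true] = some [false, true])
    (hX' : endOrientation X' [false, true] = some [false, true])
    (h : ev [false, true] X = a • ev [false, true] [] + c • ev [false, true] [.cap 0, .cup 0 false])
    (h' : ev [false, true] X' =
      a' • ev [false, true] [] + c' • ev [false, true] [.cap 0, .cup 0 false]) :
    ev [false, true] (lowerHalf true X X' [.cap 0, .cup 0 true]) =
      ∑ i, ![a * a' * cD + a * c' + c * a', c * c'] i •
        ev [false, true] (![lowerMid, lowerTurn] i) := by
  have e₁ : ev [false, true] (lowerHalf true [] [] [.cap 0, .cup 0 true]) =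
      cD • ev [false, true] lowerMid := ev_step1 0 1 (ev_circle true)
  have e₂ : ev [false, true] (lowerHalf true [] [.cap 0, .cup 0 false] [.cap 0, .cup 0 true]) =
      ev [false, true] lowerMid := ev_eq_of_simplify rfl rfl rfl
  have e₃ : ev [false, true] (lowerHalf true [.cap 0, .cup 0 false] [] [.cap 0, .cup 0 true]) =
      ev [false, true] lowerMid := ev_eq_of_simplify rfl rfl rfl
  have e₄ : ev [false, true] (lowerHalf true [.cap 0, .cup 0 false] [.cap 0, .cup 0 false]
      [.cap 0, .cup 0 true]) = ev [false, true] lowerTurn := ev_eq_of_simplify rfl rfl rfl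
  rw [ev_lowerHalf_expand (e := true) hX rfl rfl hX' rfl rfl h h', e₁, e₂, e₃, e₄, smul_smul,
    Fin.sum_univ_two, ← add_smul, ← add_smul]
  rfl

theorem sum_upperTurn {Y Y' : List Layer} {a c a' c' : Coeff}
    (hY : endOrientation Y [true, false] = some [true, false])
    (hY' : endOrientation Y' [true, false] = some [true, false])
    (h : ev [true, false] Y = a • ev [true, false] [] + c • ev [true, false] [.cap 0, .cup 0 true])
    (h' : ev [true, false] Y' =
      a' • ev [true, false] [] + c' • ev [true, false] [.cap 0, .cup 0 true]) :
    ev [true, false, true, false] (upperHalf [.cap 0, .cup 0 false] Y Y') =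
      ∑ i, ![a * a' * cD + a * c' + c * a', c * c'] i •
        ev [true, false, true, false] (![upperMid, upperTurn] i) := by
  have e₁ : ev [true, false, true, false] (upperHalf [.cap 0, .cup 0 false] [] []) =
      cD • ev [true, false, true, false] upperMid := ev_step1 1 1 (ev_circle false)
  have e₂ : ev [true, false, true, false] (upperHalf [.cap 0, .cup 0 false] []
      [.cap 0, .cup 0 true]) = ev [true, false, true, false] upperMid :=
    ev_eq_of_simplify rfl rfl rfl
  have e₃ : ev [true, false, true, false] (upperHalf [.cap 0, .cup 0 false]
      [.cap 0, .cup 0 true] []) = ev [true, false, true, false] upperMid :=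
    ev_eq_of_simplify rfl rfl rfl
  have e₄ : ev [true, false, true, false] (upperHalf [.cap 0, .cup 0 false]
      [.cap 0, .cup 0 true] [.cap 0, .cup 0 true]) =
      ev [true, false, true, false] upperTurn := ev_eq_of_simplify rfl rfl rfl
  rw [ev_upperHalf_expand (f := false) rfl hY rfl rfl hY' rfl rfl h h', e₁, e₂, e₃, e₄,
    smul_smul, Fin.sum_univ_two, ← add_smul, ← add_smul]
  rfl

/-- The tangles in the lower half with a turnback in the `p`-box. -/
def lowerTurns : Fin 2 → List Layer := ![lowerMid, lowerTurn]

/-- The tangles in the upper half with a turnback in the `q`-box. -/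
def upperTurns : Fin 2 → List Layer := ![upperMid, upperTurn]

theorem endOrientation_lowerTurns (i : Fin 2) :
    endOrientation (lowerTurns i) [false, true] = some [false, true, false, true] := by
  fin_cases i <;> rfl

theorem endOrientation_upperTurns (i : Fin 2) :
    endOrientation (upperTurns i) [true, false, true, false] = some [true, false] := by
  fin_cases i <;> rfl

/-- Values of the planar diagrams with a turnback in one box. -/
noncomputable def tableTurn (i : Fin 4) : Fin 2 → Coeff :=
  ![cD ^ planarExponent i 0, cD ^ (![2, 1, 1, 2] i : ℕ)]

theorem ev_even_turn (i : Fin 4) (j : Fin 2) :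
    ev [] (joinHalves (lowerEven i) (upperTurns j)) = tableTurn i j • ev [] [] := by
  fin_cases j
  · exact ev_even_even i 0
  · exact (ev_planar_turn i).1

theorem ev_turn_even (i : Fin 2) (j : Fin 4) :
    ev [] (joinHalves (lowerTurns i) (upperEven j)) = tableTurn j i • ev [] [] := by
  fin_cases i
  · refine (ev_even_even 0 j).trans ?_
    fin_cases j <;> rfl
  · exact (ev_planar_turn j).2

theorem ev_turns_turns (i j : Fin 2) :
    ev [] (joinHalves (lowerTurns i) (upperTurns j)) =
      cD ^ ((i : ℕ) + (j : ℕ) + 1) • ev [] [] := by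
  fin_cases i <;> fin_cases j
  · exact ev_planar rfl rfl
  · exact ev_planar rfl rfl
  · exact ev_planar rfl rfl
  · exact ev_turn_turn

/-- The values of the deformed diagram, with empty boxes and with turnbacks in the boxes. -/
theorem exists_ev_deformed : ∃ c₁ c₂ c₃ c₄ : Coeff,
    laurentToField c₂ = doubleBraidP ∧ laurentToField c₃ = deformedP ∧
    laurentToField c₄ = doubleBraidP * dimD ∧
    ev [] (boxDiagram true (List.replicate 2 (.cross 0 true)) (List.replicate 2 (.cross 0 false))
      (verticalLock 0 true true) (List.replicate 2 (.cross 0 false)) [] []) = c₁ • ev [] [] ∧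
    ev [] (boxDiagram true (List.replicate 2 (.cross 0 true)) (List.replicate 2 (.cross 0 false))
      (verticalLock 0 true true) (List.replicate 2 (.cross 0 false)) []
      [.cap 0, .cup 0 false]) = c₂ • ev [] [] ∧
    ev [] (boxDiagram true (List.replicate 2 (.cross 0 true)) (List.replicate 2 (.cross 0 false))
      (verticalLock 0 true true) (List.replicate 2 (.cross 0 false)) [.cap 0, .cup 0 true]
      []) = c₃ • ev [] [] ∧
    ev [] (boxDiagram true (List.replicate 2 (.cross 0 true)) (List.replicate 2 (.cross 0 false))
      (verticalLock 0 true true) (List.replicate 2 (.cross 0 false)) [.cap 0, .cup 0 true]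
      [.cap 0, .cup 0 false]) = c₄ • ev [] [] := by
  have h₁ := ev_untwist_untwist false
  have h₂ := ev_twist_twist false
  -- The identity comes first in the sums over tangles. For a vertical lock its coefficient is `φ`,
  -- and that of the turnback is `1`.
  have h₃ := ev_verticalLock.trans (add_comm _ _)
  have h₄ := ev_twist_twist true
  have l : endOrientation (lowerHalf true (List.replicate 2 (.cross 0 true))
      (List.replicate 2 (.cross 0 false)) []) [false, true] = some [false, true, false, true] := rfl
  have l' : endOrientation (lowerHalf true (List.replicate 2 (.cross 0 true))
      (List.replicate 2 (.cross 0 false)) [.cap 0, .cup 0 true]) [false, true] =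
      some [false, true, false, true] := rfl
  have r : endOrientation (upperHalf [] (verticalLock 0 true true)
      (List.replicate 2 (.cross 0 false))) [true, false, true, false] = some [true, false] := rfl
  have r' : endOrientation (upperHalf [.cap 0, .cup 0 false] (verticalLock 0 true true)
      (List.replicate 2 (.cross 0 false))) [true, false, true, false] = some [true, false] := rfl
  refine ⟨_, _, _, _, ?_, ?_, ?_,
    ev_joinHalves_sum l r endOrientation_lowerEven endOrientation_upperEven
      (sum_lowerEven rfl rfl h₁ h₂) (sum_upperEven rfl rfl h₃ h₄) ev_even_even,
    ev_joinHalves_sum l r' endOrientation_lowerEven endOrientation_upperTurns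
      (sum_lowerEven rfl rfl h₁ h₂) (sum_upperTurn rfl rfl h₃ h₄) ev_even_turn,
    ev_joinHalves_sum l' r endOrientation_lowerTurns endOrientation_upperEven
      (sum_lowerTurn rfl rfl h₁ h₂) (sum_upperEven rfl rfl h₃ h₄) ev_turn_even,
    ev_joinHalves_sum l' r' endOrientation_lowerTurns endOrientation_upperTurns
      (sum_lowerTurn rfl rfl h₁ h₂) (sum_upperTurn rfl rfl h₃ h₄) ev_turns_turns⟩
  -- The three values involving a turnback are compared with the stated polynomials as rational
  -- functions; the value `c₁` for empty boxes needs no closed form.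
  all_goals
    have hA := A_ne_zero
    have hz := q_sub_inv_ne_zero
    simp only [Fin.sum_univ_four, Fin.sum_univ_two, tableTurn, planarExponent, doubleBraidP,
      deformedP]
    simp [laurentToField_cphi, laurentToField_cphiBar, phi, phiBar, dimD]
    generalize q - q⁻¹ = z at hz
    field_simp
    ring

theorem kanDef_eq {u v : List Piece} (hu : Even (twistNumber u)) : kanDef u v =
    [.cup 0 true, .cup 1 false, .cup 2 true, .cup 4 true] ++
      shift 1 (boxLayers 0 false v) ++ shift 3 (List.replicate 2 (.cross 0 true)) ++
      shift 5 (List.replicate 2 (.cross 0 false)) ++ verticalLock 0 true true ++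
      shift 2 (List.replicate 2 (.cross 0 false)) ++ shift 4 (boxLayers 0 true u) ++ topCaps := by
  rw [kanDef, lowerPart, ← shift_boxLayers, ← shift_boxLayers, decide_eq_true hu]
  rfl

/-- The lower chains still cancel, while the vertical lock and the chain beside it have four
positive crossings. This is the origin of the factor `A ^ (-4)`. -/
theorem hasWrithe_kanDef {u v : List Piece} (hu : Even (twistNumber u))
    (hv : Even (twistNumber v)) : HasWrithe (kanDef u v) [] []
      (twistNumber u - 2 * lockNumber u + (twistNumber v - 2 * lockNumber v) + 4) := by
  have k := hasWrithe_boxLayers_decide u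
  rw [decide_eq_true hu] at k
  have k' := hasWrithe_boxLayers false v
  rw [boxEnd, if_pos hv] at k'
  rw [kanDef_eq hu]
  have h := hasWrithe_word (X := List.replicate 2 (.cross 0 true))
    (X' := List.replicate 2 (.cross 0 false)) (Y := verticalLock 0 true true)
    (Y' := List.replicate 2 (.cross 0 false)) (x := -2) (x' := 2) (y := 2) (y' := 2)
    ⟨rfl, rfl⟩ ⟨rfl, rfl⟩ k k' ⟨rfl, rfl⟩ ⟨rfl, rfl⟩
  rwa [neg_add_cancel, add_zero] at h

/-- The value of a deformed diagram. -/
theorem exists_ev_kanDef : ∃ c₁ c₂ c₃ c₄ : Coeff,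
    laurentToField c₂ = doubleBraidP ∧ laurentToField c₃ = deformedP ∧
    laurentToField c₄ = doubleBraidP * dimD ∧ ∀ u v : List Piece,
      Even (twistNumber u) → Even (twistNumber v) → ev [] (kanDef u v) =
        (cphiBar ^ (lockNumber v + lockNumber u) * c₁ + cphiBar ^ lockNumber u * boxCoeff v * c₂ +
          cphiBar ^ lockNumber v * boxCoeff u * c₃ + boxCoeff u * boxCoeff v * c₄) • ev [] [] := by
  obtain ⟨c₁, c₂, c₃, c₄, e₂, e₃, e₄, h₁, h₂, h₃, h₄⟩ := exists_ev_deformed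
  refine ⟨c₁, c₂, c₃, c₄, e₂, e₃, e₄, fun u v hu hv => ?_⟩
  have hb : boxEnd true u = true := if_pos hu
  have hb' : boxEnd false v = false := if_pos hv
  have p : boxParity u = [] := if_pos hu
  have p' : boxParity v = [] := if_pos hv
  have k := (hasWrithe_boxLayers true u).1
  have k' := (hasWrithe_boxLayers false v).1
  rw [hb] at k
  rw [hb'] at k'
  rw [kanDef_eq hu]
  refine (ev_joinHalves (e := true) (f := false) rfl rfl k k' rfl rfl).trans ?_
  exact ev_boxDiagram_boxes hb hb' rfl rfl rfl rfl (by rw [p, p']; exact h₁)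
    (by rw [p]; exact h₂) (by rw [p']; exact h₃) h₄

/-! ## Independence of the variables -/

theorem A_pow_injective : Function.Injective fun n : ℕ => A ^ n := by
  intro m n h
  have h' : algebraMap (Polynomial Kq) KqA (Polynomial.X ^ m) =
      algebraMap (Polynomial Kq) KqA (Polynomial.X ^ n) := by
    simpa [A, RatFunc.algebraMap_X] using h
  simpa using congrArg Polynomial.natDegree (RatFunc.algebraMap_injective Kq h')

theorem A_zpow_injective {m n : ℤ} (h : A ^ m = A ^ n) : m = n := by
  wlog hmn : n ≤ m
  · exact (this h.symm (le_of_not_ge hmn)).symm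
  obtain ⟨d, rfl⟩ := Int.le.dest hmn
  rw [zpow_add₀ A_ne_zero, zpow_natCast, mul_eq_left₀ (zpow_ne_zero _ A_ne_zero)] at h
  have := A_pow_injective (a₁ := d) (a₂ := 0) (by simpa using h)
  omega

/-- Since `A` is transcendental over `ℚ(q)`, no monic quadratic vanishes at it. Clearing
denominators brings `D`, `D + φ̄` and `D ± 1` to this form. -/
theorem A_sq_add_ne_zero (b c : Kq) : A ^ 2 + RatFunc.C b * A + RatFunc.C c ≠ 0 := by
  have h : algebraMap (Polynomial Kq) KqA
      (Polynomial.X ^ 2 + Polynomial.C b * Polynomial.X + Polynomial.C c) =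
      A ^ 2 + RatFunc.C b * A + RatFunc.C c := by
    simp [A, RatFunc.algebraMap_X, RatFunc.algebraMap_C]
  rw [← h]
  refine RatFunc.algebraMap_ne_zero fun h0 => ?_
  simpa [Polynomial.coeff_X, Polynomial.coeff_C] using
    congrArg (fun f => Polynomial.coeff f 2) h0

theorem dimD_ne_zero : dimD ≠ 0 := by
  intro h
  have h' := phi_mul_dimD
  rw [h, mul_zero] at h'
  exact A_sq_add_ne_zero 0 (-1) (by simpa [sub_eq_add_neg] using h'.symm)

theorem phiBar_ne_zero : phiBar ≠ 0 :=
  neg_ne_zero.mpr (mul_ne_zero (inv_ne_zero A_ne_zero) q_sub_inv_ne_zero)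

theorem C_q₀_sub_inv : RatFunc.C (q₀ - q₀⁻¹) = q - q⁻¹ := by
  rw [map_sub, map_inv₀]
  rfl

theorem dimD_add_phiBar_ne_zero : dimD + phiBar ≠ 0 := by
  intro h
  -- With `z = q - q⁻¹`, one has `z A (D + φ̄) = A ^ 2 - 1 - z ^ 2`.
  refine A_sq_add_ne_zero 0 (-(1 + (q₀ - q₀⁻¹) ^ 2)) ?_
  rw [map_neg, map_add, map_pow, C_q₀_sub_inv, map_one, map_zero, zero_mul, add_zero]
  have hA := A_ne_zero
  have hz := q_sub_inv_ne_zero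
  rw [dimD, phiBar] at h
  generalize q - q⁻¹ = z at h hz ⊢
  field_simp at h
  linear_combination h

theorem one_add_sq_ne_zero : 1 + (q - q⁻¹) ^ 2 ≠ 0 := by
  -- This polynomial is `q ^ 2 (1 + (q - q⁻¹) ^ 2)`, and its constant term is `1`.
  have h : algebraMap (Polynomial ℚ) Kq (Polynomial.X ^ 4 - Polynomial.X ^ 2 + 1) ≠ 0 := by
    refine RatFunc.algebraMap_ne_zero fun h0 => ?_
    simpa using congrArg (Polynomial.eval 0) h0
  have e : algebraMap (Polynomial ℚ) Kq (Polynomial.X ^ 4 - Polynomial.X ^ 2 + 1) =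
      q₀ ^ 2 * (1 + (q₀ - q₀⁻¹) ^ 2) := by
    have hq := q₀_ne_zero
    rw [map_add, map_sub, map_pow, map_pow, map_one, RatFunc.algebraMap_X]
    change q₀ ^ 4 - q₀ ^ 2 + 1 = _
    field_simp
    ring
  have h' : 1 + (q₀ - q₀⁻¹) ^ 2 ≠ 0 := right_ne_zero_of_mul (e ▸ h)
  rw [← C_q₀_sub_inv, ← map_pow, ← map_one RatFunc.C, ← map_add]
  exact fun h0 => h' (RatFunc.C.injective (h0.trans (map_zero _).symm))

/-- The factorisation reduces nonvanishing to that of simple factors. -/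
theorem deformedP_sub_doubleBraidP : deformedP - doubleBraidP =
    A ^ 2 * dimD * (1 + (q - q⁻¹) ^ 2) ^ 2 * ((dimD - 1) * (dimD + 1)) := by
  have hA := A_ne_zero
  have hz := q_sub_inv_ne_zero
  rw [deformedP, doubleBraidP, phi, phiBar, dimD]
  generalize q - q⁻¹ = z at hz
  field_simp
  ring

theorem deformedP_ne_doubleBraidP : deformedP - doubleBraidP ≠ 0 := by
  have key (s : ℤ) : dimD + s ≠ 0 := by
    intro h
    -- Here `z A (D + s) = A ^ 2 + s z A - 1` with `z = q - q⁻¹`.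
    refine A_sq_add_ne_zero (s * (q₀ - q₀⁻¹)) (-1) ?_
    rw [map_neg, map_mul, C_q₀_sub_inv, map_one, map_intCast]
    have hA := A_ne_zero
    have hz := q_sub_inv_ne_zero
    rw [dimD] at h
    generalize q - q⁻¹ = z at h hz ⊢
    field_simp at h
    linear_combination h
  rw [deformedP_sub_doubleBraidP]
  refine mul_ne_zero (mul_ne_zero (mul_ne_zero (pow_ne_zero _ A_ne_zero) dimD_ne_zero)
    (pow_ne_zero _ one_add_sq_ne_zero)) (mul_ne_zero ?_ ?_)
  · simpa [sub_eq_add_neg] using key (-1)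
  · simpa using key 1

/-! ## The polynomials `Θ̄` -/

theorem one_add_phi_mul_dimD : 1 + phi * dimD = A ^ (2 : ℤ) := by
  rw [phi_mul_dimD, add_sub_cancel]
  rfl

/-- Dividing by `D` is avoided from here on: `D Θ̄ + φ̄ ^ k` is a product of powers. -/
theorem thetaBar_mul_dimD (n : ℤ) (k : ℕ) : thetaBar n k * dimD =
    (dimD + phiBar) ^ k * A ^ (2 * (n - k)) - phiBar ^ k := by
  rw [thetaBar, div_mul_cancel₀ _ dimD_ne_zero, one_add_phi_mul_dimD, zpow_mul]

theorem thetaBar_zero_zero : thetaBar 0 0 = 0 := by simp [thetaBar]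

/-- The quantity `D Θ̄_{n,k} + φ̄ ^ k = (D + φ̄) ^ k A ^ (2 (n - k))` is multiplicative in `(n, k)`.
Expanding the product of two of them and removing a factor `D` gives the formula. -/
theorem thetaBar_add (n m : ℤ) (k l : ℕ) : thetaBar (n + m) (k + l) =
    phiBar ^ l * thetaBar n k + phiBar ^ k * thetaBar m l + thetaBar n k * thetaBar m l * dimD := by
  apply mul_right_cancel₀ dimD_ne_zero
  have h := thetaBar_mul_dimD n k
  have h' := thetaBar_mul_dimD m l
  have e : (2 : ℤ) * (n + m - (k + l : ℕ)) = 2 * (n - k) + 2 * (m - l) := by push_cast; ring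
  rw [thetaBar_mul_dimD, e, zpow_add₀ A_ne_zero, pow_add, pow_add]
  linear_combination (-(phiBar ^ l) - thetaBar m l * dimD) * h -
    (dimD + phiBar) ^ k * A ^ (2 * (n - k)) * h'

theorem thetaBar_injective {m m' : ℤ} {l : ℕ} (h : thetaBar m l = thetaBar m' l) : m = m' := by
  have e := congrArg (· * dimD) h
  simp only [thetaBar_mul_dimD, sub_left_inj] at e
  have := A_zpow_injective (mul_left_cancel₀ (pow_ne_zero l dimD_add_phiBar_ne_zero) e)
  omega

theorem even_crossingNumber (u : List Piece) :
    Even (crossingNumber u) ↔ Even (twistNumber u) := by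
  rw [crossingNumber]
  simp [parity_simps]

/-- The capped box has the eigenvalue `A ^ t (D + φ̄) ^ l` with `t = ε + 2 (m - l)`. Once `A ^ ε` is
split off, this is the power product in `thetaBar_mul_dimD`. -/
theorem laurentToField_boxCoeff_eq {u : List Piece} {m ε : ℤ} (hε : ε = 0 ∨ ε = 1)
    (h : crossingNumber u = 2 * m + ε) :
    laurentToField (boxCoeff u) = A ^ ε * thetaBar m (lockNumber u) := by
  apply mul_right_cancel₀ dimD_ne_zero
  have hp : (if Even (twistNumber u) then 1 else A) = A ^ ε := by
    have := even_crossingNumber u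
    rw [h] at this
    rcases hε with rfl | rfl <;> simp [← this, parity_simps]
  have ht : twistNumber u = ε + 2 * (m - lockNumber u) := by
    rw [crossingNumber] at h
    linarith
  rw [laurentToField_boxCoeff, hp, mul_assoc, thetaBar_mul_dimD, ht, zpow_add₀ A_ne_zero]
  ring

/-! ## The HOMFLY polynomials -/

/-- The HOMFLY polynomials of the generalised Kanenobu diagrams. -/
theorem exists_isHomfly_kanGen {ε₁ ε₂ : ℤ} (h₁ : ε₁ = 0 ∨ ε₁ = 1) (h₂ : ε₂ = 0 ∨ ε₂ = 1)
    (j i : ℤ) : ∃ H : KqA, ∀ (u v : List Piece) (m n : ℤ),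
    crossingNumber u = 2 * m + ε₁ → crossingNumber v = 2 * n + ε₂ →
    IsHomfly (kanGen u v j i) (A ^ (-2 * m - 2 * n + 4 * (lockNumber v : ℤ) + 4 * (lockNumber u : ℤ)) *
      (phiBar ^ (lockNumber v + lockNumber u) * H +
        dimD ^ 2 * thetaBar (n + m) (lockNumber v + lockNumber u))) := by
  obtain ⟨c, hc⟩ := exists_ev_kanGen (decide (ε₁ = 0)) (decide (ε₂ = 0)) j i
  -- The exponent is minus the writhe of the diagram with `ε₁` and `ε₂` half twists in the boxes.
  refine ⟨A ^ (-ε₁ - ε₂) * laurentToField c, fun u v m n hu hv => ?_⟩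
  have p₁ : decide (Even (twistNumber u)) = decide (ε₁ = 0) := by
    rw [decide_eq_decide, ← even_crossingNumber, hu]
    rcases h₁ with rfl | rfl <;> simp [parity_simps]
  have p₂ : decide (Even (twistNumber v)) = decide (ε₂ = 0) := by
    rw [decide_eq_decide, ← even_crossingNumber, hv]
    rcases h₂ with rfl | rfl <;> simp [parity_simps]
  have e₁ : laurentToField (if decide (ε₁ = 0) then 1 else cA) = A ^ ε₁ := by
    rcases h₁ with rfl | rfl <;> simp
  have e₂ : laurentToField (if decide (ε₂ = 0) then 1 else cA) = A ^ ε₂ := by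
    rcases h₂ with rfl | rfl <;> simp
  have h := isHomfly_of_ev (hasWrithe_kanGen u v j i) (hc u v p₁ p₂)
  convert h using 1
  simp only [map_add, map_mul, map_pow, e₁, e₂, laurentToField_cD, laurentToField_cphiBar,
    laurentToField_boxCoeff_eq h₁ hu, laurentToField_boxCoeff_eq h₂ hv, thetaBar_add]
  have ew : -(twistNumber u - 2 * (lockNumber u : ℤ) + (twistNumber v - 2 * (lockNumber v : ℤ))) =
      -2 * m - 2 * n + 4 * (lockNumber v : ℤ) + 4 * (lockNumber u : ℤ) + (-ε₁ - ε₂) := by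
    rw [crossingNumber] at hu hv
    linarith
  -- Each term with a turnback carries exactly one `A ^ ε₁` and one `A ^ ε₂`, from a coefficient or
  -- from a remaining half twist; the writhe cancels them.
  have ea : A ^ (-ε₁ - ε₂) * (A ^ ε₁ * A ^ ε₂) = 1 := by
    rw [← zpow_add₀ A_ne_zero, ← zpow_add₀ A_ne_zero, ← zpow_zero A]
    congr 1
    ring
  rw [ew, zpow_add₀ A_ne_zero _ (-ε₁ - ε₂)]
  linear_combination (-A ^ (-2 * m - 2 * n + 4 * (lockNumber v : ℤ) + 4 * (lockNumber u : ℤ)) *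
    dimD ^ 2 * (phiBar ^ lockNumber u * thetaBar n (lockNumber v) +
      phiBar ^ lockNumber v * thetaBar m (lockNumber u) +
      thetaBar n (lockNumber v) * thetaBar m (lockNumber u) * dimD)) * ea

theorem crossingNumber_halfTwists {ε : ℤ} (h : ε = 0 ∨ ε = 1) :
    crossingNumber (halfTwists ε) = 2 * 0 + ε ∧ lockNumber (halfTwists ε) = 0 := by
  rcases h with rfl | rfl <;> exact ⟨rfl, rfl⟩

/-- The HOMFLY polynomial of a generalised Kanenobu diagram in terms of the Kanenobu diagram with
at most one half twist in each box. -/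
theorem isHomfly_kanGen {ε₁ ε₂ : ℤ} (h₁ : ε₁ = 0 ∨ ε₁ = 1) (h₂ : ε₂ = 0 ∨ ε₂ = 1)
    (u v : List Piece) (m n j i : ℤ)
    (hu : crossingNumber u = 2 * m + ε₁) (hv : crossingNumber v = 2 * n + ε₂) :
    IsHomfly (kan ε₁ ε₂ j i) (homfly (kan ε₁ ε₂ j i)) ∧
    IsHomfly (kanGen u v j i) (A ^ (-2 * m - 2 * n + 4 * (lockNumber v : ℤ) + 4 * (lockNumber u : ℤ)) *
      (phiBar ^ (lockNumber v + lockNumber u) * homfly (kan ε₁ ε₂ j i) +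
        dimD ^ 2 * thetaBar (n + m) (lockNumber v + lockNumber u))) := by
  obtain ⟨H, hH⟩ := exists_isHomfly_kanGen h₁ h₂ j i
  obtain ⟨k₁, l₁⟩ := crossingNumber_halfTwists h₁
  obtain ⟨k₂, l₂⟩ := crossingNumber_halfTwists h₂
  -- The unknown `H` is identified by the boxes with `ε₁` and `ε₂` half twists: there `m = n = 0`,
  -- there are no locks, and `Θ̄_{0,0} = 0`.
  have h := hH _ _ _ _ k₁ k₂
  rw [l₁, l₂] at h
  simp only [mul_zero, Nat.cast_zero, add_zero, sub_zero, zpow_zero, one_mul, pow_zero,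
    thetaBar_zero_zero] at h
  have h' : IsHomfly (kan ε₁ ε₂ j i) H := h
  rw [h'.eq_homfly]
  exact ⟨h', hH u v m n hu hv⟩

theorem exists_eq_two_mul_add (p : ℤ) : ∃ m ε : ℤ, (ε = 0 ∨ ε = 1) ∧ p = 2 * m + ε :=
  ⟨p / 2, p % 2, Int.emod_two_eq_zero_or_one p, (Int.mul_ediv_add_emod p 2).symm⟩

/-- For fixed parities, the HOMFLY polynomial depends on the sum of the crossing numbers only. -/
theorem homfly_kanGen_congr {u v u' v' : List Piece} (j i : ℤ)
    (hl : lockNumber u + lockNumber v = lockNumber u' + lockNumber v')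
    (hc : crossingNumber u + crossingNumber v = crossingNumber u' + crossingNumber v')
    (hp : Even (crossingNumber u) ↔ Even (crossingNumber u')) :
    homfly (kanGen u v j i) = homfly (kanGen u' v' j i) := by
  obtain ⟨m, ε₁, h₁, hu⟩ := exists_eq_two_mul_add (crossingNumber u)
  obtain ⟨n, ε₂, h₂, hv⟩ := exists_eq_two_mul_add (crossingNumber v)
  obtain ⟨m', δ₁, k₁, hu'⟩ := exists_eq_two_mul_add (crossingNumber u')
  obtain ⟨n', δ₂, k₂, hv'⟩ := exists_eq_two_mul_add (crossingNumber v')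
  rw [Int.even_iff, Int.even_iff] at hp
  obtain rfl : ε₁ = δ₁ := by omega
  obtain rfl : ε₂ = δ₂ := by omega
  rw [(isHomfly_kanGen h₁ h₂ u v m n j i hu hv).2.eq_homfly,
    (isHomfly_kanGen h₁ h₂ u' v' m' n' j i hu' hv').2.eq_homfly,
    show lockNumber v + lockNumber u = lockNumber v' + lockNumber u' by omega,
    show n + m = n' + m' by omega,
    show -2 * m - 2 * n + 4 * (lockNumber v : ℤ) + 4 * (lockNumber u : ℤ) =
      -2 * m' - 2 * n' + 4 * (lockNumber v' : ℤ) + 4 * (lockNumber u' : ℤ) by omega]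

/-- The usual Kanenobu diagrams with one half twist have the same HOMFLY polynomial. -/
theorem homfly_kan_one_zero : homfly (kan 1 0 1 1) = homfly (kan 0 1 1 1) := by
  obtain ⟨c, c', e, h, h'⟩ := exists_ev_boxDiagram_oneTwist
  have k := ev_kanGen_eq (u := [.twist]) (v := []) (j := 1) (i := 1) even_two even_two rfl rfl rfl
    rfl h
  have k' := ev_kanGen_eq (u := []) (v := [.twist]) (j := 1) (i := 1) even_two even_two rfl rfl rfl
    rfl h'
  -- A single half twist is its own parity tangle, so only the terms `c` and `c'` survive, with the
  -- same writhe.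
  have z : boxCoeff [.twist] = 0 := by simp [boxCoeff, twistNumber]
  have g := (isHomfly_of_ev (hasWrithe_kanGen [.twist] [] 1 1) k).eq_homfly
  have g' := (isHomfly_of_ev (hasWrithe_kanGen [] [.twist] 1 1) k').eq_homfly
  have t : kan 1 0 1 1 = kanGen [.twist] [] 1 1 := rfl
  have t' : kan 0 1 1 1 = kanGen [] [.twist] 1 1 := rfl
  rw [t, t', g, g', z]
  simp [boxCoeff, twistNumber, lockNumber, e]

/-- For the usual locks and an odd sum of the crossing numbers, the HOMFLY polynomial depends on
this sum only. -/
theorem homfly_kanGen_congr_of_odd {u v u' v' : List Piece}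
    (hl : lockNumber u + lockNumber v = lockNumber u' + lockNumber v')
    (hc : crossingNumber u + crossingNumber v = crossingNumber u' + crossingNumber v')
    (ho : Odd (crossingNumber u + crossingNumber v)) :
    homfly (kanGen u v 1 1) = homfly (kanGen u' v' 1 1) := by
  obtain ⟨m, ε₁, h₁, hu⟩ := exists_eq_two_mul_add (crossingNumber u)
  obtain ⟨n, ε₂, h₂, hv⟩ := exists_eq_two_mul_add (crossingNumber v)
  obtain ⟨m', δ₁, k₁, hu'⟩ := exists_eq_two_mul_add (crossingNumber u')
  obtain ⟨n', δ₂, k₂, hv'⟩ := exists_eq_two_mul_add (crossingNumber v')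
  rw [Int.odd_iff] at ho
  -- With an odd sum exactly one box is odd in each diagram, so both base diagrams are among the two
  -- compared in `homfly_kan_one_zero`.
  have hk : homfly (kan ε₁ ε₂ 1 1) = homfly (kan δ₁ δ₂ 1 1) := by
    have hε : ε₁ = 1 ∧ ε₂ = 0 ∨ ε₁ = 0 ∧ ε₂ = 1 := by omega
    have hδ : δ₁ = 1 ∧ δ₂ = 0 ∨ δ₁ = 0 ∧ δ₂ = 1 := by omega
    have := homfly_kan_one_zero
    rcases hε with ⟨rfl, rfl⟩ | ⟨rfl, rfl⟩ <;> rcases hδ with ⟨rfl, rfl⟩ | ⟨rfl, rfl⟩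
    exacts [rfl, this, this.symm, rfl]
  rw [(isHomfly_kanGen h₁ h₂ u v m n 1 1 hu hv).2.eq_homfly,
    (isHomfly_kanGen k₁ k₂ u' v' m' n' 1 1 hu' hv').2.eq_homfly, hk,
    show lockNumber v + lockNumber u = lockNumber v' + lockNumber u' by omega,
    show n + m = n' + m' by omega,
    show -2 * m - 2 * n + 4 * (lockNumber v : ℤ) + 4 * (lockNumber u : ℤ) =
      -2 * m' - 2 * n' + 4 * (lockNumber v' : ℤ) + 4 * (lockNumber u' : ℤ) by omega]

/-- The HOMFLY polynomials of the deformed diagrams. -/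
theorem isHomfly_kanDef (u v : List Piece) (m n : ℤ) (hu : crossingNumber u = 2 * m)
    (hv : crossingNumber v = 2 * n) :
    IsHomfly (kanDef [] []) (homfly (kanDef [] [])) ∧
    IsHomfly (kanDef u v)
      (A ^ (-2 * m - 2 * n + 4 * (lockNumber v : ℤ) + 4 * (lockNumber u : ℤ)) *
        (phiBar ^ (lockNumber v + lockNumber u) * homfly (kanDef [] []) +
          A ^ (-4 : ℤ) * (phiBar ^ lockNumber v * thetaBar m (lockNumber u) * deformedP +
            phiBar ^ lockNumber u * thetaBar n (lockNumber v) * doubleBraidP +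
            thetaBar n (lockNumber v) * thetaBar m (lockNumber u) * doubleBraidP * dimD))) := by
  obtain ⟨c₁, c₂, c₃, c₄, e₂, e₃, e₄, hc⟩ := exists_ev_kanDef
  have key (u v : List Piece) (m n : ℤ) (hu : crossingNumber u = 2 * m)
      (hv : crossingNumber v = 2 * n) : IsHomfly (kanDef u v)
      (A ^ (-2 * m - 2 * n + 4 * (lockNumber v : ℤ) + 4 * (lockNumber u : ℤ)) *
        (phiBar ^ (lockNumber v + lockNumber u) * (A ^ (-4 : ℤ) * laurentToField c₁) +
          A ^ (-4 : ℤ) * (phiBar ^ lockNumber v * thetaBar m (lockNumber u) * deformedP +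
            phiBar ^ lockNumber u * thetaBar n (lockNumber v) * doubleBraidP +
            thetaBar n (lockNumber v) * thetaBar m (lockNumber u) * doubleBraidP * dimD))) := by
    have pu : Even (twistNumber u) := by
      rw [← even_crossingNumber, hu]
      exact even_two_mul m
    have pv : Even (twistNumber v) := by
      rw [← even_crossingNumber, hv]
      exact even_two_mul n
    have h := isHomfly_of_ev (hasWrithe_kanDef pu pv) (hc u v pu pv)
    convert h using 1
    have ew : -(twistNumber u - 2 * (lockNumber u : ℤ) +
        (twistNumber v - 2 * (lockNumber v : ℤ)) + 4) =
        -2 * m - 2 * n + 4 * (lockNumber v : ℤ) + 4 * (lockNumber u : ℤ) + -4 := by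
      rw [crossingNumber] at hu hv
      linarith
    simp only [map_add, map_mul, map_pow, e₂, e₃, e₄, laurentToField_cphiBar,
      laurentToField_boxCoeff_eq (Or.inl rfl) (hu.trans (add_zero _).symm),
      laurentToField_boxCoeff_eq (Or.inl rfl) (hv.trans (add_zero _).symm), zpow_zero, one_mul]
    rw [ew, zpow_add₀ A_ne_zero _ (-4)]
    ring
  -- Empty boxes identify the undetermined constant, since both `Θ̄` vanish.
  have h₀ : IsHomfly (kanDef [] []) (A ^ (-4 : ℤ) * laurentToField c₁) := by
    have h := key [] [] 0 0 rfl rfl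
    simpa [lockNumber, thetaBar_zero_zero] using h
  rw [h₀.eq_homfly]
  exact ⟨h₀, key u v m n hu hv⟩

/-- The deformed diagrams have separate dependence on the crossing numbers. -/
theorem homfly_kanDef_eq_iff {u v u' v' : List Piece} {m n m' n' : ℤ}
    (hu : crossingNumber u = 2 * m) (hv : crossingNumber v = 2 * n)
    (hu' : crossingNumber u' = 2 * m') (hv' : crossingNumber v' = 2 * n')
    (hl : lockNumber u = lockNumber u') (hk : lockNumber v = lockNumber v')
    (hs : m + n = m' + n') :
    homfly (kanDef u v) = homfly (kanDef u' v') ↔ m = m' ∧ n = n' := by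
  rw [(isHomfly_kanDef u v m n hu hv).2.eq_homfly,
    (isHomfly_kanDef u' v' m' n' hu' hv').2.eq_homfly, hl, hk,
    show -2 * m - 2 * n + 4 * (lockNumber v' : ℤ) + 4 * (lockNumber u' : ℤ) =
      -2 * m' - 2 * n' + 4 * (lockNumber v' : ℤ) + 4 * (lockNumber u' : ℤ) by omega]
  constructor
  · intro h
    have h₁ := add_left_cancel (mul_left_cancel₀ (zpow_ne_zero _ A_ne_zero) h)
    have h₂ := mul_left_cancel₀ (zpow_ne_zero _ A_ne_zero) h₁
    have s := thetaBar_add n m (lockNumber v') (lockNumber u')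
    have s' := thetaBar_add n' m' (lockNumber v') (lockNumber u')
    rw [show n + m = n' + m' by omega] at s
    -- Subtracting `P^DB` times the expansion of `Θ̄_{n+m,k+l}`, which both sides share, removes
    -- every term with `Θ̄_{n,k}`.
    have h₃ : phiBar ^ lockNumber v' * (deformedP - doubleBraidP) *
        thetaBar m (lockNumber u') = phiBar ^ lockNumber v' * (deformedP - doubleBraidP) *
        thetaBar m' (lockNumber u') := by
      linear_combination h₂ + doubleBraidP * (s - s')
    have := thetaBar_injective (mul_left_cancel₀ (mul_ne_zero (pow_ne_zero _ phiBar_ne_zero)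
      deformedP_ne_doubleBraidP) h₃)
    omega
  · rintro ⟨rfl, rfl⟩
    rfl

end KanenobuHomfly
-- Assembly of the results on both families
theorem mainTheorem7 :
    -- the HOMFLY polynomial of the generalised Kanenobu links
    (∀ (u v : List Piece) (m n ε₁ ε₂ j i : ℤ) (k l : ℕ),
      (ε₁ = 0 ∨ ε₁ = 1) → (ε₂ = 0 ∨ ε₂ = 1) →
      crossingNumber u = 2 * m + ε₁ → lockNumber u = l →
      crossingNumber v = 2 * n + ε₂ → lockNumber v = k →
      IsHomfly (kan ε₁ ε₂ j i) (homfly (kan ε₁ ε₂ j i)) ∧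
      IsHomfly (kanGen u v j i) (homfly (kanGen u v j i)) ∧
      homfly (kanGen u v j i) =
        A ^ (-2 * m - 2 * n + 4 * (k : ℤ) + 4 * (l : ℤ)) *
          (phiBar ^ (k + l) * homfly (kan ε₁ ε₂ j i) +
            dimD ^ 2 * (phiBar ^ l * thetaBar n k + phiBar ^ k * thetaBar m l +
              thetaBar n k * thetaBar m l * dimD)) ∧
      homfly (kanGen u v j i) =
        A ^ (-2 * m - 2 * n + 4 * (k : ℤ) + 4 * (l : ℤ)) *
          (phiBar ^ (k + l) * homfly (kan ε₁ ε₂ j i) + dimD ^ 2 * thetaBar (n + m) (k + l))) ∧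
    -- for a fixed total number of opposite vertical locks and fixed parities it depends on the
    -- sum of the two crossing numbers only
    (∀ (u v u' v' : List Piece) (j i : ℤ),
      lockNumber u + lockNumber v = lockNumber u' + lockNumber v' →
      crossingNumber u + crossingNumber v = crossingNumber u' + crossingNumber v' →
      (Even (crossingNumber u) ↔ Even (crossingNumber u')) →
      homfly (kanGen u v j i) = homfly (kanGen u' v' j i)) ∧
    -- for the usual four locks outside the boxes, the two families with an odd sum coincide
    (∀ (u v u' v' : List Piece),
      lockNumber u + lockNumber v = lockNumber u' + lockNumber v' →
      crossingNumber u + crossingNumber v = crossingNumber u' + crossingNumber v' →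
      Odd (crossingNumber u + crossingNumber v) →
      homfly (kanGen u v 1 1) = homfly (kanGen u' v' 1 1)) ∧
    -- the HOMFLY polynomial of the deformed links
    (∀ (u v : List Piece) (m n : ℤ) (k l : ℕ),
      crossingNumber u = 2 * m → lockNumber u = l →
      crossingNumber v = 2 * n → lockNumber v = k →
      IsHomfly (kanDef [] []) (homfly (kanDef [] [])) ∧
      IsHomfly (kanDef u v) (homfly (kanDef u v)) ∧
      homfly (kanDef u v) =
        A ^ (-2 * m - 2 * n + 4 * (k : ℤ) + 4 * (l : ℤ)) *
          (phiBar ^ (k + l) * homfly (kanDef [] []) +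
            A ^ (-4 : ℤ) * (phiBar ^ k * thetaBar m l * deformedP +
              phiBar ^ l * thetaBar n k * doubleBraidP +
              thetaBar n k * thetaBar m l * doubleBraidP * dimD))) ∧
    -- the deformed links have separate dependence on the two crossing numbers
    (∀ (u v u' v' : List Piece) (m n m' n' : ℤ),
      crossingNumber u = 2 * m → crossingNumber v = 2 * n →
      crossingNumber u' = 2 * m' → crossingNumber v' = 2 * n' →
      lockNumber u = lockNumber u' → lockNumber v = lockNumber v' →
      m + n = m' + n' →
      (homfly (kanDef u v) = homfly (kanDef u' v') ↔ m = m' ∧ n = n')) := by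
  refine ⟨?_, fun u v u' v' j i => homfly_kanGen_congr j i, fun u v u' v' =>
    homfly_kanGen_congr_of_odd, ?_, fun u v u' v' m n m' n' => homfly_kanDef_eq_iff⟩
  · rintro u v m n ε₁ ε₂ j i k l h₁ h₂ hu rfl hv rfl
    obtain ⟨h, h'⟩ := isHomfly_kanGen h₁ h₂ u v m n j i hu hv
    rw [h'.eq_homfly]
    exact ⟨h, h', by rw [thetaBar_add], rfl⟩
  · rintro u v m n k l hu rfl hv rfl
    obtain ⟨h, h'⟩ := isHomfly_kanDef u v m n hu hv
    rw [h'.eq_homfly]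
    exact ⟨h, h', rfl⟩
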